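/- Let $k$ be an algebraically closed field (of any characteristic), let $N$ be a lattice (a finitely generated free abelian group) and let $M=\operatorname{Hom}(N,\mathbb Z)$. Let $\Sigma$ be a smooth fan in $N_{\mathbb R}$, that is, a finite fan each of whose cones is generated by part of a $\mathbb Z$-basis of $N$, and let $X=X_\Sigma$ be the corresponding smooth toric variety over $k$ ($X$ need not be complete). For a ray $\rho\in\Sigma(1)$ let $D_\rho\subset X$ be the corresponding torus-invariant prime divisor. For an integer $\ell\ge 1$ let $\mathcal F_\ell\colon X\to X$ be the toric Frobenius morphism, that is, the toric morphism induced by multiplication by $\ell$ on $N$ (on the affine chart $U_\sigma=\operatorname{Spec}k[\sigma^\vee\cap M]$ it is $\chi^m\mapsto\chi^{\ell m}$). For a divisor $D$ on $X$ let $$\operatorname{Frob}_\ell(D)\subset\operatorname{Pic}(X)$$ be the set of isomorphism classes of line bundles that are direct summands of $(\mathcal F_\ell)_*\mathcal O_X(D)$, and let $\operatorname{Frob}(D)=\bigcup_{\ell\ge1}\operatorname{Frob}_\ell(D)$. Let $\operatorname{Pic}(X)_{\mathbb R}=\operatorname{Pic}(X)\otimes_{\mathbb Z}\mathbb R$; for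 a line bundle $E$ let $[E]$ be its class in $\operatorname{Pic}(X)_{\mathbb R}$, and write $[D]=[\mathcal O_X(D)]$. Let $Z\subset\operatorname{Pic}(X)_{\mathbb R}$ be the zonotope $$Z=\operatorname{conv}\Big\{\big[-\textstyle\sum_{\rho\in A}D_\rho\big] : A\subseteq\Sigma(1)\Big\}.$$ For $p\in Z$ let $\bigstar_Z(p)$ be the union of the relative interiors of those faces of $Z$ ($Z$ itself included) that contain $p$. Then the following hold for every divisor $D$ on $X$. 1. For all sufficiently large $\ell$, every $E\in\operatorname{Frob}_\ell(D)$ satisfies $[E]\in Z$. 2. If $[D]\in Z$, then every $E\in\operatorname{Frob}(D)$ satisfies $[E]\in\bigstar_Z([D])$. Moreover, if $D=-\sum_{\rho\in A}D_\rho$ for some $A\subseteq\Sigma(1)$, then $$\operatorname{Frob}(D)=\{E\in\operatorname{Pic}(X) : [E]\in\bigstar_Z([D])\}.$$ 3. If $P\in\operatorname{Frob}(D)$ and $p=[P]$ lies in $Z$, then $[D]$ lies in the translated cone $p+\operatorname{cone}(p-Z)$, where $\operatorname{cone}(p-Z)$ is the set of all non-negative real multiples of elements of the convex set $p-Z$.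 4. For every $A\subseteq\Sigma(1)$: $\ \mathcal O_X\big(-\sum_{\rho\in A}D_\rho\big)\in\operatorname{Frob}(D)$ if and only if there are integers $r_\rho\ge0$, $\rho\in\Sigma(1)$, such that $D$ is linearly equivalent to $$-\sum_{\rho\in A}D_\rho+\sum_{\rho\notin A}r_\rho D_\rho-\sum_{\rho\in A}r_\rho D_\rho .$$ -/

import Mathlib

open CategoryTheory CategoryTheory.Limits AlgebraicGeometry TopologicalSpace
open scoped TensorProduct

universe u

noncomputable section

namespace Toric

/-- The structure sheaf `𝒪_X`, as a module over itself. -/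
abbrev structureModule (X : Scheme.{u}) : X.Modules := SheafOfModules.unit X.ringCatSheaf

/-- A sheaf of modules generated freely by one global section is isomorphic to `𝒪_X`. -/
theorem nonempty_iso_of_generator {X : Scheme.{u}} (M : X.Modules) (s : Γ(M, ⊤))
    (hs : ∀ V : X.Opens, Function.Bijective
      (fun r : Γ(X, V) => r • (M.presheaf.map (homOfLE le_top).op s : Γ(M, V)))) :
    Nonempty (M ≅ structureModule X) := by
  let φ : structureModule X ⟶ M :=
   ⟨PresheafOfModules.homMk
      { app := fun V => AddCommGrpCat.ofHom (LinearMap.toSpanSingleton (Γ(X, V.unop))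
          (Γ(M, V.unop)) (M.presheaf.map (homOfLE le_top).op s : Γ(M, V.unop))).toAddMonoidHom
        naturality := fun V W f => by
          ext (r : Γ(X, V.unop))
          change (X.presheaf.map f.unop.op r : Γ(X, W.unop)) •
            (M.presheaf.map (homOfLE le_top).op s : Γ(M, W.unop)) =
            M.presheaf.map f.unop.op
              (r • (M.presheaf.map (homOfLE le_top).op s : Γ(M, V.unop)))
          rw [Scheme.Modules.map_smul, ← ConcreteCategory.comp_apply, ← Functor.map_comp]
          rfl }
      (fun V r m => mul_smul (α := Γ(X, V.unop)) (β := Γ(M, V.unop)) r m _)⟩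
  have : IsIso φ := by
    rw [Scheme.Modules.Hom.isIso_iff_isIso_app]
    intro U
    rw [ConcreteCategory.isIso_iff_bijective]
    exact hs U
  exact ⟨(asIso φ).symm⟩

section Restriction

/-- The restriction map of the structure sheaf. -/
def res {X : Scheme.{u}} {V W : X.Opens} (h : W ≤ V) : Γ(X, V) →+* Γ(X, W) :=
  (X.presheaf.map (homOfLE h).op).hom

theorem res_res {X : Scheme.{u}} {V W W' : X.Opens} (h : W ≤ V) (h' : W' ≤ W) (f : Γ(X, V)) :
    res h' (res h f) = res (h'.trans h) f := by
  change X.presheaf.map _ (X.presheaf.map _ f) = _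
  rw [← ConcreteCategory.comp_apply, ← Functor.map_comp]
  rfl

theorem app_res {T X : Scheme.{u}} (j : T ⟶ X) {V W : X.Opens} (h : W ≤ V) (f : Γ(X, V)) :
    j.app W (res h f) = res (j.preimage_mono h) (j.app V f) := by
  change j.app W (X.presheaf.map _ f) = T.presheaf.map _ (j.app V f)
  rw [← ConcreteCategory.comp_apply, ← ConcreteCategory.comp_apply, j.naturality]
  rfl

end Restriction

section Cartier

variable {T X : Scheme.{u}} (j : T ⟶ X) {I : Type u} (U : I → X.Opens) (h : I → Γ(T, ⊤))

/-- Let `h i` be functions on `T`, thought of as rational functions on `X` attached to the open sets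
`U i`.  The function `f` on `j⁻¹ V` is a regular section over `V` if each product `h i * f` extends,
locally around every point of `V ∩ U i`, to a regular function on `X`. -/
def IsRegularSection (V : X.Opens) (f : Γ(T, j ⁻¹ᵁ V)) : Prop :=
  ∀ i : I, ∀ x ∈ V, x ∈ U i → ∃ (W : X.Opens) (hW : W ≤ V), x ∈ W ∧ ∃ g : Γ(X, W),
    j.app W g = res le_top (h i) * res (j.preimage_mono hW) f

variable {U h}

theorem IsRegularSection.res {V V' : X.Opens} (hV : V' ≤ V) {f : Γ(T, j ⁻¹ᵁ V)}
    (hf : IsRegularSection j U h V f) :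
    IsRegularSection j U h V' (res (j.preimage_mono hV) f) := by
  intro i x hx hi
  obtain ⟨W, hW, hxW, g, hg⟩ := hf i x (hV hx) hi
  refine ⟨W ⊓ V', inf_le_right, ⟨hxW, hx⟩, Toric.res inf_le_left g, ?_⟩
  rw [app_res, hg, map_mul, res_res, res_res, res_res]

theorem IsRegularSection.smul {V : X.Opens} (r : Γ(X, V)) {f : Γ(T, j ⁻¹ᵁ V)}
    (hf : IsRegularSection j U h V f) : IsRegularSection j U h V (j.app V r * f) := by
  intro i x hx hi
  obtain ⟨W, hW, hxW, g, hg⟩ := hf i x hx hi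
  refine ⟨W, hW, hxW, Toric.res hW r * g, ?_⟩
  rw [map_mul, app_res, hg, map_mul]
  ring

theorem IsRegularSection.add {V : X.Opens} {f f' : Γ(T, j ⁻¹ᵁ V)}
    (hf : IsRegularSection j U h V f) (hf' : IsRegularSection j U h V f') :
    IsRegularSection j U h V (f + f') := by
  intro i x hx hi
  obtain ⟨W, hW, hxW, g, hg⟩ := hf i x hx hi
  obtain ⟨W', hW', hxW', g', hg'⟩ := hf' i x hx hi
  refine ⟨W ⊓ W', inf_le_left.trans hW, ⟨hxW, hxW'⟩,
    Toric.res inf_le_left g + Toric.res inf_le_right g', ?_⟩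
  rw [map_add, app_res, app_res, hg, hg', map_mul, map_mul, map_add, res_res, res_res, res_res,
    res_res]
  ring

theorem isRegularSection_zero (V : X.Opens) : IsRegularSection j U h V 0 :=
  fun _ _ hx _ => ⟨V, le_rfl, hx, 0, by simp⟩

/-- Regularity is a local condition. -/
theorem IsRegularSection.of_locally {V : X.Opens} {f : Γ(T, j ⁻¹ᵁ V)}
    (hf : ∀ x ∈ V, ∃ (V' : X.Opens) (hV : V' ≤ V), x ∈ V' ∧
      IsRegularSection j U h V' (Toric.res (j.preimage_mono hV) f)) :
    IsRegularSection j U h V f := by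
  intro i x hx hi
  obtain ⟨V', hV, hxV', hf'⟩ := hf x hx
  obtain ⟨W, hW, hxW, g, hg⟩ := hf' i x hxV' hi
  refine ⟨W, hW.trans hV, hxW, g, ?_⟩
  rw [hg, res_res]

variable (U h)

/-- The regular sections, as a family of submodules of `j_* 𝒪_T`. -/
def cartierSubmodule :
    PresheafOfModules.Submodule ((Scheme.Modules.pushforward j).obj (structureModule T)).val where
  obj V :=
    { carrier := {f : Γ(T, j ⁻¹ᵁ V.unop) | IsRegularSection j U h V.unop f}
      add_mem' := fun hf hf' => IsRegularSection.add j hf hf'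
      zero_mem' := isRegularSection_zero j V.unop
      smul_mem' := fun r _ hf => IsRegularSection.smul j r hf }
  map := fun f _ hx => IsRegularSection.res j (leOfHom f.unop) hx

/-- The subsheaf of `j_* 𝒪_T` of the regular sections.  If `T` is a dense open subset of an integral
scheme `X` and the `h i` are the local equations, on the open sets `U i`, of a Cartier divisor `D`
supported in the complement of `T`, this is the sheaf `𝒪_X(D)`. -/
def cartierModule : X.Modules where
  val := (cartierSubmodule j U h).toPresheafOfModules
  isSheaf := by
    change TopCat.Presheaf.IsSheaf _
    rw [TopCat.Presheaf.isSheaf_iff_isSheafUniqueGluing]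
    intro κ V s hs
    let A := (Scheme.Modules.pushforward j).obj (structureModule T)
    let F : TopCat.Sheaf Ab X := ⟨A.presheaf, A.isSheaf⟩
    obtain ⟨t, ht, huniq⟩ := F.existsUnique_gluing V (fun i => (s i).1) (fun a b =>
      congrArg Subtype.val (hs a b))
    refine ⟨⟨t, ?_⟩, fun a => Subtype.ext (ht a), fun t' ht' => Subtype.ext
      (huniq t'.1 fun a => congrArg Subtype.val (ht' a))⟩
    refine IsRegularSection.of_locally j fun x hx => ?_
    obtain ⟨a, ha⟩ := Opens.mem_iSup.1 hx
    refine ⟨V a, le_iSup V a, ha, ?_⟩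
    have h1 : res (j.preimage_mono (le_iSup V a)) t = (s a).1 := ht a
    rw [h1]
    exact (s a).2

end Cartier

/-- Invertible sheaves: sheaves of modules which are locally isomorphic to `𝒪_X`. -/
def IsInvertible {X : Scheme.{u}} (L : X.Modules) : Prop :=
  ∀ x : X, ∃ U : X.Opens, x ∈ U ∧
    Nonempty (L.restrict U.ι ≅ structureModule (U : Scheme.{u}))

section Cartier

variable {T X : Scheme.{u}} (j : T ⟶ X) {I : Type u} (U : I → X.Opens) (h : I → Γ(T, ⊤))

variable {U h} in
theorem exists_regular_extension (hinj : ∀ V : X.Opens, Function.Injective (j.app V))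
    {V : X.Opens} {f : Γ(T, j ⁻¹ᵁ V)} (hf : IsRegularSection j U h V f) (i : I) (hV : V ≤ U i) :
    ∃ g : Γ(X, V), j.app V g = res le_top (h i) * f := by
  choose W hW hxW g hg using fun x : V => hf i x.1 x.2 (hV x.2)
  have hcov : V ≤ iSup W := fun x hx => Opens.mem_iSup.2 ⟨⟨x, hx⟩, hxW ⟨x, hx⟩⟩
  obtain ⟨(G : Γ(X, V)), hG, -⟩ := X.sheaf.existsUnique_gluing' W V (fun x => homOfLE (hW x)) hcov g (by
    intro x y
    change res inf_le_left (g x) = res inf_le_right (g y)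
    apply hinj
    rw [app_res, app_res, hg, hg, map_mul, map_mul, res_res, res_res, res_res, res_res])
  refine ⟨G, T.sheaf.eq_of_locally_eq' (fun x => j ⁻¹ᵁ (W x)) (j ⁻¹ᵁ V)
    (fun x => homOfLE (j.preimage_mono (hW x))) (fun y hy => ?_) _ _ fun x => ?_⟩
  · obtain ⟨a, ha⟩ := Opens.mem_iSup.1 (hcov hy)
    exact Opens.mem_iSup.2 ⟨a, ha⟩
  · change res (j.preimage_mono (hW x)) (j.app V G) = res (j.preimage_mono (hW x)) (_ * f)
    have h1 : res (hW x) G = g x := hG x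
    rw [← app_res j (hW x), h1, hg, map_mul, res_res]

theorem isInvertible_cartierModule (hinj : ∀ V : X.Opens, Function.Injective (j.app V))
    (hcov : ∀ x, ∃ i, x ∈ U i) (hunit : ∀ i, IsUnit (h i))
    (hcomp : ∀ i i' x, x ∈ U i → x ∈ U i' → ∃ W : X.Opens, x ∈ W ∧ ∃ g : Γ(X, W),
      j.app W g * res le_top (h i) = res le_top (h i')) :
    IsInvertible (cartierModule j U h) := by
  intro x
  obtain ⟨i, hi⟩ := hcov x
  refine ⟨U i, hi, ?_⟩
  obtain ⟨v, hv⟩ := (hunit i).exists_right_inv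
  have hle : (U i).ι ''ᵁ ⊤ ≤ U i := by simp
  have hreg : IsRegularSection j U h ((U i).ι ''ᵁ ⊤) (res le_top v) := by
    intro i' y hy hi'
    obtain ⟨W, hyW, g, hg⟩ := hcomp i i' y (hle hy) hi'
    refine ⟨W ⊓ (U i).ι ''ᵁ ⊤, inf_le_right, ⟨hyW, hy⟩, res inf_le_left g, ?_⟩
    have h1 := congrArg (res (j.preimage_mono (inf_le_left : W ⊓ (U i).ι ''ᵁ ⊤ ≤ W))) hg
    rw [map_mul, res_res, res_res] at h1
    rw [app_res, res_res, ← h1, mul_assoc, ← map_mul, hv, map_one, mul_one]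
  refine nonempty_iso_of_generator ((cartierModule j U h).restrict (U i).ι) ⟨_, hreg⟩ fun V => ?_
  have hV : (U i).ι ''ᵁ V ≤ U i := (Scheme.Hom.image_mono _ le_top).trans hle
  have hval (r : Γ(X, (U i).ι ''ᵁ V)) :
      ((show Γ((cartierModule j U h).restrict (U i).ι, V) from
        (show Γ((U i : Scheme.{u}), V) from r) •
        (((cartierModule j U h).restrict (U i).ι).presheaf.map (homOfLE le_top).op
          (⟨_, hreg⟩ : Γ((cartierModule j U h).restrict (U i).ι, ⊤)))) :
          cartierSubmodule j U h |>.obj (.op ((U i).ι ''ᵁ V))).1 =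
        j.app ((U i).ι ''ᵁ V) r * res le_top v := by
    trans j.app ((U i).ι ''ᵁ V) (((U i).ι.appIso V).inv r) *
      res (j.preimage_mono (Scheme.Hom.image_mono _ le_top)) (res le_top v)
    · rfl
    · rw [res_res, Scheme.Opens.ι_appIso]
      rfl
  constructor
  · intro a b hab
    have h1 : j.app ((U i).ι ''ᵁ V) a * res le_top v = j.app ((U i).ι ''ᵁ V) b * res le_top v :=
      (hval a).symm.trans ((congrArg Subtype.val hab).trans (hval b))
    apply hinj ((U i).ι ''ᵁ V)
    have h2 := congrArg (· * res le_top (h i)) h1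
    simp only [mul_assoc, ← map_mul, mul_comm v, hv, map_one, mul_one] at h2
    exact h2
  · rintro ⟨f, hf⟩
    obtain ⟨(g : Γ(X, (U i).ι ''ᵁ V)), hg⟩ := exists_regular_extension j hinj hf i hV
    have h3 (f' : Γ(T, j ⁻¹ᵁ ((U i).ι ''ᵁ V)))
        (hf' : j.app ((U i).ι ''ᵁ V) g = res le_top (h i) * f') :
        j.app ((U i).ι ''ᵁ V) g * res le_top v = f' := by
      rw [hf', mul_right_comm, ← map_mul, hv, map_one, one_mul]
    exact ⟨g, Subtype.ext ((hval g).trans (h3 f hg))⟩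

end Cartier

section Picard

/-- The tensor product of sheaves of modules: the sheafification of
`U ↦ Γ(L, U) ⊗ Γ(L', U)`. -/
def tensorModule {X : Scheme.{u}} (L L' : X.Modules) : X.Modules :=
  (PresheafOfModules.sheafification (𝟙 X.ringCatSheaf.obj)).obj
    (PresheafOfModules.Monoidal.tensorObj (R := X.presheaf) L.val L'.val)

/-- Line bundles on `X`. -/
def LineBundle (X : Scheme.{u}) : Type (u + 1) := {L : X.Modules // IsInvertible L}

/-- The equivalence relation of isomorphism on line bundles. -/
instance lineBundleSetoid (X : Scheme.{u}) : Setoid (LineBundle X) where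
  r L L' := Nonempty (L.1 ≅ L'.1)
  iseqv := ⟨fun L => ⟨Iso.refl L.1⟩, fun ⟨e⟩ => ⟨e.symm⟩, fun ⟨e⟩ ⟨e'⟩ => ⟨e.trans e'⟩⟩

/-- `Pic(X)`, as the set of isomorphism classes of line bundles. -/
def Pic (X : Scheme.{u}) : Type (u + 1) := Quotient (lineBundleSetoid X)

/-- The isomorphism class of a line bundle. -/
def LineBundle.cls {X : Scheme.{u}} (L : LineBundle X) : Pic X := Quotient.mk _ L

/-- The relations `[L ⊗ L'] = [L] + [L']` of the group law of `Pic(X)`. -/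
def picRelations (X : Scheme.{u}) : Set (Pic X →₀ ℝ) :=
  {v | ∃ L L' L'' : LineBundle X, Nonempty (L''.1 ≅ tensorModule L.1 L'.1) ∧
    v = Finsupp.single L''.cls 1 - (Finsupp.single L.cls 1 + Finsupp.single L'.cls 1)}

/-- The real Picard group `Pic(X)_ℝ = Pic(X) ⊗ ℝ`: the real vector space generated by the classes of
line bundles, subject to the relations of the group law `[L ⊗ L'] = [L] + [L']` of `Pic(X)`. -/
abbrev PicReal (X : Scheme.{u}) : Type (u + 1) :=
  (Pic X →₀ ℝ) ⧸ Submodule.span ℝ (picRelations X)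

/-- The canonical map `Pic(X) → Pic(X)_ℝ`. -/
def Pic.toReal {X : Scheme.{u}} (P : Pic X) : PicReal X :=
  Submodule.Quotient.mk (Finsupp.single P 1)

end Picard

section Convex

variable {V : Type*} [AddCommGroup V] [Module ℝ V]

/-- Faces of a convex set `Z` (`Z` itself included): its convex extreme subsets. -/
def IsFace (Z F : Set V) : Prop := Convex ℝ F ∧ IsExtreme ℝ Z F

/-- The relative interior of a convex subset `F` of a finite-dimensional space: the points `x` of `F`
such that every segment in `F` that ends in `x` can be prolonged beyond `x` inside `F`. -/
def relInterior (F : Set V) : Set V :=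
  {x | x ∈ F ∧ ∀ y ∈ F, ∃ ε : ℝ, 0 < ε ∧ x + ε • (x - y) ∈ F}

/-- The open star of `p` in `Z`: the union of the relative interiors of the faces of `Z` that
contain `p`. -/
def openStar (Z : Set V) (p : V) : Set V :=
  {x | ∃ F : Set V, IsFace Z F ∧ p ∈ F ∧ x ∈ relInterior F}

/-- The translated cone `p + cone(p - Z)`. -/
def translatedCone (Z : Set V) (p : V) : Set V :=
  {q | q - p ∈ PointedCone.hull ℝ ((fun z => p - z) '' Z)}

end Convex

section Fan

variable (N : Type u) [AddCommGroup N] (ι : Type u)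

/-- The convex cone in `N_ℝ = ℝ ⊗ N` generated by the vectors `v ρ`, `ρ ∈ s`. -/
def realCone {N : Type u} [AddCommGroup N] {ι : Type u} (v : ι → N) (s : Set ι) :
    PointedCone ℝ (ℝ ⊗[ℤ] N) :=
  PointedCone.hull ℝ ((fun ρ => (1 : ℝ) ⊗ₜ[ℤ] v ρ) '' s)

/-- A smooth fan in the lattice `N`, with rays indexed by `ι = Σ(1)`.  A cone of a smooth fan is
simplicial, so it is recorded by the set of its rays: `σ ∈ cones` stands for the cone spanned by
the primitive generators `ray ρ`, `ρ ∈ σ`, and its faces are the cones of the subsets of `σ`. -/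
structure SmoothFan where
  /-- the primitive generator `u_ρ` of the ray `ρ` -/
  ray : ι → N
  /-- the cones of the fan, given by their sets of rays -/
  cones : Set (Finset ι)
  /-- the zero cone belongs to the fan -/
  empty_mem : ∅ ∈ cones
  /-- every index is a ray of the fan -/
  singleton_mem : ∀ ρ, {ρ} ∈ cones
  /-- faces of cones of the fan belong to the fan -/
  face_mem : ∀ σ ∈ cones, ∀ τ ⊆ σ, τ ∈ cones
  /-- two cones intersect in the common face spanned by their common rays -/
  inter : ∀ σ ∈ cones, ∀ τ ∈ cones,
    realCone ray (σ : Set ι) ⊓ realCone ray (τ : Set ι) = realCone ray ((σ : Set ι) ∩ (τ : Set ι))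
  /-- smoothness: the generators of each cone are part of a `ℤ`-basis of `N` -/
  smooth : ∀ σ ∈ cones, ∃ (b : Module.Basis (Fin (Module.finrank ℤ N)) ℤ N)
    (e : σ ↪ Fin (Module.finrank ℤ N)), ∀ ρ : σ, b (e ρ) = ray ρ

end Fan

/-- The coefficients of the divisor `-∑_{ρ ∈ A} D_ρ`. -/
def cubeVertex {ι : Type u} (A : Set ι) : ι → ℤ := A.indicator fun _ => -1

/-- The coefficients of the divisor
`-∑_{ρ ∈ A} D_ρ + ∑_{ρ ∉ A} r_ρ D_ρ - ∑_{ρ ∈ A} r_ρ D_ρ`. -/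
def coneDivisor {ι : Type u} (A : Set ι) (r : ι → ℕ) : ι → ℤ :=
  cubeVertex A + Aᶜ.indicator (fun ρ => (r ρ : ℤ)) - A.indicator fun ρ => (r ρ : ℤ)

namespace SmoothFan

variable {N : Type u} [AddCommGroup N] {ι : Type u} (Δ : SmoothFan N ι)

/-- The poset of cones of the fan, ordered by inclusion. -/
abbrev Cone : Type u := {σ : Finset ι // σ ∈ Δ.cones}

/-- The monoid `σ^∨ ∩ M`, where `M = Hom(N, ℤ)`. -/
def dualMonoid (σ : Δ.Cone) : AddSubmonoid (Module.Dual ℤ N) where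
  carrier := {m | ∀ ρ ∈ σ.1, 0 ≤ m (Δ.ray ρ)}
  add_mem' ha hb ρ hρ := add_nonneg (ha ρ hρ) (hb ρ hρ)
  zero_mem' _ _ := le_rfl

theorem dualMonoid_anti {σ τ : Δ.Cone} (h : σ ≤ τ) : Δ.dualMonoid τ ≤ Δ.dualMonoid σ :=
  fun _ hm ρ hρ => hm ρ (h hρ)

theorem exists_dual (σ : Δ.Cone) (a : ι → ℤ) :
    ∃ m : Module.Dual ℤ N, ∀ ρ ∈ σ.1, m (Δ.ray ρ) = a ρ := by
  classical
  obtain ⟨b, e, he⟩ := Δ.smooth σ.1 σ.2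
  refine ⟨∑ ρ : σ.1, a ρ • b.coord (e ρ), fun ρ hρ => ?_⟩
  rw [← he ⟨ρ, hρ⟩]
  simp only [LinearMap.sum_apply, LinearMap.smul_apply, Module.Basis.coord_apply,
    Module.Basis.repr_self, smul_eq_mul]
  rw [Finset.sum_eq_single (⟨ρ, hρ⟩ : σ.1)]
  · simp
  · intro τ _ hτ
    rw [Finsupp.single_apply, if_neg]
    · simp
    · intro h
      exact hτ (e.injective h.symm)
  · simp

variable (k : Type u) [Field k]

/-- The coordinate ring `k[σ^∨ ∩ M]` of the affine chart of the cone `σ`. -/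
abbrev chartRing (σ : Δ.Cone) : Type u := AddMonoidAlgebra k (Δ.dualMonoid σ)

/-- The inclusion `k[τ^∨ ∩ M] → k[σ^∨ ∩ M]` for a face `σ` of `τ`. -/
def chartRingMap {σ τ : Δ.Cone} (h : σ ≤ τ) : Δ.chartRing k τ →+* Δ.chartRing k σ :=
  AddMonoidAlgebra.mapDomainRingHom k (AddSubmonoid.inclusion (Δ.dualMonoid_anti h))

/-- The diagram of affine charts `U_σ = Spec k[σ^∨ ∩ M]`, indexed by the poset of cones. -/
def charts : Δ.Cone ⥤ Scheme.{u} where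
  obj σ := Spec (CommRingCat.of (Δ.chartRing k σ))
  map f := Spec.map (CommRingCat.ofHom (Δ.chartRingMap k (leOfHom f)))
  map_id σ := by
    rw [← Spec.map_id]
    congr 1
    ext : 1
    exact AddMonoidAlgebra.mapDomainRingHom_id
  map_comp f g := by
    rw [← Spec.map_comp, ← CommRingCat.ofHom_comp]
    congr 2
    exact AddMonoidAlgebra.mapDomainRingHom_comp (R := k)
      (AddSubmonoid.inclusion (Δ.dualMonoid_anti (leOfHom f)))
      (AddSubmonoid.inclusion (Δ.dualMonoid_anti (leOfHom g)))

theorem chartRingMap_single {σ τ : Δ.Cone} (h : σ ≤ τ) (m : Δ.dualMonoid τ) (r : k) :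
    Δ.chartRingMap k h (AddMonoidAlgebra.single m r) =
      AddMonoidAlgebra.single (AddSubmonoid.inclusion (Δ.dualMonoid_anti h) m) r :=
  AddMonoidAlgebra.mapDomain_single

theorem chartRingMap_injective {σ τ : Δ.Cone} (h : σ ≤ τ) :
    Function.Injective (Δ.chartRingMap k h) :=
  AddMonoidAlgebra.mapDomain_injective (AddSubmonoid.inclusion_injective _)

/-- The character `χ^m` as a regular function on `U_σ`, for `m ∈ σ^∨ ∩ M`. -/
def monomial (σ : Δ.Cone) (m : Δ.dualMonoid σ) : Δ.chartRing k σ :=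
  AddMonoidAlgebra.single m 1

theorem isUnit_monomial (σ : Δ.Cone) (m : Δ.dualMonoid σ) (hm : ∀ ρ ∈ σ.1, m.1 (Δ.ray ρ) = 0) :
    IsUnit (Δ.monomial k σ m) := by
  have hneg : -m.1 ∈ Δ.dualMonoid σ := fun ρ hρ => by simp [hm ρ hρ]
  refine IsUnit.of_mul_eq_one (Δ.monomial k σ ⟨-m.1, hneg⟩) ?_
  rw [monomial, monomial, AddMonoidAlgebra.single_mul_single, AddMonoidAlgebra.one_def]
  congr 1
  · ext1
    simp
  · simp

theorem isLocalization_chartRingMap {σ τ : Δ.Cone} (h : σ ≤ τ) (m : Δ.dualMonoid τ)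
    (h0 : ∀ ρ ∈ σ.1, m.1 (Δ.ray ρ) = 0) (h1 : ∀ ρ ∈ τ.1, ρ ∉ σ.1 → 0 < m.1 (Δ.ray ρ)) :
    letI := (Δ.chartRingMap k h).toAlgebra
    IsLocalization.Away (Δ.monomial k τ m) (Δ.chartRing k σ) := by
  let _ := (Δ.chartRingMap k h).toAlgebra
  have key : ∀ n : ℕ, algebraMap (Δ.chartRing k τ) (Δ.chartRing k σ) (Δ.monomial k τ m) ^ n =
      AddMonoidAlgebra.single (n • AddSubmonoid.inclusion (Δ.dualMonoid_anti h) m) 1 := by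
    intro n
    change Δ.chartRingMap k h (Δ.monomial k τ m) ^ n = _
    rw [monomial, chartRingMap_single, AddMonoidAlgebra.single_pow, one_pow]
  refine IsLocalization.Away.mk _ ?_ ?_ ?_
  · change IsUnit (Δ.chartRingMap k h (Δ.monomial k τ m))
    rw [monomial, chartRingMap_single]
    exact Δ.isUnit_monomial k σ _ h0
  · intro x
    induction x using AddMonoidAlgebra.induction_linear with
    | zero => exact ⟨0, 0, by simp⟩
    | add f g hf hg =>
      obtain ⟨n, a, ha⟩ := hf
      obtain ⟨n', a', ha'⟩ := hg
      refine ⟨n + n', a * Δ.monomial k τ m ^ n' + a' * Δ.monomial k τ m ^ n, ?_⟩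
      rw [map_add, map_mul, map_mul, map_pow, map_pow, ← ha, ← ha']
      ring
    | single s r =>
      obtain ⟨n, hn⟩ : ∃ n : ℕ, ∀ ρ ∈ τ.1, - s.1 (Δ.ray ρ) ≤ n := by
        refine ⟨∑ ρ ∈ τ.1, (s.1 (Δ.ray ρ)).natAbs, fun ρ hρ => ?_⟩
        have h2 := Finset.single_le_sum (f := fun ρ => (s.1 (Δ.ray ρ)).natAbs)
          (fun _ _ => Nat.zero_le _) hρ
        have h3 : (((s.1 (Δ.ray ρ)).natAbs : ℕ) : ℤ) ≤
          ((∑ ρ ∈ τ.1, (s.1 (Δ.ray ρ)).natAbs : ℕ) : ℤ) := by exact_mod_cast h2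
        have h4 : - s.1 (Δ.ray ρ) ≤ (((s.1 (Δ.ray ρ)).natAbs : ℕ) : ℤ) := by omega
        exact h4.trans h3
      have hmem : s.1 + n • m.1 ∈ Δ.dualMonoid τ := by
        intro ρ hρ
        by_cases hσ : ρ ∈ σ.1
        · simpa [h0 ρ hσ] using s.2 ρ hσ
        · have h5 := h1 ρ hρ hσ
          have h6 := hn ρ hρ
          have h7 : (n : ℤ) ≤ n * m.1 (Δ.ray ρ) := by nlinarith
          simp only [LinearMap.add_apply, LinearMap.smul_apply, nsmul_eq_mul]
          linarith
      refine ⟨n, AddMonoidAlgebra.single ⟨_, hmem⟩ r, ?_⟩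
      rw [key]
      change _ = Δ.chartRingMap k h _
      rw [chartRingMap_single, AddMonoidAlgebra.single_mul_single, mul_one]
      congr 1
  · intro a b hab
    exact ⟨0, by rw [Δ.chartRingMap_injective k h hab]⟩

theorem exists_face_character {σ τ : Δ.Cone} (_ : σ ≤ τ) : ∃ m : Δ.dualMonoid τ,
    (∀ ρ ∈ σ.1, m.1 (Δ.ray ρ) = 0) ∧ (∀ ρ ∈ τ.1, ρ ∉ σ.1 → 0 < m.1 (Δ.ray ρ)) := by
  classical
  obtain ⟨m, hm⟩ := Δ.exists_dual τ (fun ρ => if ρ ∈ σ.1 then 0 else 1)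
  refine ⟨⟨m, fun ρ hρ => ?_⟩, fun ρ hρ => ?_, fun ρ hρ hσ => ?_⟩
  · rw [hm ρ hρ]
    split_ifs <;> simp
  · have hτ : ρ ∈ τ.1 := by
      rename_i h
      exact h hρ
    simpa [hρ] using hm ρ hτ
  · simpa [hσ] using (hm ρ hρ).symm ▸ (by simp [hσ] : (0 : ℤ) < if ρ ∈ σ.1 then 0 else 1)

theorem isOpenImmersion_charts {σ τ : Δ.Cone} (f : σ ⟶ τ) :
    IsOpenImmersion ((Δ.charts k).map f) := by
  obtain ⟨m, h0, h1⟩ := Δ.exists_face_character (leOfHom f)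
  let _ := (Δ.chartRingMap k (leOfHom f)).toAlgebra
  have := Δ.isLocalization_chartRingMap k (leOfHom f) m h0 h1
  exact IsOpenImmersion.of_isLocalization (Δ.monomial k τ m)

instance {σ τ : Δ.Cone} (f : σ ⟶ τ) : IsOpenImmersion ((Δ.charts k).map f) :=
  Δ.isOpenImmersion_charts k f

theorem range_charts {σ τ : Δ.Cone} (f : σ ⟶ τ) (m : Δ.dualMonoid τ)
    (h0 : ∀ ρ ∈ σ.1, m.1 (Δ.ray ρ) = 0) (h1 : ∀ ρ ∈ τ.1, ρ ∉ σ.1 → 0 < m.1 (Δ.ray ρ)) :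
    Set.range ((Δ.charts k).map f) =
      (PrimeSpectrum.basicOpen (Δ.monomial k τ m) : Set (PrimeSpectrum (Δ.chartRing k τ))) := by
  let _ := (Δ.chartRingMap k (leOfHom f)).toAlgebra
  have := Δ.isLocalization_chartRingMap k (leOfHom f) m h0 h1
  exact PrimeSpectrum.localization_away_comap_range (Δ.chartRing k σ) (Δ.monomial k τ m)

instance isLocallyDirected_charts :
    (Δ.charts k ⋙ Scheme.forget).IsLocallyDirected where
  cond {i j l} fi fj xi xj hx := by
    classical
    let p : Δ.Cone := ⟨i.1 ∩ j.1, Δ.face_mem i.1 i.2 _ Finset.inter_subset_left⟩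
    have hpi : p ≤ i := Finset.inter_subset_left
    have hpj : p ≤ j := Finset.inter_subset_right
    obtain ⟨mi, hi0, hi1⟩ := Δ.exists_face_character (leOfHom fi)
    obtain ⟨mj, hj0, hj1⟩ := Δ.exists_face_character (leOfHom fj)
    have e1 := Δ.range_charts k fi mi hi0 hi1
    have e2 := Δ.range_charts k fj mj hj0 hj1
    have e3 := Δ.range_charts k (homOfLE (hpi.trans (leOfHom fi))) (mi + mj) (fun ρ hρ => by
        simp only [AddSubmonoid.coe_add, LinearMap.add_apply]
        rw [hi0 ρ (hpi hρ), hj0 ρ (hpj hρ), add_zero]) (fun ρ hρ hρ' => by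
        simp only [AddSubmonoid.coe_add, LinearMap.add_apply]
        have hi := mi.2 ρ hρ
        have hj := mj.2 ρ hρ
        by_cases h : ρ ∈ i.1
        · have : ρ ∉ j.1 := fun h' => hρ' (Finset.mem_inter.2 ⟨h, h'⟩)
          have := hj1 ρ hρ this
          omega
        · have := hi1 ρ hρ h
          omega)
    have hxi : (Δ.charts k).map fi xi ∈ Set.range ((Δ.charts k).map fi) := ⟨xi, rfl⟩
    have hx' : (Δ.charts k).map fi xi = (Δ.charts k).map fj xj := hx
    have hxj : (Δ.charts k).map fi xi ∈ Set.range ((Δ.charts k).map fj) := ⟨xj, hx'.symm⟩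
    have hmul : Δ.monomial k l (mi + mj) = Δ.monomial k l mi * Δ.monomial k l mj := by
      rw [monomial, monomial, monomial, AddMonoidAlgebra.single_mul_single, mul_one]
    have hmem : (Δ.charts k).map fi xi ∈
        Set.range ((Δ.charts k).map (homOfLE (hpi.trans (leOfHom fi)))) := by
      rw [e3, hmul, PrimeSpectrum.basicOpen_mul]
      rw [e1] at hxi
      rw [e2] at hxj
      exact ⟨hxi, hxj⟩
    obtain ⟨x, hx⟩ := hmem
    refine ⟨p, homOfLE hpi, homOfLE hpj, x, ?_, ?_⟩
    · apply ((Δ.charts k).map fi).isOpenEmbedding.injective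
      rw [← hx]
      change ((Δ.charts k).map (homOfLE hpi) ≫ (Δ.charts k).map fi) x = _
      rw [← Functor.map_comp]
      rfl
    · apply ((Δ.charts k).map fj).isOpenEmbedding.injective
      rw [← hx', ← hx]
      change ((Δ.charts k).map (homOfLE hpj) ≫ (Δ.charts k).map fj) x = _
      rw [← Functor.map_comp]
      rfl

/-- The smooth toric variety `X_Σ` over `k`: the charts `U_σ = Spec k[σ^∨ ∩ M]` glued along the
open inclusions `U_σ ⊆ U_τ` for faces `σ` of `τ`. -/
def variety : Scheme.{u} := colimit (Δ.charts k)

/-- The inclusion `U_σ → X_Σ`. -/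
def chart (σ : Δ.Cone) : (Δ.charts k).obj σ ⟶ Δ.variety k := colimit.ι (Δ.charts k) σ

instance (σ : Δ.Cone) : IsOpenImmersion (Δ.chart k σ) :=
  inferInstanceAs (IsOpenImmersion (colimit.ι (Δ.charts k) σ))

/-- The toric Frobenius morphism `F_ℓ : X_Σ → X_Σ`, induced by multiplication by `ℓ` on the
lattice: on each chart it is dual to `χ^m ↦ χ^{ℓ m}`. -/
def frobenius (l : ℕ) : Δ.variety k ⟶ Δ.variety k :=
  colimMap
    { app := fun σ => Spec.map (CommRingCat.ofHom
        (AddMonoidAlgebra.mapDomainRingHom k (nsmulAddMonoidHom (α := Δ.dualMonoid σ) l)))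
      naturality := fun σ τ f => by
        change Spec.map _ ≫ Spec.map _ = Spec.map _ ≫ Spec.map _
        rw [← Spec.map_comp, ← Spec.map_comp, ← CommRingCat.ofHom_comp, ← CommRingCat.ofHom_comp,
          chartRingMap, ← AddMonoidAlgebra.mapDomainRingHom_comp,
          ← AddMonoidAlgebra.mapDomainRingHom_comp]
        congr 3 }

/-- The cone `{0}`, whose chart is the torus. -/
def zeroCone : Δ.Cone := ⟨∅, Δ.empty_mem⟩

/-- The torus `𝕋 = Spec k[M]`. -/
abbrev torus : Scheme.{u} := (Δ.charts k).obj Δ.zeroCone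

/-- A regular function on `U_σ`, given by an element of `k[σ^∨ ∩ M]`. -/
def chartFunction (σ : Δ.Cone) : Δ.chartRing k σ →+* Γ((Δ.charts k).obj σ, ⊤) :=
  (Scheme.ΓSpecIso (CommRingCat.of (Δ.chartRing k σ))).inv.hom

/-- The character `χ^m` as a regular function on the torus. -/
def character (m : Module.Dual ℤ N) : Γ(Δ.torus k, ⊤) :=
  Δ.chartFunction k Δ.zeroCone
    (Δ.monomial k Δ.zeroCone ⟨m, fun ρ hρ => absurd hρ (Finset.notMem_empty ρ)⟩)

theorem character_add (m m' : Module.Dual ℤ N) :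
    Δ.character k (m + m') = Δ.character k m * Δ.character k m' := by
  rw [character, character, character, ← map_mul, monomial, monomial, monomial,
    AddMonoidAlgebra.single_mul_single, mul_one]
  rfl

theorem isUnit_character (m : Module.Dual ℤ N) : IsUnit (Δ.character k m) :=
  (Δ.isUnit_monomial k _ _ fun ρ hρ => absurd hρ (Finset.notMem_empty ρ)).map
    (Δ.chartFunction k Δ.zeroCone)

theorem uniqueSums_dualMonoid (σ : Δ.Cone) : UniqueSums (Δ.dualMonoid σ) := by
  obtain ⟨b, -⟩ := Δ.smooth _ Δ.empty_mem
  let f : Δ.dualMonoid σ →+ (Fin (Module.finrank ℤ N) → ℤ) :=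
    { toFun := fun m i => m.1 (b i)
      map_zero' := rfl
      map_add' := fun _ _ => rfl }
  exact UniqueSums.of_injective_addHom f.toAddHom (fun m m' h => Subtype.ext
    (b.ext fun i => congrFun h i)) inferInstance

instance isDomain_chartRing (σ : Δ.Cone) : IsDomain (Δ.chartRing k σ) :=
  have := Δ.uniqueSums_dualMonoid σ
  inferInstance

instance isIntegral_charts (σ : Δ.Cone) : IsIntegral ((Δ.charts k).obj σ) :=
  inferInstanceAs (IsIntegral (Spec (CommRingCat.of (Δ.chartRing k σ))))

theorem zeroCone_le (σ : Δ.Cone) : Δ.zeroCone ≤ σ := Finset.empty_subset σ.1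

theorem charts_map_comp_chart {σ τ : Δ.Cone} (h : σ ≤ τ) :
    (Δ.charts k).map (homOfLE h) ≫ Δ.chart k τ = Δ.chart k σ :=
  colimit.w (Δ.charts k) (homOfLE h)

theorem exists_chart (x : Δ.variety k) : ∃ (σ : Δ.Cone) (y : (Δ.charts k).obj σ),
    Δ.chart k σ y = x :=
  Scheme.IsLocallyDirected.ι_jointly_surjective (Δ.charts k) x

theorem exists_torus_mem (V : (Δ.variety k).Opens) {x : Δ.variety k} (hx : x ∈ V) :
    ∃ t : Δ.torus k, Δ.chart k Δ.zeroCone t ∈ V := by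
  obtain ⟨σ, y, rfl⟩ := Δ.exists_chart k x
  let f := (Δ.charts k).map (homOfLE (Δ.zeroCone_le σ))
  obtain ⟨z, hz, t, rfl⟩ := nonempty_preirreducible_inter (X := (Δ.charts k).obj σ)
    (Δ.chart k σ ⁻¹ᵁ V).2 f.isOpenEmbedding.isOpen_range ⟨y, hx⟩ (Set.range_nonempty f)
  refine ⟨t, ?_⟩
  rw [← Δ.charts_map_comp_chart k (Δ.zeroCone_le σ)]
  exact hz

instance : IrreducibleSpace (Δ.variety k) where
  toPreirreducibleSpace := by
    refine ⟨fun A B hA hB ⟨x, _, hx⟩ ⟨y, _, hy⟩ => ?_⟩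
    obtain ⟨t, ht⟩ := Δ.exists_torus_mem k ⟨A, hA⟩ hx
    obtain ⟨t', ht'⟩ := Δ.exists_torus_mem k ⟨B, hB⟩ hy
    obtain ⟨z, hz, hz'⟩ := nonempty_preirreducible_inter (X := Δ.torus k)
      (Δ.chart k Δ.zeroCone ⁻¹ᵁ ⟨A, hA⟩).2 (Δ.chart k Δ.zeroCone ⁻¹ᵁ ⟨B, hB⟩).2 ⟨t, ht⟩ ⟨t', ht'⟩
    exact ⟨Δ.chart k Δ.zeroCone z, trivial, hz, hz'⟩
  toNonempty := ⟨Δ.chart k Δ.zeroCone (Classical.arbitrary (Δ.torus k))⟩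

instance : IsIntegral (Δ.variety k) := by
  have : ∀ i, IsReduced ((Scheme.IsLocallyDirected.openCover (Δ.charts k)).X i) :=
    fun i => have := Δ.isIntegral_charts k i
      inferInstanceAs (IsReduced ((Δ.charts k).obj i))
  have : IsReduced (Δ.variety k) :=
    IsReduced.of_openCover _ (Scheme.IsLocallyDirected.openCover (Δ.charts k))
  exact isIntegral_of_irreducibleSpace_of_isReduced _

theorem torus_app_injective (V : (Δ.variety k).Opens) :
    Function.Injective ((Δ.chart k Δ.zeroCone).app V) := by
  let j := Δ.chart k Δ.zeroCone
  rcases (V : Set (Δ.variety k)).eq_empty_or_nonempty with hV | ⟨x, hx⟩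
  · obtain rfl : V = ⊥ := Opens.ext hV
    exact Function.injective_of_subsingleton _
  · obtain ⟨t, ht⟩ := Δ.exists_torus_mem k V hx
    have : Nonempty (j ''ᵁ j ⁻¹ᵁ V : (Δ.variety k).Opens) := ⟨⟨j t, t, ht, rfl⟩⟩
    have h1 := map_injective_of_isIntegral (Δ.variety k) (homOfLE (j.image_preimage_le V))
    have h2 := j.app_appIso_inv V
    intro a b hab
    apply h1
    have h3 (c) : (Δ.variety k).presheaf.map (homOfLE (j.image_preimage_le V)).op c =
        (j.appIso (j ⁻¹ᵁ V)).inv (j.app V c) := by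
      rw [← ConcreteCategory.comp_apply, h2]
      rfl
    rw [h3, h3, hab]

/-- The function on the open set `U_σ` of `X_Σ` defined by a character `m ∈ σ^∨ ∩ M` restricts to
`χ^m` on the torus. -/
theorem exists_character_extension (σ : Δ.Cone) (m : Δ.dualMonoid σ) :
    ∃ g : Γ(Δ.variety k, Δ.chart k σ ''ᵁ ⊤),
      (Δ.chart k Δ.zeroCone).app _ g = res le_top (Δ.character k m.1) := by
  refine ⟨((Δ.chart k σ).appIso ⊤).inv (Δ.chartFunction k σ (Δ.monomial k σ m)), ?_⟩
  let i := (Δ.charts k).map (homOfLE (Δ.zeroCone_le σ))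
  have hchar : i.appTop (Δ.chartFunction k σ (Δ.monomial k σ m)) = Δ.character k m.1 := by
    have h1 := Scheme.ΓSpecIso_inv_naturality
      (CommRingCat.ofHom (Δ.chartRingMap k (Δ.zeroCone_le σ)))
    have h2 := ConcreteCategory.congr_hom h1 (Δ.monomial k σ m)
    refine h2.symm.trans ?_
    change Δ.chartFunction k Δ.zeroCone (Δ.chartRingMap k (Δ.zeroCone_le σ) (Δ.monomial k σ m)) = _
    rw [monomial, chartRingMap_single]
    rfl
  have key : ∀ (j : Δ.torus k ⟶ Δ.variety k) (_ : i ≫ Δ.chart k σ = j)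
      (c : Γ((Δ.charts k).obj σ, ⊤)),
      j.app (Δ.chart k σ ''ᵁ ⊤) (((Δ.chart k σ).appIso ⊤).inv c) = res le_top (i.appTop c) := by
    rintro j rfl c
    have h3 : (Δ.chart k σ).app (Δ.chart k σ ''ᵁ ⊤) (((Δ.chart k σ).appIso ⊤).inv c) =
        res le_top c := by
      rw [← ConcreteCategory.comp_apply, Scheme.Hom.appIso_inv_app]
      rfl
    change i.app _ ((Δ.chart k σ).app (Δ.chart k σ ''ᵁ ⊤) (((Δ.chart k σ).appIso ⊤).inv c)) = _
    rw [h3, app_res]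
    rfl
  rw [key _ (Δ.charts_map_comp_chart k _), hchar]

/-- The index set of the local equations of the divisor `∑ a_ρ D_ρ`: pairs of a cone `σ` and
a character `m` with `⟨m, u_ρ⟩ = a_ρ` for all rays `ρ` of `σ`. -/
abbrev LocalEquation (a : ι → ℤ) : Type u :=
  {p : Δ.Cone × Module.Dual ℤ N // ∀ ρ ∈ p.1.1, p.2 (Δ.ray ρ) = a ρ}

/-- The sheaf `𝒪_X(D)` of the torus-invariant divisor `D = ∑ a_ρ D_ρ`, as the sheaf of functions
`f` on the torus with `div f + D ≥ 0`: on `U_σ` the divisor `D` has the local equation `χ^m`, where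
`⟨m, u_ρ⟩ = a_ρ` for the rays `ρ` of `σ`, and `χ^m f` has to be regular on `U_σ`. -/
def divisorSheaf (a : ι → ℤ) : (Δ.variety k).Modules :=
  cartierModule (Δ.chart k Δ.zeroCone)
    (fun p : Δ.LocalEquation a => (Δ.chart k p.1.1).opensRange)
    (fun p => Δ.character k p.1.2)

theorem isInvertible_divisorSheaf (a : ι → ℤ) : IsInvertible (Δ.divisorSheaf k a) := by
  classical
  refine isInvertible_cartierModule _ _ _ (Δ.torus_app_injective k) (fun x => ?_)
    (fun p => Δ.isUnit_character k _) ?_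
  · obtain ⟨σ, y, rfl⟩ := Δ.exists_chart k x
    obtain ⟨m, hm⟩ := Δ.exists_dual σ a
    exact ⟨⟨(σ, m), hm⟩, y, rfl⟩
  · rintro ⟨⟨σ, m⟩, hm⟩ ⟨⟨σ', m'⟩, hm'⟩ x ⟨y, hy⟩ ⟨y', hy'⟩
    obtain ⟨τ, f, f', z, hz, -⟩ := (Scheme.IsLocallyDirected.ι_eq_ι_iff (Δ.charts k)).1
      (hy.trans hy'.symm)
    have hmem : m' - m ∈ Δ.dualMonoid τ := fun ρ hρ => by
      rw [LinearMap.sub_apply, hm ρ (leOfHom f hρ), hm' ρ (leOfHom f' hρ), sub_self]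
    obtain ⟨g, hg⟩ := Δ.exists_character_extension k τ ⟨_, hmem⟩
    refine ⟨Δ.chart k τ ''ᵁ ⊤, ⟨z, trivial, ?_⟩, g, ?_⟩
    · rw [← hy, ← hz]
      have h1 := Δ.charts_map_comp_chart k (leOfHom f)
      rw [← h1]
      rfl
    · rw [hg, ← map_mul, ← character_add, sub_add_cancel]

/-- The line bundle `𝒪_X(D)` of the torus-invariant divisor `D = ∑ a_ρ D_ρ`. -/
def divisorBundle (a : ι → ℤ) : LineBundle (Δ.variety k) :=
  ⟨Δ.divisorSheaf k a, Δ.isInvertible_divisorSheaf k a⟩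

/-- The set of the line bundles that are direct summands of `(F_ℓ)_* L`. -/
def frobAt (l : ℕ) (L : LineBundle (Δ.variety k)) : Set (Pic (Δ.variety k)) :=
  {P | ∃ E : LineBundle (Δ.variety k), E.cls = P ∧
    Nonempty (Retract E.1 ((Scheme.Modules.pushforward (Δ.frobenius k l)).obj L.1))}

/-- The union of the sets `Frob_ℓ(L)` over all positive integers `ℓ`. -/
def frob (L : LineBundle (Δ.variety k)) : Set (Pic (Δ.variety k)) :=
  {P | ∃ l : ℕ, 1 ≤ l ∧ P ∈ Δ.frobAt k l L}

/-- The zonotope `Z` in `Pic(X)_ℝ`: the convex hull of the classes of the divisors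
`-∑_{ρ ∈ A} D_ρ`, `A ⊆ Σ(1)`. -/
def zonotope : Set (PicReal (Δ.variety k)) :=
  convexHull ℝ (Set.range fun A : Set ι => (Δ.divisorBundle k (cubeVertex A)).cls.toReal)

end SmoothFan

end Toric

end

noncomputable section

/-! ### Functions on the charts as Laurent polynomials -/

namespace Toric

/-! Everything is read off on the torus. A section of `𝒪_X(D)`, `D = ∑ a_ρ D_ρ`, over `U_σ` is a
Laurent polynomial whose exponents `m` satisfy `m(u_ρ) + a_ρ ≥ 0` for the rays `ρ` of `σ`
(`isRegular_laurent_iff`), and the Frobenius morphism replaces `χ^m` by `χ^{ℓm}`. Classically,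
`(F_ℓ)_* 𝒪_X(D)` splits according to the residue classes of exponents modulo `ℓ`, and the summand of
`m` belongs to the divisor with coefficients `b_ρ = ⌊(a_ρ + m(u_ρ))/ℓ⌋`. The full decomposition is
not needed, only a description of the line bundles that are retracts, `mem_frobAt_iff`: up to linear
equivalence they are exactly these roundings.

That each rounding occurs is `nonempty_retract`: the inclusion is pullback followed by
multiplication by `χ^m`, the retraction is multiplication by `χ^{-m}` followed by the projection of
`k[M]` onto the exponents divisible by `ℓ`. That nothing else occurs is `exists_floor`: over the
torus a retract gives additive maps `Φ`, `Ψ` of `k[M]` with `Ψ ∘ Φ = id`, and a monomial of `Φ 1`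
that contributes to the constant term of `Ψ (Φ 1) = 1` is the required `m`.

The Picard group is treated by hand. Charts have factorial coordinate rings, so an invertible sheaf
is trivial on each of them. The units of the torus are multiples of characters, so the sheaf comes
from an invariant divisor (`exists_nonempty_iso_divisorSheaf`). Isomorphism means that the divisors
differ by that of a character (the case `ℓ = 1` of the rounding result), and addition of divisors is
the tensor product. Hence `Pic(X)_ℝ` is `ℝ^{Σ(1)}` modulo the span of the principal divisors
(`exists_realClass`), and `Z` is the image of the cube `[-1, 0]^{Σ(1)}`.

The four assertions now follow from `[b] = [a]/ℓ - [t]`, where `t` has coordinates in `[0,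
(ℓ-1)/ℓ]`. For 1, the classes `[b]` lie in a finite set, `[b] - [a]/ℓ = -[t]` is in `Z`, the term
`[a]/ℓ` tends to `0`, and the preimage of `Z` in `ℝ^{Σ(1)}` is closed. For 2 and 3, the bounds on
`t` are precisely what is needed to prolong the segment from `[a]` to `[b]` inside `Z`, respectively
to write `[a] - [b]` as a multiple of an element of `[b] - Z`. The converse in 2 approximates a real
combination of characters by integral ones (`exists_floor_of_mem_openStar`). For 4, the rounding is
`-1` on `A` and `0` elsewhere for some `ℓ` exactly when `a + m` is negative on `A` and nonnegative
elsewhere. -/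

theorem res_self {X : Scheme.{u}} {V : X.Opens} (h : V ≤ V) (f : Γ(X, V)) : res h f = f := by
  change X.presheaf.map (𝟙 _) f = f
  simp

section Cartier

variable {T X : Scheme.{u}} (j : T ⟶ X) {I : Type u} {U : I → X.Opens} {h : I → Γ(T, ⊤)}

/-- On overlaps, one local equation is a regular multiple of any other, so a single equation
suffices to test regularity. This is the converse of `exists_regular_extension`. -/
theorem isRegularSection_of_eq
    (hcomp : ∀ i i' x, x ∈ U i → x ∈ U i' → ∃ W : X.Opens, x ∈ W ∧ ∃ g : Γ(X, W),
      j.app W g * res le_top (h i) = res le_top (h i'))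
    {V : X.Opens} {i : I} (hV : V ≤ U i) {f : Γ(T, j ⁻¹ᵁ V)} {g : Γ(X, V)}
    (hg : j.app V g = res le_top (h i) * f) : IsRegularSection j U h V f := by
  intro i' x hx hi'
  obtain ⟨W, hxW, g', hg'⟩ := hcomp i i' x (hV hx) hi'
  refine ⟨W ⊓ V, inf_le_right, ⟨hxW, hx⟩, res inf_le_left g' * res inf_le_right g, ?_⟩
  have h1 := congrArg (res (j.preimage_mono (inf_le_left : W ⊓ V ≤ W))) hg'
  rw [map_mul, res_res, res_res] at h1
  rw [map_mul, app_res, app_res, hg, map_mul, res_res, ← h1]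
  ring

end Cartier

namespace SmoothFan

variable {N : Type u} [AddCommGroup N] {ι : Type u} (Δ : SmoothFan N ι)
variable (k : Type u) [Field k]

/-- The open subset `U_σ` of `X_Σ`. -/
abbrev affine (σ : Δ.Cone) : (Δ.variety k).Opens := (Δ.chart k σ).opensRange

/-- A function on an open subset of the torus, given by a Laurent polynomial. -/
def laurent (W : (Δ.torus k).Opens) : Δ.chartRing k Δ.zeroCone →+* Γ(Δ.torus k, W) :=
  (res le_top).comp (Δ.chartFunction k Δ.zeroCone)

theorem res_laurent {W W' : (Δ.torus k).Opens} (h : W' ≤ W) (P : Δ.chartRing k Δ.zeroCone) :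
    res h (Δ.laurent k W P) = Δ.laurent k W' P := by
  rw [laurent, laurent, RingHom.comp_apply, RingHom.comp_apply, res_res]

/-- A character, as an element of `k[M]`. -/
def mono (m : Module.Dual ℤ N) : Δ.dualMonoid Δ.zeroCone :=
  ⟨m, fun ρ hρ => absurd hρ (Finset.notMem_empty ρ)⟩

theorem res_character (W : (Δ.torus k).Opens) (m : Module.Dual ℤ N) :
    res le_top (Δ.character k m) = Δ.laurent k W (AddMonoidAlgebra.single (Δ.mono m) 1) :=
  rfl

theorem chartFunction_bijective (σ : Δ.Cone) : Function.Bijective (Δ.chartFunction k σ) :=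
  ConcreteCategory.bijective_of_isIso
    (Scheme.ΓSpecIso (CommRingCat.of (Δ.chartRing k σ))).inv

/-- The hypothesis has the form `⊤ ≤ W` because the preimage of a chart in the torus is the whole
torus without being `⊤` by definition. -/
theorem laurent_bijective {W : (Δ.torus k).Opens} (hW : ⊤ ≤ W) :
    Function.Bijective (Δ.laurent k W) := by
  obtain rfl : W = ⊤ := top_le_iff.1 hW
  have h : ⇑(Δ.laurent k ⊤) = Δ.chartFunction k Δ.zeroCone := funext fun P => by
    rw [laurent, RingHom.comp_apply]
    exact res_self _ _
  rw [h]
  exact Δ.chartFunction_bijective k Δ.zeroCone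

theorem top_le_preimage_affine (σ : Δ.Cone) :
    ⊤ ≤ (Δ.chart k Δ.zeroCone) ⁻¹ᵁ Δ.affine k σ := by
  intro t _
  refine ⟨(Δ.charts k).map (homOfLE (Δ.zeroCone_le σ)) t, ?_⟩
  rw [← Δ.charts_map_comp_chart k (Δ.zeroCone_le σ)]
  rfl

theorem affine_mono {σ τ : Δ.Cone} (h : σ ≤ τ) : Δ.affine k σ ≤ Δ.affine k τ := by
  rintro _ ⟨t, rfl⟩
  refine ⟨(Δ.charts k).map (homOfLE h) t, ?_⟩
  rw [← Δ.charts_map_comp_chart k h]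
  rfl

theorem chartFunction_naturality {σ τ : Δ.Cone} (h : σ ≤ τ) (P : Δ.chartRing k τ) :
    ((Δ.charts k).map (homOfLE h)).appTop (Δ.chartFunction k τ P) =
      Δ.chartFunction k σ (Δ.chartRingMap k h P) :=
  (ConcreteCategory.congr_hom (Scheme.ΓSpecIso_inv_naturality
      (CommRingCat.ofHom (Δ.chartRingMap k h))) P).symm

/-- A regular function on `U_σ`, given by an element of `k[σ^∨ ∩ M]`. -/
def affineFunction (σ : Δ.Cone) : Δ.chartRing k σ →+* Γ(Δ.variety k, Δ.chart k σ ''ᵁ ⊤) :=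
  (((Δ.chart k σ).appIso ⊤).inv.hom).comp (Δ.chartFunction k σ)

theorem affineFunction_bijective (σ : Δ.Cone) : Function.Bijective (Δ.affineFunction k σ) :=
  (ConcreteCategory.bijective_of_isIso ((Δ.chart k σ).appIso ⊤).inv).comp
    (Δ.chartFunction_bijective k σ)

theorem app_affineFunction {σ τ : Δ.Cone} (h : σ ≤ τ) (P : Δ.chartRing k τ) :
    (Δ.chart k σ).app _ (Δ.affineFunction k τ P) =
      res le_top (Δ.chartFunction k σ (Δ.chartRingMap k h P)) := by
  let i := (Δ.charts k).map (homOfLE h)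
  -- The chart of `σ` equals the composite through `τ` only propositionally; quantifying over `j`
  -- allows the equation to be substituted.
  have key : ∀ (j : (Δ.charts k).obj σ ⟶ Δ.variety k) (_ : i ≫ Δ.chart k τ = j)
      (c : Γ((Δ.charts k).obj τ, ⊤)),
      j.app (Δ.chart k τ ''ᵁ ⊤) (((Δ.chart k τ).appIso ⊤).inv c) = res le_top (i.appTop c) := by
    rintro j rfl c
    have h3 : (Δ.chart k τ).app (Δ.chart k τ ''ᵁ ⊤) (((Δ.chart k τ).appIso ⊤).inv c) =
        res le_top c := by
      rw [← ConcreteCategory.comp_apply, Scheme.Hom.appIso_inv_app]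
      rfl
    change i.app _ ((Δ.chart k τ).app (Δ.chart k τ ''ᵁ ⊤) (((Δ.chart k τ).appIso ⊤).inv c)) = _
    rw [h3, app_res]
    rfl
  refine (key _ (Δ.charts_map_comp_chart k h) _).trans ?_
  rw [Δ.chartFunction_naturality]

theorem exists_app_eq_laurent (σ : Δ.Cone) (P : Δ.chartRing k σ) :
    ∃ g : Γ(Δ.variety k, Δ.affine k σ), (Δ.chart k Δ.zeroCone).app _ g =
      Δ.laurent k _ (Δ.chartRingMap k (Δ.zeroCone_le σ) P) := by
  have h := (Scheme.Hom.image_top_eq_opensRange (Δ.chart k σ)).ge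
  refine ⟨res h (Δ.affineFunction k σ P), ?_⟩
  rw [app_res, Δ.app_affineFunction k (Δ.zeroCone_le σ), res_res]
  rfl

theorem exists_laurent_eq_app (σ : Δ.Cone) (g : Γ(Δ.variety k, Δ.affine k σ)) :
    ∃ P : Δ.chartRing k σ, (Δ.chart k Δ.zeroCone).app _ g =
      Δ.laurent k _ (Δ.chartRingMap k (Δ.zeroCone_le σ) P) := by
  have h := (Scheme.Hom.image_top_eq_opensRange (Δ.chart k σ)).ge
  have h' := (Scheme.Hom.image_top_eq_opensRange (Δ.chart k σ)).le
  obtain ⟨P, hP⟩ := (Δ.affineFunction_bijective k σ).2 (res h' g)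
  refine ⟨P, ?_⟩
  have h1 : g = res h (Δ.affineFunction k σ P) := by rw [hP, res_res, res_self]
  rw [h1, app_res, Δ.app_affineFunction k (Δ.zeroCone_le σ), res_res]
  rfl

theorem mem_range_chartRingMap_iff (σ : Δ.Cone) (P : Δ.chartRing k Δ.zeroCone) :
    (∃ Q, Δ.chartRingMap k (Δ.zeroCone_le σ) Q = P) ↔
      ∀ m ∈ P.coeff.support, ∀ ρ ∈ σ.1, 0 ≤ m.1 (Δ.ray ρ) := by
  classical
  constructor
  · rintro ⟨Q, rfl⟩ m hm
    obtain ⟨m', -, rfl⟩ := Finset.mem_image.1 (Finsupp.mapDomain_support hm)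
    exact m'.2
  · intro h
    change P ∈ (Δ.chartRingMap k (Δ.zeroCone_le σ)).range
    rw [← AddMonoidAlgebra.sum_coeff_single P]
    exact sum_mem fun m hm =>
      ⟨AddMonoidAlgebra.single ⟨m.1, h m hm⟩ _, Δ.chartRingMap_single k _ _ _⟩

/-- Regularity of a function on the torus as a section of `𝒪_X(D)`. -/
abbrev IsRegular (a : ι → ℤ) (V : (Δ.variety k).Opens)
    (f : Γ(Δ.torus k, Δ.chart k Δ.zeroCone ⁻¹ᵁ V)) : Prop :=
  IsRegularSection (Δ.chart k Δ.zeroCone)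
    (fun p : Δ.LocalEquation a => (Δ.chart k p.1.1).opensRange)
    (fun p => Δ.character k p.1.2) V f

/-- The point lies in the chart of a common face `τ`. On the rays of `τ` both characters take the
values `a ρ`, so their quotient is regular there. -/
theorem exists_transition (a : ι → ℤ) (p q : Δ.LocalEquation a) (x : Δ.variety k)
    (hp : x ∈ Δ.affine k p.1.1) (hq : x ∈ Δ.affine k q.1.1) :
    ∃ W : (Δ.variety k).Opens, x ∈ W ∧ ∃ g : Γ(Δ.variety k, W),
      (Δ.chart k Δ.zeroCone).app W g * res le_top (Δ.character k p.1.2) =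
        res le_top (Δ.character k q.1.2) := by
  obtain ⟨⟨σ, m⟩, hm⟩ := p
  obtain ⟨⟨σ', m'⟩, hm'⟩ := q
  obtain ⟨y, hy⟩ := hp
  obtain ⟨y', hy'⟩ := hq
  obtain ⟨τ, f, f', z, hz, -⟩ := (Scheme.IsLocallyDirected.ι_eq_ι_iff (Δ.charts k)).1
    (hy.trans hy'.symm)
  have hmem : m' - m ∈ Δ.dualMonoid τ := fun ρ hρ => by
    rw [LinearMap.sub_apply, hm ρ (leOfHom f hρ), hm' ρ (leOfHom f' hρ), sub_self]
  obtain ⟨g, hg⟩ := Δ.exists_character_extension k τ ⟨_, hmem⟩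
  refine ⟨Δ.chart k τ ''ᵁ ⊤, ⟨z, trivial, ?_⟩, g, ?_⟩
  · rw [← hy, ← hz]
    have h1 := Δ.charts_map_comp_chart k (leOfHom f)
    rw [← h1]
    rfl
  · rw [hg, ← map_mul, ← character_add, sub_add_cancel]

theorem isRegular_iff {a : ι → ℤ} {V : (Δ.variety k).Opens} {σ : Δ.Cone}
    (hV : V ≤ Δ.affine k σ) {m : Module.Dual ℤ N} (hm : ∀ ρ ∈ σ.1, m (Δ.ray ρ) = a ρ)
    {f : Γ(Δ.torus k, Δ.chart k Δ.zeroCone ⁻¹ᵁ V)} :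
    Δ.IsRegular k a V f ↔ ∃ g : Γ(Δ.variety k, V),
      (Δ.chart k Δ.zeroCone).app V g = res le_top (Δ.character k m) * f :=
  ⟨fun hf => exists_regular_extension _ (Δ.torus_app_injective k) hf ⟨(σ, m), hm⟩ hV,
    fun ⟨_, hg⟩ => isRegularSection_of_eq _ (Δ.exists_transition k a)
      (i := ⟨(σ, m), hm⟩) hV hg⟩

/-- Regularity on `U_σ` is a condition on the exponents of a Laurent polynomial. -/
theorem isRegular_laurent_iff {a : ι → ℤ} {σ : Δ.Cone} {P : Δ.chartRing k Δ.zeroCone} :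
    Δ.IsRegular k a (Δ.affine k σ) (Δ.laurent k _ P) ↔
      ∀ m ∈ P.coeff.support, ∀ ρ ∈ σ.1, 0 ≤ m.1 (Δ.ray ρ) + a ρ := by
  obtain ⟨m, hm⟩ := Δ.exists_dual σ a
  -- Multiplication by `χ^m` translates the support by `m`, and `m(u_ρ) = a ρ`: so `χ^m P` has
  -- exponents in `σ^∨` iff the inequalities hold.
  have h1 : (∃ Q, Δ.chartRingMap k (Δ.zeroCone_le σ) Q =
      AddMonoidAlgebra.single (Δ.mono m) 1 * P) ↔
      ∀ m ∈ P.coeff.support, ∀ ρ ∈ σ.1, 0 ≤ m.1 (Δ.ray ρ) + a ρ := by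
    classical
    rw [mem_range_chartRingMap_iff, AddMonoidAlgebra.support_coeff_single_mul_eq_image _
      (by simp) (fun x y h => add_left_cancel h), Finset.forall_mem_image]
    refine forall₂_congr fun m' _ => forall₂_congr fun ρ hρ => ?_
    rw [← hm ρ hρ, add_comm]
    rfl
  rw [Δ.isRegular_iff k le_rfl hm, ← h1, Δ.res_character]
  have hbij := Δ.laurent_bijective k (Δ.top_le_preimage_affine k σ)
  constructor
  · rintro ⟨g, hg⟩
    obtain ⟨Q, hQ⟩ := Δ.exists_laurent_eq_app k σ g
    exact ⟨Q, hbij.1 (by rw [map_mul, ← hg, ← hQ])⟩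
  · rintro ⟨Q, hQ⟩
    obtain ⟨g, hg⟩ := Δ.exists_app_eq_laurent k σ Q
    exact ⟨g, by rw [hg, hQ, map_mul]⟩

end SmoothFan

end Toric

/-! ### The Frobenius morphism on charts, and the rounding formula -/

namespace Toric

theorem app_congr {T X : Scheme.{u}} {f g : T ⟶ X} (h : f = g) (V : X.Opens) (s : Γ(X, V)) :
    f.app V s = res (by rw [h]) (g.app V s) := by
  subst h
  exact (res_self _ _).symm

namespace SmoothFan

variable {N : Type u} [AddCommGroup N] {ι : Type u} (Δ : SmoothFan N ι)
variable (k : Type u) [Field k]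

/-- The ring homomorphism `χ^m ↦ χ^{ℓ m}`. -/
abbrev frobRing (l : ℕ) (σ : Δ.Cone) : Δ.chartRing k σ →+* Δ.chartRing k σ :=
  AddMonoidAlgebra.mapDomainRingHom k (nsmulAddMonoidHom (α := Δ.dualMonoid σ) l)

/-- The toric Frobenius morphism of `U_σ`. -/
def chartFrobenius (l : ℕ) (σ : Δ.Cone) : (Δ.charts k).obj σ ⟶ (Δ.charts k).obj σ :=
  Spec.map (CommRingCat.ofHom (Δ.frobRing k l σ))

theorem chart_comp_frobenius (l : ℕ) (σ : Δ.Cone) :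
    Δ.chart k σ ≫ Δ.frobenius k l = Δ.chartFrobenius k l σ ≫ Δ.chart k σ :=
  ι_colimMap _ _

theorem frobenius_chart (l : ℕ) (σ : Δ.Cone) (y : (Δ.charts k).obj σ) :
    Δ.frobenius k l (Δ.chart k σ y) = Δ.chart k σ (Δ.chartFrobenius k l σ y) :=
  congrArg (fun f => f y) (Δ.chart_comp_frobenius k l σ)

theorem affine_le_preimage (l : ℕ) (σ : Δ.Cone) :
    Δ.affine k σ ≤ Δ.frobenius k l ⁻¹ᵁ Δ.affine k σ := by
  rintro _ ⟨y, rfl⟩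
  exact ⟨_, (Δ.frobenius_chart k l σ y).symm⟩

theorem frobRing_monomial (l : ℕ) (σ : Δ.Cone) (m : Δ.dualMonoid σ) :
    Δ.frobRing k l σ (Δ.monomial k σ m) = Δ.monomial k σ m ^ l := by
  rw [monomial, AddMonoidAlgebra.single_pow, one_pow]
  exact AddMonoidAlgebra.mapDomain_single

/-- Inside `U_τ` the overlap with `U_σ` is contained in the nonvanishing locus of a face character
`χ^m`. Frobenius pulls `χ^m` back to its `ℓ`-th power, which for `ℓ ≥ 1` vanishes at the same
points. -/
theorem preimage_affine_le {l : ℕ} (hl : 1 ≤ l) (σ : Δ.Cone) :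
    Δ.frobenius k l ⁻¹ᵁ Δ.affine k σ ≤ Δ.affine k σ := by
  intro x hx
  obtain ⟨τ, y, rfl⟩ := Δ.exists_chart k x
  obtain ⟨z, hz⟩ := hx
  rw [frobenius_chart] at hz
  obtain ⟨κ, f, g, w, -, hw⟩ := (Scheme.IsLocallyDirected.ι_eq_ι_iff (Δ.charts k)).1 hz
  obtain ⟨m, h0, h1⟩ := Δ.exists_face_character (leOfHom g)
  have hr := Δ.range_charts k g m h0 h1
  have h2 : Δ.chartFrobenius k l τ y ∈ Set.range ((Δ.charts k).map g) := ⟨w, hw⟩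
  have h3 : y ∈ Set.range ((Δ.charts k).map g) := by
    rw [hr] at h2 ⊢
    change Δ.monomial k τ m ∉ PrimeSpectrum.asIdeal _
    change Δ.frobRing k l τ (Δ.monomial k τ m) ∉ PrimeSpectrum.asIdeal y at h2
    rw [frobRing_monomial] at h2
    exact fun h => h2 (Ideal.pow_mem_of_mem _ h _ hl)
  obtain ⟨v, rfl⟩ := h3
  refine Δ.affine_mono k (leOfHom f) ⟨v, ?_⟩
  rw [← Δ.charts_map_comp_chart k (leOfHom g)]
  rfl

theorem chartFrobenius_app_laurent (l : ℕ) (W : (Δ.torus k).Opens)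
    (P : Δ.chartRing k Δ.zeroCone) :
    (Δ.chartFrobenius k l Δ.zeroCone).app W (Δ.laurent k W P) =
      Δ.laurent k _ (Δ.frobRing k l Δ.zeroCone P) := by
  rw [laurent, RingHom.comp_apply, app_res]
  exact congrArg (res le_top) (ConcreteCategory.congr_hom (Scheme.ΓSpecIso_inv_naturality
      (CommRingCat.ofHom (Δ.frobRing k l Δ.zeroCone))) P).symm

/-- The pullback along the Frobenius morphism, in terms of functions on the torus. -/
theorem app_frobenius (l : ℕ) (V : (Δ.variety k).Opens) (g : Γ(Δ.variety k, V)) :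
    (Δ.chart k Δ.zeroCone).app _ ((Δ.frobenius k l).app V g) =
      res (by rw [← Scheme.Hom.comp_preimage, ← Scheme.Hom.comp_preimage, chart_comp_frobenius])
        ((Δ.chartFrobenius k l Δ.zeroCone).app _ ((Δ.chart k Δ.zeroCone).app V g)) := by
  have h1 := app_congr (Δ.chart_comp_frobenius k l Δ.zeroCone) V g
  rw [Scheme.Hom.comp_app, Scheme.Hom.comp_app] at h1
  exact h1

theorem mono_add (m m' : Module.Dual ℤ N) : Δ.mono (m + m') = Δ.mono m + Δ.mono m' := rfl

/-- This is the algebraic core of the classification of summands. `Φ` and `Ψ` stand for the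
inclusion and the retraction over the torus. Since `Ψ (Φ 1) = 1`, some monomial `χ^{m'}` of `Φ 1` is
sent by `Ψ` to a polynomial with nonzero constant term. Along each ray, translates of `1` and of
`χ^{m'}` on the boundary of the regularity condition give the two inequalities. The same `m'` serves
all rays. -/
theorem exists_floor {l : ℕ} (hl : 1 ≤ l) {a b : ι → ℤ}
    (Φ Ψ : Δ.chartRing k Δ.zeroCone →+ Δ.chartRing k Δ.zeroCone)
    (hΦ : ∀ m P, Φ (AddMonoidAlgebra.single m 1 * P) = AddMonoidAlgebra.single (l • m) 1 * Φ P)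
    (hΨ : ∀ m P, Ψ (AddMonoidAlgebra.single (l • m) 1 * P) = AddMonoidAlgebra.single m 1 * Ψ P)
    (hid : ∀ P, Ψ (Φ P) = P)
    (hΦr : ∀ ρ P, (∀ m ∈ P.coeff.support, 0 ≤ m.1 (Δ.ray ρ) + b ρ) →
      ∀ m ∈ (Φ P).coeff.support, 0 ≤ m.1 (Δ.ray ρ) + a ρ)
    (hΨr : ∀ ρ P, (∀ m ∈ P.coeff.support, 0 ≤ m.1 (Δ.ray ρ) + a ρ) →
      ∀ m ∈ (Ψ P).coeff.support, 0 ≤ m.1 (Δ.ray ρ) + b ρ) :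
    ∃ m : Module.Dual ℤ N, ∀ ρ, b ρ = (a ρ + m (Δ.ray ρ)) / l := by
  classical
  have hsingle (m : Δ.dualMonoid Δ.zeroCone) (P : Δ.chartRing k Δ.zeroCone) :
      (AddMonoidAlgebra.single m 1 * P).coeff.support = P.coeff.support.image (m + ·) :=
    AddMonoidAlgebra.support_coeff_single_mul_eq_image _ (by simp) (fun x y h => add_left_cancel h)
  have hl' : (0 : ℤ) < l := by exact_mod_cast hl
  have h1 : ∑ m ∈ (Φ 1).coeff.support,
      (Ψ (AddMonoidAlgebra.single m ((Φ 1).coeff m))).coeff 0 ≠ 0 := by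
    have h2 : Ψ (∑ m ∈ (Φ 1).coeff.support, AddMonoidAlgebra.single m ((Φ 1).coeff m)) = 1 := by
      exact (congrArg Ψ (AddMonoidAlgebra.sum_coeff_single (Φ 1))).trans (hid 1)
    rw [map_sum] at h2
    have h3 := congrArg (fun P => P.coeff 0) h2
    simp only [AddMonoidAlgebra.coeff_sum, Finsupp.finsetSum_apply,
      AddMonoidAlgebra.coeff_one_zero] at h3
    rw [h3]
    exact one_ne_zero
  obtain ⟨m', hm', h0⟩ := Finset.exists_ne_zero_of_sum_ne_zero h1
  refine ⟨m'.1, fun ρ => le_antisymm ?_ ?_⟩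
  -- `χ^m` with `m(u_ρ) = -b ρ` is just regular along `ρ`. Its image `χ^{ℓm} Φ(1)` contains the
  -- exponent `ℓm + m'`, hence `ℓ b ρ ≤ a ρ + m'(u_ρ)`.
  · obtain ⟨m, hm⟩ := Δ.exists_dual ⟨{ρ}, Δ.singleton_mem ρ⟩ (-b)
    have hm := hm ρ (Finset.mem_singleton_self ρ)
    rw [Int.le_ediv_iff_mul_le hl']
    have h4 := hΦr ρ (AddMonoidAlgebra.single (Δ.mono m) 1 * 1) (by
      rw [hsingle]
      intro x hx
      obtain ⟨y, hy, rfl⟩ := Finset.mem_image.1 hx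
      obtain rfl : y = 0 := by
        have := AddMonoidAlgebra.support_coeff_one_subset hy
        simpa using this
      change 0 ≤ (m + 0) (Δ.ray ρ) + b ρ
      rw [add_zero, hm, Pi.neg_apply, neg_add_cancel]) (l • Δ.mono m + m') (by
      rw [hΦ, hsingle]
      exact Finset.mem_image_of_mem _ hm')
    change 0 ≤ (l • m + m'.1) (Δ.ray ρ) + a ρ at h4
    rw [LinearMap.add_apply, LinearMap.smul_apply, hm, Pi.neg_apply, nsmul_eq_mul] at h4
    linarith
  -- With `m(u_ρ)` equal to minus the rounded value, `χ^{ℓm + m'}` is regular for `a`. Its image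
  -- under `Ψ` contains `χ^m`, which must be regular for `b`.
  · obtain ⟨m, hm⟩ := Δ.exists_dual ⟨{ρ}, Δ.singleton_mem ρ⟩
      (fun ρ => -((a ρ + m'.1 (Δ.ray ρ)) / l))
    have hm := hm ρ (Finset.mem_singleton_self ρ)
    have h4 := hΨr ρ (AddMonoidAlgebra.single (l • Δ.mono m) 1 *
        AddMonoidAlgebra.single m' ((Φ 1).coeff m')) (by
      rw [hsingle]
      intro x hx
      obtain ⟨y, hy, rfl⟩ := Finset.mem_image.1 hx
      obtain rfl : y = m' := by
        simpa using Finsupp.support_single_subset hy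
      change 0 ≤ (l • m + y.1) (Δ.ray ρ) + a ρ
      rw [LinearMap.add_apply, LinearMap.smul_apply, hm, nsmul_eq_mul]
      have := Int.mul_ediv_self_le (x := a ρ + y.1 (Δ.ray ρ)) hl'.ne'
      linarith) (Δ.mono m + 0) (by
      rw [hΨ, hsingle]
      exact Finset.mem_image_of_mem _ (Finsupp.mem_support_iff.2 h0))
    change 0 ≤ (m + 0) (Δ.ray ρ) + b ρ at h4
    rw [add_zero, hm] at h4
    linarith

end SmoothFan

end Toric

/-! ### From a retract of sheaves to maps of Laurent polynomials -/

namespace Toric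

section Cartier

variable {T X : Scheme.{u}} (j : T ⟶ X) {I : Type u} (U : I → X.Opens) (h : I → Γ(T, ⊤))

/-- The function on `T` underlying a section of `cartierModule`. -/
def cartierVal (V : X.Opens) : Γ(cartierModule j U h, V) →+ Γ(T, j ⁻¹ᵁ V) where
  toFun s := Subtype.val (p := fun f => f ∈ (cartierSubmodule j U h).obj (.op V)) s
  map_zero' := rfl
  map_add' _ _ := rfl

theorem cartierVal_injective (V : X.Opens) : Function.Injective (cartierVal j U h V) :=
  fun _ _ hs => Subtype.ext hs

theorem isRegularSection_cartierVal {V : X.Opens} (s : Γ(cartierModule j U h, V)) :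
    IsRegularSection j U h V (cartierVal j U h V s) :=
  Subtype.property (p := fun f => f ∈ (cartierSubmodule j U h).obj (.op V)) s

theorem exists_cartierVal_eq {V : X.Opens} {f : Γ(T, j ⁻¹ᵁ V)} (hf : IsRegularSection j U h V f) :
    ∃ s : Γ(cartierModule j U h, V), cartierVal j U h V s = f :=
  ⟨(⟨f, hf⟩ : (cartierSubmodule j U h).obj (.op V)), rfl⟩

theorem cartierVal_smul {V : X.Opens} (r : Γ(X, V)) (s : Γ(cartierModule j U h, V)) :
    cartierVal j U h V (r • s) = j.app V r * cartierVal j U h V s :=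
  rfl

theorem cartierVal_map {V W : X.Opens} (i : W ≤ V) (s : Γ(cartierModule j U h, V)) :
    cartierVal j U h W ((cartierModule j U h).presheaf.map (homOfLE i).op s) =
      res (j.preimage_mono i) (cartierVal j U h V s) :=
  rfl

end Cartier

/-- Restriction of sections of a sheaf of modules. -/
def mres {X : Scheme.{u}} (L : X.Modules) {V W : X.Opens} (h : W ≤ V) : Γ(L, V) →+ Γ(L, W) :=
  (L.presheaf.map (homOfLE h).op).hom

theorem mres_mres {X : Scheme.{u}} (L : X.Modules) {V W W' : X.Opens} (h : W ≤ V) (h' : W' ≤ W)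
    (s : Γ(L, V)) : mres L h' (mres L h s) = mres L (h'.trans h) s := by
  change L.presheaf.map _ (L.presheaf.map _ s) = _
  rw [← ConcreteCategory.comp_apply, ← Functor.map_comp]
  rfl

theorem mres_self {X : Scheme.{u}} (L : X.Modules) {V : X.Opens} (h : V ≤ V) (s : Γ(L, V)) :
    mres L h s = s := by
  change L.presheaf.map (𝟙 _) s = s
  simp

theorem mres_smul {X : Scheme.{u}} (L : X.Modules) {V W : X.Opens} (h : W ≤ V) (r : Γ(X, V))
    (s : Γ(L, V)) : mres L h (r • s) = res h r • mres L h s :=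
  Scheme.Modules.map_smul L _ _ _

theorem hom_mres {X : Scheme.{u}} {L L' : X.Modules} (φ : L ⟶ L') {V W : X.Opens} (h : W ≤ V)
    (s : Γ(L, V)) : φ.app W (mres L h s) = mres L' h (φ.app V s) :=
  ConcreteCategory.congr_hom (φ.mapPresheaf.naturality (homOfLE h).op) s

namespace SmoothFan

variable {N : Type u} [AddCommGroup N] {ι : Type u} (Δ : SmoothFan N ι)
variable (k : Type u) [Field k]

/-- The Laurent polynomials and the functions on the torus. -/
def laurentEquiv {W : (Δ.torus k).Opens} (hW : ⊤ ≤ W) :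
    Δ.chartRing k Δ.zeroCone ≃+* Γ(Δ.torus k, W) :=
  RingEquiv.ofBijective (Δ.laurent k W) (Δ.laurent_bijective k hW)

theorem laurent_laurentEquiv_symm {W : (Δ.torus k).Opens} (hW : ⊤ ≤ W) (f : Γ(Δ.torus k, W)) :
    Δ.laurent k W ((Δ.laurentEquiv k hW).symm f) = f :=
  (Δ.laurentEquiv k hW).apply_symm_apply f

/-- The function on the torus underlying a section of `𝒪_X(D)`. -/
def val (a : ι → ℤ) (V : (Δ.variety k).Opens) :
    Γ(Δ.divisorSheaf k a, V) →+ Γ(Δ.torus k, Δ.chart k Δ.zeroCone ⁻¹ᵁ V) :=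
  cartierVal _ _ _ V

theorem val_injective (a : ι → ℤ) (V : (Δ.variety k).Opens) :
    Function.Injective (Δ.val k a V) :=
  cartierVal_injective _ _ _ V

theorem isRegular_val {a : ι → ℤ} {V : (Δ.variety k).Opens} (s : Γ(Δ.divisorSheaf k a, V)) :
    Δ.IsRegular k a V (Δ.val k a V s) :=
  isRegularSection_cartierVal _ _ _ s

theorem exists_val_eq {a : ι → ℤ} {V : (Δ.variety k).Opens}
    {f : Γ(Δ.torus k, Δ.chart k Δ.zeroCone ⁻¹ᵁ V)} (hf : Δ.IsRegular k a V f) :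
    ∃ s : Γ(Δ.divisorSheaf k a, V), Δ.val k a V s = f :=
  exists_cartierVal_eq _ _ _ hf

theorem val_smul {a : ι → ℤ} {V : (Δ.variety k).Opens} (r : Γ(Δ.variety k, V))
    (s : Γ(Δ.divisorSheaf k a, V)) :
    Δ.val k a V (r • s) = (Δ.chart k Δ.zeroCone).app V r * Δ.val k a V s :=
  cartierVal_smul _ _ _ r s

theorem val_mres {a : ι → ℤ} {V W : (Δ.variety k).Opens} (i : W ≤ V)
    (s : Γ(Δ.divisorSheaf k a, V)) :
    Δ.val k a W (mres _ i s) = res ((Δ.chart k Δ.zeroCone).preimage_mono i) (Δ.val k a V s) :=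
  cartierVal_map _ _ _ i s

theorem isRegular_res {a : ι → ℤ} {V W : (Δ.variety k).Opens} (i : W ≤ V)
    {f : Γ(Δ.torus k, Δ.chart k Δ.zeroCone ⁻¹ᵁ V)} (hf : Δ.IsRegular k a V f) :
    Δ.IsRegular k a W (res ((Δ.chart k Δ.zeroCone).preimage_mono i) f) :=
  IsRegularSection.res _ i hf

theorem isRegular_zeroCone (a : ι → ℤ) (P : Δ.chartRing k Δ.zeroCone) :
    Δ.IsRegular k a (Δ.affine k Δ.zeroCone) (Δ.laurent k _ P) :=
  (Δ.isRegular_laurent_iff k).2 fun _ _ _ hρ => absurd hρ (Finset.notMem_empty _)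

/-- Over the torus the retract gives `Φ` and `Ψ` for `exists_floor`. Their semilinearity is
linearity over functions, because `F` pulls `χ^m` back to `χ^{ℓm}`. Their compatibility with a ray
`ρ` holds because morphisms of sheaves commute with restriction from `U_ρ` to the torus. -/
theorem exists_floor_of_retract {l : ℕ} (hl : 1 ≤ l) {a b : ι → ℤ}
    (R : Retract (Δ.divisorSheaf k b)
      ((Scheme.Modules.pushforward (Δ.frobenius k l)).obj (Δ.divisorSheaf k a))) :
    ∃ m : Module.Dual ℤ N, ∀ ρ, b ρ = (a ρ + m (Δ.ray ρ)) / l := by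
  let j := Δ.chart k Δ.zeroCone
  let U₀ := Δ.affine k Δ.zeroCone
  let F := Δ.frobenius k l
  have hle (σ) := Δ.affine_le_preimage k l σ
  have hge (σ) := Δ.preimage_affine_le k hl σ
  have hU (σ) : ⊤ ≤ j ⁻¹ᵁ Δ.affine k σ := Δ.top_le_preimage_affine k σ
  have hFU (σ) : ⊤ ≤ j ⁻¹ᵁ F ⁻¹ᵁ Δ.affine k σ := (hU σ).trans (j.preimage_mono (hle σ))
  have hreg (P) : Δ.IsRegular k a (F ⁻¹ᵁ U₀) (Δ.laurent k _ P) := by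
    have := Δ.isRegular_res k (hge Δ.zeroCone) (Δ.isRegular_zeroCone k a P)
    rwa [res_laurent] at this
  -- `s P` and `t P` are the sections over the torus with underlying Laurent polynomial `P`. For the
  -- push-forward these live on `F ⁻¹ᵁ U₀`, which is why both inclusions between the charts and
  -- their preimages are needed.
  choose s hs using fun P => Δ.exists_val_eq k (Δ.isRegular_zeroCone k b P)
  choose t ht using fun P => Δ.exists_val_eq k (hreg P)
  let φ : Γ(Δ.divisorSheaf k b, U₀) →+ Γ(Δ.divisorSheaf k a, F ⁻¹ᵁ U₀) := (R.i.app U₀).hom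
  let ψ : Γ(Δ.divisorSheaf k a, F ⁻¹ᵁ U₀) →+ Γ(Δ.divisorSheaf k b, U₀) := (R.r.app U₀).hom
  have hs_add (P Q) : s (P + Q) = s P + s Q := Δ.val_injective k _ _ (by
    rw [map_add, hs, hs, hs, map_add])
  have ht_add (P Q) : t (P + Q) = t P + t Q := Δ.val_injective k _ _ (by
    rw [map_add, ht, ht, ht, map_add])
  let Φ : Δ.chartRing k Δ.zeroCone →+ Δ.chartRing k Δ.zeroCone :=
    AddMonoidHom.mk' (fun P => (Δ.laurentEquiv k (hFU Δ.zeroCone)).symm (Δ.val k a _ (φ (s P))))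
      (fun P Q => by rw [hs_add, map_add, map_add, map_add])
  let Ψ : Δ.chartRing k Δ.zeroCone →+ Δ.chartRing k Δ.zeroCone :=
    AddMonoidHom.mk' (fun P => (Δ.laurentEquiv k (hU Δ.zeroCone)).symm (Δ.val k b _ (ψ (t P))))
      (fun P Q => by rw [ht_add, map_add, map_add, map_add])
  have hΦ (P) : Δ.val k a _ (φ (s P)) = Δ.laurent k _ (Φ P) :=
    (Δ.laurent_laurentEquiv_symm k _ _).symm
  have hΨ (P) : Δ.val k b _ (ψ (t P)) = Δ.laurent k _ (Ψ P) :=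
    (Δ.laurent_laurentEquiv_symm k _ _).symm
  have hφt (P) : φ (s P) = t (Φ P) := Δ.val_injective k _ _ (by rw [ht]; exact hΦ P)
  have hchar (m) : ∃ g : Γ(Δ.variety k, U₀), j.app _ g =
      Δ.laurent k _ (AddMonoidAlgebra.single m 1) ∧ j.app _ (F.app _ g) =
        Δ.laurent k _ (AddMonoidAlgebra.single (l • m) 1) := by
    obtain ⟨g, hg⟩ := Δ.exists_app_eq_laurent k Δ.zeroCone (AddMonoidAlgebra.single m 1)
    rw [chartRingMap_single] at hg
    refine ⟨g, hg, ?_⟩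
    rw [app_frobenius, hg, chartFrobenius_app_laurent, res_laurent]
    congr 1
    exact AddMonoidAlgebra.mapDomain_single
  refine Δ.exists_floor k hl Φ Ψ (fun m P => ?_) (fun m P => ?_) (fun P => ?_)
    (fun ρ P hP => ?_) (fun ρ P hP => ?_)
  · obtain ⟨g, hg, hFg⟩ := hchar m
    apply (Δ.laurent_bijective k (hFU Δ.zeroCone)).1
    have h1 : s (AddMonoidAlgebra.single m 1 * P) = g • s P := Δ.val_injective k _ _ (by
      rw [val_smul, hs, hs, map_mul, ← hg])
    have h2 : φ (g • s P) = F.app _ g • φ (s P) := R.i.app_smul g (s P)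
    rw [← hΦ, h1, h2, val_smul, hFg, hΦ, map_mul]
  · obtain ⟨g, hg, hFg⟩ := hchar m
    apply (Δ.laurent_bijective k (hU Δ.zeroCone)).1
    have h1 : t (AddMonoidAlgebra.single (l • m) 1 * P) = F.app _ g • t P :=
      Δ.val_injective k _ _ (by rw [val_smul, ht, ht, map_mul, ← hFg])
    have h2 : ψ (F.app _ g • t P) = g • ψ (t P) := R.r.app_smul (U := U₀) g (t P)
    rw [← hΨ, h1, h2, val_smul, hg, hΨ, map_mul]
  · apply (Δ.laurent_bijective k (hU Δ.zeroCone)).1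
    have h1 : ψ (φ (s P)) = s P :=
      congrArg (fun f : Δ.divisorSheaf k b ⟶ Δ.divisorSheaf k b => f.app U₀ (s P)) R.retract
    rw [← hΨ, ← hφt, h1, hs]
  -- If `P` is regular along `ρ`, then `s P` extends to `U_ρ`, and so does its image; its exponents
  -- satisfy the inequality of `ρ`.
  · let σ : Δ.Cone := ⟨{ρ}, Δ.singleton_mem ρ⟩
    have hP' : Δ.IsRegular k b (Δ.affine k σ) (Δ.laurent k _ P) :=
      (Δ.isRegular_laurent_iff k).2 fun m hm ρ' hρ' => by
        rw [Finset.mem_singleton.1 hρ']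
        exact hP m hm
    obtain ⟨s', hs'⟩ := Δ.exists_val_eq k hP'
    have h0 := Δ.affine_mono k (Δ.zeroCone_le σ)
    have h1 : mres _ h0 s' = s P := Δ.val_injective k _ _ (by
      rw [hs]
      rw [val_mres, hs', res_laurent])
    let φ' : Γ(Δ.divisorSheaf k a, F ⁻¹ᵁ Δ.affine k σ) := R.i.app _ s'
    have h2 : φ (s P) = mres (Δ.divisorSheaf k a) (F.preimage_mono h0) φ' := by
      rw [← h1]
      exact hom_mres R.i h0 s'
    obtain ⟨Q, hQ⟩ := (Δ.laurent_bijective k (hFU σ)).2 (Δ.val k a _ φ')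
    have h3 : Q = Φ P := by
      apply (Δ.laurent_bijective k (hFU Δ.zeroCone)).1
      rw [← hΦ, h2, val_mres, ← hQ, res_laurent]
    have h4 := Δ.isRegular_res k (hle σ) (Δ.isRegular_val k φ')
    rw [← hQ, h3, res_laurent] at h4
    exact fun m hm => (Δ.isRegular_laurent_iff k).1 h4 m hm ρ (Finset.mem_singleton_self ρ)
  · let σ : Δ.Cone := ⟨{ρ}, Δ.singleton_mem ρ⟩
    have hP' : Δ.IsRegular k a (Δ.affine k σ) (Δ.laurent k _ P) :=
      (Δ.isRegular_laurent_iff k).2 fun m hm ρ' hρ' => by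
        rw [Finset.mem_singleton.1 hρ']
        exact hP m hm
    replace hP' := Δ.isRegular_res k (hge σ) hP'
    rw [res_laurent] at hP'
    obtain ⟨t', ht'⟩ := Δ.exists_val_eq k hP'
    have h0 := Δ.affine_mono k (Δ.zeroCone_le σ)
    have h1 : mres (Δ.divisorSheaf k a) (F.preimage_mono h0) t' = t P :=
      Δ.val_injective k _ _ (by
        rw [ht]
        rw [val_mres, ht', res_laurent])
    let ψ' : Γ(Δ.divisorSheaf k b, Δ.affine k σ) := R.r.app (Δ.affine k σ) t'
    have h2 : ψ (t P) = mres (Δ.divisorSheaf k b) h0 ψ' := by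
      rw [← h1]
      exact hom_mres R.r h0 t'
    obtain ⟨Q, hQ⟩ := (Δ.laurent_bijective k (hU σ)).2 (Δ.val k b _ ψ')
    have h3 : Q = Ψ P := by
      apply (Δ.laurent_bijective k (hU Δ.zeroCone)).1
      rw [← hΨ, h2, val_mres, ← hQ, res_laurent]
    have h4 : Δ.IsRegular k b _ _ := Δ.isRegular_val k ψ'
    rw [← hQ, h3] at h4
    exact fun m hm => (Δ.isRegular_laurent_iff k).1 h4 m hm ρ (Finset.mem_singleton_self ρ)

end SmoothFan

end Toric

/-! ### Morphisms out of push-forwards on affine schemes -/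

namespace Toric

/-- The right adjoint is full on morphisms out of objects at which the counit is invertible: there
`H` turns the inverse counit into the unit, and the triangle identity recovers `f`. -/
theorem exists_map_eq_of_isIso_counit {C D : Type*} [Category* C] [Category* D] {G : C ⥤ D}
    {H : D ⥤ C} (adj : G ⊣ H) {M N : D} [IsIso (adj.counit.app M)] (f : H.obj M ⟶ H.obj N) :
    ∃ φ : M ⟶ N, H.map φ = f := by
  refine ⟨inv (adj.counit.app M) ≫ G.map f ≫ adj.counit.app N, ?_⟩
  have h1 : H.map (inv (adj.counit.app M)) = adj.unit.app (H.obj M) := by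
    rw [Functor.map_inv, IsIso.inv_eq_of_inv_hom_id]
    simp
  rw [Functor.map_comp, h1, Functor.map_comp, ← Functor.comp_map, ← adj.unit.naturality_assoc,
    adj.right_triangle_components]
  exact Category.comp_id f

/-- On an affine scheme, linear maps between global sections extend to morphisms of sheaves of
modules, if the source is quasi-coherent. -/
theorem exists_hom_of_linearMap {R : CommRingCat.{u}} (M N : (Spec R).Modules)
    [h : IsIso M.fromTildeΓ] (f : Γ(M, ⊤) →ₗ[R] Γ(N, ⊤)) :
    ∃ φ : M ⟶ N, ∀ s : Γ(M, ⊤), φ.app ⊤ s = f s := by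
  let F : moduleSpecΓFunctor.obj M ⟶ moduleSpecΓFunctor.obj N :=
    @ModuleCat.ofHom R _ Γ(M, ⊤) Γ(N, ⊤) _ _ _ _ f
  have : IsIso ((tilde.adjunction (R := R)).counit.app M) := h
  obtain ⟨φ, hφ⟩ := exists_map_eq_of_isIso_counit (tilde.adjunction (R := R)) F
  exact ⟨φ, fun s => congrArg (fun g => g.hom s) hφ⟩

/-- The projection formula `hp` says that `p` is `R`-linear. The push-forward along an affine
morphism of affine schemes is quasi-coherent, so a linear map of global sections suffices. In this
way the projection of `k[M]` becomes available over arbitrary open subsets of the torus. -/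
theorem exists_pushforward_hom {R S : CommRingCat.{u}} (φ : R ⟶ S) (p : S →+ R)
    (hp : ∀ r x, p (φ r * x) = r * p x) :
    ∃ π : (Scheme.Modules.pushforward (Spec.map φ)).obj (structureModule (Spec S)) ⟶
      structureModule (Spec R), ∀ x : S,
        (π.app ⊤).hom ((Scheme.ΓSpecIso S).inv x : Γ(Spec S, ⊤)) =
          ((Scheme.ΓSpecIso R).inv (p x) : Γ(Spec R, ⊤)) := by
  have := isIso_fromTildeΓ_pushforward φ (structureModule (Spec S))
  have hinv' (R : CommRingCat.{u}) (x : R) : 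
     (Scheme.ΓSpecIso R).hom ((Scheme.ΓSpecIso R).inv x) = x := by
    rw [← ConcreteCategory.comp_apply]; simp
  let f : Γ((Scheme.Modules.pushforward (Spec.map φ)).obj (structureModule (Spec S)), ⊤) →ₗ[R]
      Γ(structureModule (Spec R), ⊤) :=
    { toFun := fun x => (Scheme.ΓSpecIso R).inv (p ((Scheme.ΓSpecIso S).hom (show Γ(Spec S, ⊤) from x)))
      map_add' := fun x y => by
        exact (congrArg (fun z => (Scheme.ΓSpecIso R).inv (p z))
          (map_add (Scheme.ΓSpecIso S).hom.hom (show Γ(Spec S, ⊤) from x) y)).trans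
          ((congrArg (Scheme.ΓSpecIso R).inv.hom (map_add p _ _)).trans (map_add _ _ _))
      map_smul' := fun r x => by
        have h1 : r • x = (show Γ((Scheme.Modules.pushforward (Spec.map φ)).obj (structureModule (Spec S)), ⊤) from 
            ((Spec.map φ).appTop ((Scheme.ΓSpecIso R).inv r) * (show Γ(Spec S, ⊤) from x) : Γ(Spec S, ⊤))) := by
          rw [Scheme.Modules.smul_Spec_def]
          change (Spec.map φ).appTop ((Spec R).presheaf.map (𝟙 _) _) * (show Γ(Spec S, ⊤) from x) = _
          simp
        have h2 (y : Γ(structureModule (Spec R), ⊤)) : r • y = (show Γ(structureModule (Spec R), ⊤) from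
           ((Scheme.ΓSpecIso R).inv r * (show Γ(Spec R, ⊤) from y) : Γ(Spec R, ⊤))) := by
          rw [Scheme.Modules.smul_Spec_def]
          change ((Spec R).presheaf.map (𝟙 _) _) * (show Γ(Spec R, ⊤) from y) = _
          rw [CategoryTheory.Functor.map_id]
          rfl
        refine Eq.trans ?_ (h2 _).symm
        rw [h1]
        have h3 : (Scheme.ΓSpecIso S).hom ((Spec.map φ).appTop ((Scheme.ΓSpecIso R).inv r)) = φ r := by
          rw [← ConcreteCategory.comp_apply, ← ConcreteCategory.comp_apply]
          simp
        change (Scheme.ΓSpecIso R).inv (p ((Scheme.ΓSpecIso S).hom (_ * _))) = (Scheme.ΓSpecIso R).inv r * (Scheme.ΓSpecIso R).inv _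
        rw [map_mul, h3, hp, map_mul] }
  obtain ⟨π, hπ⟩ := exists_hom_of_linearMap _ (structureModule (Spec R)) f
  refine ⟨π, fun x => (hπ _).trans ?_⟩
  change (Scheme.ΓSpecIso R).inv (p ((Scheme.ΓSpecIso S).hom ((Scheme.ΓSpecIso S).inv x))) = _
  rw [hinv']

end Toric

/-! ### The trace of the Frobenius morphism -/

namespace Toric

theorem exists_modules_hom {X : Scheme.{u}} (L L' : X.Modules) (f : ∀ V, Γ(L, V) →+ Γ(L', V))
    (hres : ∀ {V W : X.Opens} (h : W ≤ V) (s : Γ(L, V)), f W (mres L h s) = mres L' h (f V s))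
    (hsmul : ∀ (V : X.Opens) (r : Γ(X, V)) (s : Γ(L, V)), f V (r • s) = r • f V s) :
    ∃ φ : L ⟶ L', ∀ (V : X.Opens) (s : Γ(L, V)), φ.app V s = f V s :=
  ⟨⟨PresheafOfModules.homMk
      { app := fun V => AddCommGrpCat.ofHom (f V.unop)
        naturality := fun V W g => by
          ext s
          exact hres (leOfHom g.unop) s }
      (fun V r m => hsmul V.unop r m)⟩, fun _ _ => rfl⟩

theorem modules_hom_ext {X : Scheme.{u}} {L L' : X.Modules} {φ ψ : L ⟶ L'}
    (h : ∀ (V : X.Opens) (s : Γ(L, V)), φ.app V s = ψ.app V s) : φ = ψ := by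
  ext V s
  exact h V s

theorem isIso_of_bijective {X : Scheme.{u}} {L L' : X.Modules} (φ : L ⟶ L')
    (h : ∀ V : X.Opens, Function.Bijective (φ.app V)) : IsIso φ := by
  rw [Scheme.Modules.Hom.isIso_iff_isIso_app]
  intro U
  rw [ConcreteCategory.isIso_iff_bijective]
  exact h U

namespace SmoothFan

variable {N : Type u} [AddCommGroup N] {ι : Type u} (Δ : SmoothFan N ι)
variable (k : Type u) [Field k]

theorem nsmul_dualMonoid_injective {l : ℕ} (hl : 1 ≤ l) (σ : Δ.Cone) :
    Function.Injective fun m : Δ.dualMonoid σ => l • m := by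
  intro m m' h
  ext x
  have h1 := congrArg (fun m : Δ.dualMonoid σ => m.1 x) h
  change l • m.1 x = l • m'.1 x at h1
  rw [nsmul_eq_mul, nsmul_eq_mul] at h1
  exact mul_left_cancel₀ (by exact_mod_cast (Nat.pos_iff_ne_zero.1 hl)) h1

/-- The left inverse of `χ^m ↦ χ^{ℓ m}` which kills the other characters. -/
def frobProj {l : ℕ} (hl : 1 ≤ l) (σ : Δ.Cone) : Δ.chartRing k σ →+ Δ.chartRing k σ where
  toFun := AddMonoidAlgebra.comapDomain (fun m => l • m) (Δ.nsmul_dualMonoid_injective hl σ)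
  map_zero' := AddMonoidAlgebra.comapDomain_zero _ _
  map_add' := AddMonoidAlgebra.comapDomain_add _ _

theorem coeff_frobProj {l : ℕ} (hl : 1 ≤ l) (σ : Δ.Cone) (P : Δ.chartRing k σ)
    (m : Δ.dualMonoid σ) : (Δ.frobProj k hl σ P).coeff m = P.coeff (l • m) := by
  rfl

/-- The projection formula: exponents divisible by `ℓ` are stable under translation by `ℓM`. It
makes the projection a morphism of modules, and later lets denominators pass through the trace. -/
theorem frobProj_frobRing_mul {l : ℕ} (hl : 1 ≤ l) (P Q : Δ.chartRing k Δ.zeroCone) :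
    Δ.frobProj k hl Δ.zeroCone (Δ.frobRing k l Δ.zeroCone P * Q) =
      P * Δ.frobProj k hl Δ.zeroCone Q := by
  induction P using AddMonoidAlgebra.induction_linear with
  | zero => rw [map_zero, zero_mul, zero_mul, map_zero]
  | add f g hf hg => rw [map_add, add_mul, map_add, hf, hg, add_mul]
  | single m r =>
    have h1 : Δ.frobRing k l Δ.zeroCone (AddMonoidAlgebra.single m r) =
      AddMonoidAlgebra.single (l • m) r := AddMonoidAlgebra.mapDomain_single
    have hneg : -m.1 ∈ Δ.dualMonoid Δ.zeroCone := fun ρ hρ => absurd hρ (Finset.notMem_empty ρ)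
    have hadd (x : Δ.dualMonoid Δ.zeroCone) : x = m + (⟨-m.1, hneg⟩ + x) := Subtype.ext (by simp)
    rw [h1]
    ext x
    rw [coeff_frobProj, hadd x, smul_add, AddMonoidAlgebra.coeff_single_mul_add,
      AddMonoidAlgebra.coeff_single_mul_add, coeff_frobProj]

theorem frobProj_one {l : ℕ} (hl : 1 ≤ l) :
    Δ.frobProj k hl Δ.zeroCone 1 = 1 := by
  classical
  ext x
  have h : (0 = l • x) ↔ 0 = x :=
    ⟨fun h => Δ.nsmul_dualMonoid_injective hl _ (by simpa using h), fun h => by rw [← h, smul_zero]⟩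
  rw [coeff_frobProj, AddMonoidAlgebra.one_def, AddMonoidAlgebra.coeff_single,
    Finsupp.single_apply, Finsupp.single_apply]
  simp only [h]

/-- Pullback of functions on the torus along the Frobenius morphism. -/
def frobPull (l : ℕ) (V : (Δ.variety k).Opens) :
    Γ(Δ.torus k, Δ.chart k Δ.zeroCone ⁻¹ᵁ V) →+*
      Γ(Δ.torus k, Δ.chart k Δ.zeroCone ⁻¹ᵁ Δ.frobenius k l ⁻¹ᵁ V) :=
  (res (by rw [← Scheme.Hom.comp_preimage, ← Scheme.Hom.comp_preimage, chart_comp_frobenius])).comp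
    ((Δ.chartFrobenius k l Δ.zeroCone).app (Δ.chart k Δ.zeroCone ⁻¹ᵁ V)).hom

theorem app_frobenius_eq (l : ℕ) (V : (Δ.variety k).Opens) (g : Γ(Δ.variety k, V)) :
    (Δ.chart k Δ.zeroCone).app _ ((Δ.frobenius k l).app V g) =
      Δ.frobPull k l V ((Δ.chart k Δ.zeroCone).app V g) :=
  Δ.app_frobenius k l V g

theorem res_frobPull (l : ℕ) {V W : (Δ.variety k).Opens} (h : W ≤ V)
    (f : Γ(Δ.torus k, Δ.chart k Δ.zeroCone ⁻¹ᵁ V)) :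
    res ((Δ.chart k Δ.zeroCone).preimage_mono ((Δ.frobenius k l).preimage_mono h))
      (Δ.frobPull k l V f) =
      Δ.frobPull k l W (res ((Δ.chart k Δ.zeroCone).preimage_mono h) f) := by
  change res _ (res _ ((Δ.chartFrobenius k l Δ.zeroCone).app _ f)) =
    res _ ((Δ.chartFrobenius k l Δ.zeroCone).app _ _)
  rw [app_res, res_res, res_res]

theorem frobPull_laurent (l : ℕ) (V : (Δ.variety k).Opens) (P : Δ.chartRing k Δ.zeroCone) :
    Δ.frobPull k l V (Δ.laurent k _ P) = Δ.laurent k _ (Δ.frobRing k l Δ.zeroCone P) := by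
  change res _ ((Δ.chartFrobenius k l Δ.zeroCone).app _ _) = _
  rw [chartFrobenius_app_laurent, res_laurent]

/-- The projection of `k[M]` onto exponents divisible by `ℓ`, spread out to a morphism of sheaves.
Compatibility with restriction, the projection formula and the value on Laurent polynomials are all
that is used of it later. -/
theorem exists_trace {l : ℕ} (hl : 1 ≤ l) :
    ∃ tr : ∀ V : (Δ.variety k).Opens,
        Γ(Δ.torus k, Δ.chart k Δ.zeroCone ⁻¹ᵁ Δ.frobenius k l ⁻¹ᵁ V) →+
          Γ(Δ.torus k, Δ.chart k Δ.zeroCone ⁻¹ᵁ V),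
      (∀ (V W : (Δ.variety k).Opens) (h : W ≤ V) f,
        tr W (res ((Δ.chart k Δ.zeroCone).preimage_mono ((Δ.frobenius k l).preimage_mono h)) f) =
          res ((Δ.chart k Δ.zeroCone).preimage_mono h) (tr V f)) ∧
      (∀ V f g, tr V (Δ.frobPull k l V f * g) = f * tr V g) ∧
      (∀ V P, tr V (Δ.laurent k _ P) = Δ.laurent k _ (Δ.frobProj k hl Δ.zeroCone P)) := by
  let j := Δ.chart k Δ.zeroCone
  let F := Δ.frobenius k l
  let G := Δ.chartFrobenius k l Δ.zeroCone
  have hV (V : (Δ.variety k).Opens) : G ⁻¹ᵁ j ⁻¹ᵁ V = j ⁻¹ᵁ F ⁻¹ᵁ V := by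
    rw [← Scheme.Hom.comp_preimage, ← Scheme.Hom.comp_preimage, chart_comp_frobenius]
  obtain ⟨π, hπ⟩ := exists_pushforward_hom (CommRingCat.ofHom (Δ.frobRing k l Δ.zeroCone))
    (Δ.frobProj k hl Δ.zeroCone) (Δ.frobProj_frobRing_mul k hl)
  let p (W : (Δ.torus k).Opens) : Γ(Δ.torus k, G ⁻¹ᵁ W) →+ Γ(Δ.torus k, W) := (π.app W).hom
  have hpres (W W' : (Δ.torus k).Opens) (h : W' ≤ W) (f) :
      p W' (res (G.preimage_mono h) f) = res h (p W f) := hom_mres π h f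
  have hpsmul (W : (Δ.torus k).Opens) (r f) : p W (G.app W r * f) = r * p W f :=
    π.app_smul (U := W) r f
  have hptop (P) : p ⊤ (Δ.chartFunction k Δ.zeroCone P) =
    Δ.chartFunction k Δ.zeroCone (Δ.frobProj k hl Δ.zeroCone P) := hπ P
  refine ⟨fun V => (p (j ⁻¹ᵁ V)).comp (res (hV V).le).toAddMonoidHom, fun V W h f => ?_,
    fun V f g => ?_, fun V P => ?_⟩
  · change p _ (res _ (res _ f)) = res _ (p _ (res _ f))
    rw [← hpres, res_res, res_res]
  · change p _ (res _ (res _ (G.app _ f) * g)) = f * p _ (res _ g)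
    rw [map_mul, res_res, res_self, hpsmul]
  · change p _ (res _ (Δ.laurent k _ P)) = Δ.laurent k _ _
    rw [res_laurent]
    have h1 := hpres ⊤ (j ⁻¹ᵁ V) le_top (Δ.chartFunction k Δ.zeroCone P)
    rw [hptop] at h1
    exact h1

end SmoothFan

end Toric

/-! ### Every rounded divisor gives a direct summand -/

namespace Toric

namespace SmoothFan

variable {N : Type u} [AddCommGroup N] {ι : Type u} (Δ : SmoothFan N ι)
variable (k : Type u) [Field k]

theorem exists_mem_affine (x : Δ.variety k) : ∃ σ, x ∈ Δ.affine k σ := by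
  obtain ⟨σ, y, rfl⟩ := Δ.exists_chart k x
  exact ⟨σ, y, rfl⟩

theorem laurent_single_add (W : (Δ.torus k).Opens) (m m' : Module.Dual ℤ N) :
    Δ.laurent k W (AddMonoidAlgebra.single (Δ.mono (m + m')) 1) =
      Δ.laurent k W (AddMonoidAlgebra.single (Δ.mono m) 1) *
        Δ.laurent k W (AddMonoidAlgebra.single (Δ.mono m') 1) := by
  rw [mono_add, ← map_mul, AddMonoidAlgebra.single_mul_single, one_mul]

theorem laurent_single_zero (W : (Δ.torus k).Opens) :
    Δ.laurent k W (AddMonoidAlgebra.single (Δ.mono 0) 1) = 1 :=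
  map_one _

/-- With local equations `χ^{ma}`, `χ^{mb}` on `U_σ`, one has `χ^{ma} χ^m F^*f = χ^{ma + m - ℓ mb}
F^*(χ^{mb} f)`. The exponent lies in `σ^∨` because `ℓ b ρ ≤ a ρ + m(u_ρ)`. -/
theorem isRegular_frobPull {l : ℕ} (hl : 1 ≤ l) {a b : ι → ℤ} {m : Module.Dual ℤ N}
    (hb : ∀ ρ, b ρ = (a ρ + m (Δ.ray ρ)) / l) {V : (Δ.variety k).Opens}
    {f : Γ(Δ.torus k, Δ.chart k Δ.zeroCone ⁻¹ᵁ V)} (hf : Δ.IsRegular k b V f) :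
    Δ.IsRegular k a (Δ.frobenius k l ⁻¹ᵁ V)
      (Δ.laurent k _ (AddMonoidAlgebra.single (Δ.mono m) 1) * Δ.frobPull k l V f) := by
  refine IsRegularSection.of_locally _ fun x hx => ?_
  obtain ⟨σ, hσ⟩ := Δ.exists_mem_affine k (Δ.frobenius k l x)
  let V' := V ⊓ Δ.affine k σ
  refine ⟨Δ.frobenius k l ⁻¹ᵁ V', (Δ.frobenius k l).preimage_mono inf_le_left, ⟨hx, hσ⟩, ?_⟩
  rw [map_mul, res_laurent, res_frobPull _ _ _ inf_le_left]
  have hVσ : Δ.frobenius k l ⁻¹ᵁ V' ≤ Δ.affine k σ :=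
    ((Δ.frobenius k l).preimage_mono inf_le_right).trans (Δ.preimage_affine_le k hl σ)
  obtain ⟨ma, hma⟩ := Δ.exists_dual σ a
  obtain ⟨mb, hmb⟩ := Δ.exists_dual σ b
  obtain ⟨g, hg⟩ := (Δ.isRegular_iff k inf_le_right hmb).1
    (Δ.isRegular_res k (inf_le_left : V' ≤ V) hf)
  have hmem : ma + m - l • mb ∈ Δ.dualMonoid σ := fun ρ hρ => by
    have := Int.mul_ediv_self_le (x := a ρ + m (Δ.ray ρ)) (k := l) (by omega)
    rw [LinearMap.sub_apply, LinearMap.add_apply, LinearMap.smul_apply, hma ρ hρ, hmb ρ hρ,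
      nsmul_eq_mul, hb]
    linarith
  obtain ⟨c, hc⟩ := Δ.exists_app_eq_laurent k σ (AddMonoidAlgebra.single ⟨_, hmem⟩ 1)
  rw [chartRingMap_single] at hc
  refine (Δ.isRegular_iff k hVσ hma).2 ⟨res hVσ c * (Δ.frobenius k l).app V' g, ?_⟩
  rw [map_mul, app_res, hc, app_frobenius_eq, hg, map_mul, res_character, frobPull_laurent,
    res_laurent, res_character, ← mul_assoc, ← mul_assoc, ← map_mul]
  congr 1
  have h1 : Δ.frobRing k l Δ.zeroCone (AddMonoidAlgebra.single (Δ.mono mb) 1) =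
      AddMonoidAlgebra.single (l • Δ.mono mb) 1 := AddMonoidAlgebra.mapDomain_single
  rw [h1, ← map_mul, AddMonoidAlgebra.single_mul_single, AddMonoidAlgebra.single_mul_single]
  congr 2
  exact Subtype.ext (sub_add_cancel (ma + m) (l • mb))

theorem isAffineOpen_affine (σ : Δ.Cone) : IsAffineOpen (Δ.affine k σ) :=
  have : IsAffine ((Δ.charts k).obj σ) :=
    inferInstanceAs (IsAffine (Spec (CommRingCat.of (Δ.chartRing k σ))))
  isAffineOpen_opensRange (Δ.chart k σ)

/-- For a Laurent polynomial this is a comparison of exponents. A section over a general open set is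
reduced to that case on basic open subsets `D(s)` of charts. Their preimages are `D(F^*s)`, so the
denominators are powers of pulled back functions, and these leave the trace by the projection
formula. -/
theorem isRegular_trace {l : ℕ} (hl : 1 ≤ l)
    (tr : ∀ V : (Δ.variety k).Opens,
        Γ(Δ.torus k, Δ.chart k Δ.zeroCone ⁻¹ᵁ Δ.frobenius k l ⁻¹ᵁ V) →+
          Γ(Δ.torus k, Δ.chart k Δ.zeroCone ⁻¹ᵁ V))
    (tr_res : ∀ (V W : (Δ.variety k).Opens) (h : W ≤ V) f,
        tr W (res ((Δ.chart k Δ.zeroCone).preimage_mono ((Δ.frobenius k l).preimage_mono h)) f) =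
          res ((Δ.chart k Δ.zeroCone).preimage_mono h) (tr V f))
    (tr_mul : ∀ V f g, tr V (Δ.frobPull k l V f * g) = f * tr V g)
    (tr_laurent : ∀ V P, tr V (Δ.laurent k _ P) =
      Δ.laurent k _ (Δ.frobProj k hl Δ.zeroCone P))
    {a b : ι → ℤ} {m : Module.Dual ℤ N}
    (hb : ∀ ρ, b ρ = (a ρ + m (Δ.ray ρ)) / l) {V : (Δ.variety k).Opens}
    {f : Γ(Δ.torus k, Δ.chart k Δ.zeroCone ⁻¹ᵁ Δ.frobenius k l ⁻¹ᵁ V)}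
    (hf : Δ.IsRegular k a (Δ.frobenius k l ⁻¹ᵁ V) f) :
    Δ.IsRegular k b V (tr V (Δ.laurent k _ (AddMonoidAlgebra.single (Δ.mono (-m)) 1) * f)) := by
  let j := Δ.chart k Δ.zeroCone
  let F := Δ.frobenius k l
  refine IsRegularSection.of_locally _ fun x hx => ?_
  obtain ⟨σ, hσ⟩ := Δ.exists_mem_affine k x
  obtain ⟨s, hsV, hxs⟩ := (Δ.isAffineOpen_affine k σ).exists_basicOpen_le
    (V := V ⊓ Δ.affine k σ) ⟨x, hx, hσ⟩ hσ
  let D := (Δ.variety k).basicOpen s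
  have hDV : D ≤ V := hsV.trans inf_le_left
  have hDσ : D ≤ Δ.affine k σ := hsV.trans inf_le_right
  refine ⟨D, hDV, hxs, ?_⟩
  have hpre : F ⁻¹ᵁ Δ.affine k σ = Δ.affine k σ :=
    le_antisymm (Δ.preimage_affine_le k hl σ) (Δ.affine_le_preimage k l σ)
  have haff : IsAffineOpen (F ⁻¹ᵁ Δ.affine k σ) := by
    rw [hpre]
    exact Δ.isAffineOpen_affine k σ
  obtain ⟨ma, hma⟩ := Δ.exists_dual σ a
  have hFD : F ⁻¹ᵁ D = (Δ.variety k).basicOpen (F.app _ s) := Scheme.preimage_basicOpen F s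
  have hFDσ : F ⁻¹ᵁ D ≤ Δ.affine k σ := (F.preimage_mono hDσ).trans hpre.le
  obtain ⟨g, hg⟩ := (Δ.isRegular_iff k hFDσ hma).1 (Δ.isRegular_res k (F.preimage_mono hDV) hf)
  obtain ⟨n, y, hy⟩ := exists_eq_pow_mul_of_isAffineOpen _ _ haff (F.app _ s) (res hFD.ge g)
  obtain ⟨Y, hY⟩ := Δ.exists_laurent_eq_app k σ (res hpre.ge y)
  have hy' : res (F.preimage_mono hDσ) y = res (F.preimage_mono hDσ) (F.app _ s) ^ n * g := by
    have h1 := congrArg (res hFD.le) hy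
    rw [map_mul, map_pow] at h1
    refine ((res_res _ _ _).symm.trans h1).trans ?_
    congr 1
    · congr 1
      exact res_res _ _ _
    · rw [res_res, res_self]
  have hY' : j.app _ (res (F.preimage_mono hDσ) y) =
      Δ.laurent k _ (Δ.chartRingMap k (Δ.zeroCone_le σ) Y) := by
    have h1 := congrArg (res (j.preimage_mono hFDσ)) hY
    rw [res_laurent, ← app_res j hFDσ, res_res] at h1
    exact h1
  let S : Γ(Δ.variety k, D) := res hDσ s
  have hS : IsUnit S := RingedSpace.isUnit_res_basicOpen _ s
  let f' := res (j.preimage_mono (F.preimage_mono hDV)) f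
  -- After multiplication by the pullback of `S ^ n`, the argument of the trace is a Laurent
  -- polynomial with exponents in `-m - ma + σ^∨`.
  have key : Δ.frobPull k l D (j.app D (S ^ n)) *
      (Δ.laurent k _ (AddMonoidAlgebra.single (Δ.mono (-m)) 1) * f') =
      Δ.laurent k _ (AddMonoidAlgebra.single (Δ.mono (-m - ma)) 1 *
        Δ.chartRingMap k (Δ.zeroCone_le σ) Y) := by
    have h2 : Δ.frobPull k l D (j.app D S) = j.app _ (res (F.preimage_mono hDσ) (F.app _ s)) := by
      rw [← app_frobenius_eq, ← app_res F hDσ]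
    rw [map_mul, ← hY', hy', map_mul, hg, map_pow, map_pow, map_pow, ← h2, res_character,
      sub_eq_add_neg, laurent_single_add]
    have h3 := Δ.laurent_single_add k (j ⁻¹ᵁ F ⁻¹ᵁ D) (-ma) ma
    rw [neg_add_cancel, laurent_single_zero] at h3
    change _ * (Δ.laurent k (j ⁻¹ᵁ F ⁻¹ᵁ D) _ * f') = Δ.laurent k (j ⁻¹ᵁ F ⁻¹ᵁ D) _ *
      Δ.laurent k (j ⁻¹ᵁ F ⁻¹ᵁ D) _ * (_ * (Δ.laurent k (j ⁻¹ᵁ F ⁻¹ᵁ D) _ * f'))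
    linear_combination (Δ.frobPull k l D (j.app D S) ^ n *
      Δ.laurent k (j ⁻¹ᵁ F ⁻¹ᵁ D) (AddMonoidAlgebra.single (Δ.mono (-m)) 1) * f') * h3
  have htr := congrArg (tr D) key
  rw [tr_mul, tr_laurent] at htr
  have hgoal : res (j.preimage_mono hDV)
      (tr V (Δ.laurent k _ (AddMonoidAlgebra.single (Δ.mono (-m)) 1) * f)) =
      tr D (Δ.laurent k _ (AddMonoidAlgebra.single (Δ.mono (-m)) 1) * f') := by
    rw [← tr_res V D hDV, map_mul, res_laurent]
  -- An exponent `μ` of the projection satisfies `ℓμ = -m - ma + ν` with `ν` in `σ^∨`, so the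
  -- integer `-μ(u_ρ)` is at most `(a ρ + m(u_ρ))/ℓ`, hence at most its integral part `b ρ`.
  have hQ : Δ.IsRegular k b (Δ.affine k σ) (Δ.laurent k _ (Δ.frobProj k hl Δ.zeroCone
      (AddMonoidAlgebra.single (Δ.mono (-m - ma)) 1 * Δ.chartRingMap k (Δ.zeroCone_le σ) Y))) := by
    classical
    refine (Δ.isRegular_laurent_iff k).2 fun μ hμ ρ hρ => ?_
    rw [Finsupp.mem_support_iff, coeff_frobProj, ← Finsupp.mem_support_iff,
      AddMonoidAlgebra.support_coeff_single_mul_eq_image _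
      (by simp) (fun x y h => add_left_cancel h)] at hμ
    obtain ⟨ν, hν, hμ⟩ := Finset.mem_image.1 hμ
    have h4 := (Δ.mem_range_chartRingMap_iff k σ _).1 ⟨Y, rfl⟩ ν hν ρ hρ
    have h5 := congrArg (fun m : Δ.dualMonoid Δ.zeroCone => m.1 (Δ.ray ρ)) hμ
    change (-m - ma + ν.1) (Δ.ray ρ) = (l • μ.1) (Δ.ray ρ) at h5
    rw [LinearMap.add_apply, LinearMap.sub_apply, LinearMap.neg_apply, LinearMap.smul_apply,
      nsmul_eq_mul, hma ρ hρ] at h5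
    have h6 : -μ.1 (Δ.ray ρ) ≤ (a ρ + m (Δ.ray ρ)) / l := by
      rw [Int.le_ediv_iff_mul_le (by omega)]
      linarith
    rw [← hb] at h6
    linarith
  replace hQ := Δ.isRegular_res k hDσ hQ
  rw [res_laurent, ← htr] at hQ
  obtain ⟨u, hu⟩ := (hS.pow n).exists_left_inv
  have hreg := IsRegularSection.smul _ u hQ
  rw [← mul_assoc, ← map_mul, hu, map_one, one_mul, ← hgoal] at hreg
  exact hreg

/-- The inclusion is `f ↦ χ^m F^*f` and the retraction is `f ↦ tr(χ^{-m} f)`. The composite is `f ↦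
tr(F^*f) = f tr(1) = f`. -/
theorem nonempty_retract {l : ℕ} (hl : 1 ≤ l) {a b : ι → ℤ} {m : Module.Dual ℤ N}
    (hb : ∀ ρ, b ρ = (a ρ + m (Δ.ray ρ)) / l) :
    Nonempty (Retract (Δ.divisorSheaf k b)
      ((Scheme.Modules.pushforward (Δ.frobenius k l)).obj (Δ.divisorSheaf k a))) := by
  let j := Δ.chart k Δ.zeroCone
  let F := Δ.frobenius k l
  obtain ⟨tr, tr_res, tr_mul, tr_laurent⟩ := Δ.exists_trace k hl
  choose iv hiv using fun (V : (Δ.variety k).Opens) (s : Γ(Δ.divisorSheaf k b, V)) =>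
    Δ.exists_val_eq k (Δ.isRegular_frobPull k hl hb (Δ.isRegular_val k s))
  choose rv hrv using fun (V : (Δ.variety k).Opens) (s : Γ(Δ.divisorSheaf k a, F ⁻¹ᵁ V)) =>
    Δ.exists_val_eq k (Δ.isRegular_trace k hl tr tr_res tr_mul tr_laurent hb (Δ.isRegular_val k s))
  have hrv_res {V W : (Δ.variety k).Opens} (h : W ≤ V) (s : Γ(Δ.divisorSheaf k a, F ⁻¹ᵁ V)) :
      rv W (mres (Δ.divisorSheaf k a) (F.preimage_mono h) s) =
        mres (Δ.divisorSheaf k b) h (rv V s) := Δ.val_injective k b W (by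
    rw [hrv, val_mres, val_mres, hrv, ← tr_res _ _ h, map_mul (res _), res_laurent])
  have hrv_smul (V : (Δ.variety k).Opens) (r : Γ(Δ.variety k, V))
      (s : Γ(Δ.divisorSheaf k a, F ⁻¹ᵁ V)) :
      rv V ((F.app V r : Γ(Δ.variety k, F ⁻¹ᵁ V)) • s) = r • rv V s := Δ.val_injective k b V (by
    rw [hrv, val_smul, val_smul, hrv, app_frobenius_eq, mul_left_comm, tr_mul])
  obtain ⟨i, hi⟩ := exists_modules_hom (Δ.divisorSheaf k b)
    ((Scheme.Modules.pushforward (Δ.frobenius k l)).obj (Δ.divisorSheaf k a))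
    (fun V => AddMonoidHom.mk' (M := Γ(Δ.divisorSheaf k b, V)) (G := Γ(Δ.divisorSheaf k a, F ⁻¹ᵁ V))
      (iv V) fun s t => Δ.val_injective k _ _ (by
        rw [map_add, hiv, hiv, hiv, map_add, map_add, mul_add]))
    (fun {V W} h s => Δ.val_injective k a (F ⁻¹ᵁ W) (by
      refine (hiv W _).trans (Eq.trans ?_ (Δ.val_mres k (F.preimage_mono h) (iv V s)).symm)
      rw [hiv, map_mul, res_laurent, res_frobPull _ _ _ h, val_mres]))
    (fun V r s => Δ.val_injective k a (F ⁻¹ᵁ V) (by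
      refine (hiv V _).trans (Eq.trans ?_ (Δ.val_smul k (F.app V r) (iv V s)).symm)
      rw [hiv, val_smul, map_mul, app_frobenius_eq]
      ring))
  obtain ⟨r, hr⟩ := exists_modules_hom
    ((Scheme.Modules.pushforward (Δ.frobenius k l)).obj (Δ.divisorSheaf k a)) (Δ.divisorSheaf k b)
    (fun V => AddMonoidHom.mk' (G := Γ(Δ.divisorSheaf k b, V)) (M := Γ(Δ.divisorSheaf k a, F ⁻¹ᵁ V))
      (rv V) fun s t => Δ.val_injective k _ _ (by
        rw [map_add, hrv, hrv, hrv, map_add, mul_add, map_add]))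
    (fun h s => hrv_res h s) hrv_smul
  refine ⟨⟨i, r, modules_hom_ext fun V s => Δ.val_injective k b V ?_⟩⟩
  have h1 : (i ≫ r).app V s = rv V (iv V s) :=
    (congrArg (r.app V) (hi V s)).trans (hr V _)
  rw [h1, hrv, hiv, ← mul_assoc, ← laurent_single_add, neg_add_cancel, laurent_single_zero,
    mul_comm, tr_mul]
  have h2 := tr_laurent V 1
  rw [frobProj_one, map_one (Δ.laurent k _), map_one (Δ.laurent k _)] at h2
  rw [h2, mul_one]
  rfl

end SmoothFan

end Toric

/-! ### Linear equivalence of invariant divisors -/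

namespace Toric

namespace SmoothFan

variable {N : Type u} [AddCommGroup N] {ι : Type u} (Δ : SmoothFan N ι)
variable (k : Type u) [Field k]

theorem isRegular_of_locally {a : ι → ℤ} {V : (Δ.variety k).Opens}
    {f : Γ(Δ.torus k, Δ.chart k Δ.zeroCone ⁻¹ᵁ V)}
    (h : ∀ σ, Δ.IsRegular k a (V ⊓ Δ.affine k σ)
      (res ((Δ.chart k Δ.zeroCone).preimage_mono inf_le_left) f)) : Δ.IsRegular k a V f := by
  refine IsRegularSection.of_locally _ fun x hx => ?_
  obtain ⟨σ, hσ⟩ := Δ.exists_mem_affine k x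
  exact ⟨_, inf_le_left, ⟨hx, hσ⟩, h σ⟩

theorem isRegular_mul {a b : ι → ℤ} {V : (Δ.variety k).Opens}
    {f g : Γ(Δ.torus k, Δ.chart k Δ.zeroCone ⁻¹ᵁ V)} (hf : Δ.IsRegular k a V f)
    (hg : Δ.IsRegular k b V g) : Δ.IsRegular k (a + b) V (f * g) := by
  refine Δ.isRegular_of_locally k fun σ => ?_
  obtain ⟨ma, hma⟩ := Δ.exists_dual σ a
  obtain ⟨mb, hmb⟩ := Δ.exists_dual σ b
  obtain ⟨r, hr⟩ := (Δ.isRegular_iff k inf_le_right hma).1 (Δ.isRegular_res k inf_le_left hf)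
  obtain ⟨s, hs⟩ := (Δ.isRegular_iff k inf_le_right hmb).1 (Δ.isRegular_res k inf_le_left hg)
  refine (Δ.isRegular_iff k inf_le_right (m := ma + mb) fun ρ hρ => ?_).2 ⟨r * s, ?_⟩
  · rw [LinearMap.add_apply, hma ρ hρ, hmb ρ hρ, Pi.add_apply]
  · rw [map_mul, hr, hs, character_add, map_mul, map_mul]
    ring

theorem isRegular_character (m : Module.Dual ℤ N) (V : (Δ.variety k).Opens) :
    Δ.IsRegular k (fun ρ => -m (Δ.ray ρ)) V (res le_top (Δ.character k m)) := by
  refine Δ.isRegular_of_locally k fun σ =>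
    (Δ.isRegular_iff k inf_le_right (m := -m) fun ρ hρ => rfl).2 ⟨1, ?_⟩
  rw [res_res, ← map_mul, ← character_add, neg_add_cancel, map_one]
  exact (map_one (res le_top)).symm.trans (congrArg _ (map_one (Δ.chartFunction k _)).symm)

theorem character_zero : Δ.character k 0 = 1 := map_one (Δ.chartFunction k _)

/-- Multiplication by `χ^m` is the isomorphism, and multiplication by `χ^{-m}` its inverse. -/
theorem nonempty_iso_of_eq {a b : ι → ℤ} (m : Module.Dual ℤ N)
    (h : ∀ ρ, a ρ = b ρ + m (Δ.ray ρ)) : Nonempty (Δ.divisorSheaf k a ≅ Δ.divisorSheaf k b) := by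
  have hreg (V : (Δ.variety k).Opens) (s : Γ(Δ.divisorSheaf k a, V)) :
      Δ.IsRegular k b V (res le_top (Δ.character k m) * Δ.val k a V s) := by
    have h1 := Δ.isRegular_mul k (Δ.isRegular_character k m V) (Δ.isRegular_val k s)
    have h2 : (fun ρ => -m (Δ.ray ρ)) + a = b := funext fun ρ => by simp [h]
    rwa [h2] at h1
  have hreg' (V : (Δ.variety k).Opens) (s : Γ(Δ.divisorSheaf k b, V)) :
      Δ.IsRegular k a V (res le_top (Δ.character k (-m)) * Δ.val k b V s) := by
    have h1 := Δ.isRegular_mul k (Δ.isRegular_character k (-m) V) (Δ.isRegular_val k s)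
    have h2 : (fun ρ => -(-m) (Δ.ray ρ)) + b = a := funext fun ρ => by simp [h, add_comm]
    rwa [h2] at h1
  have hunit (W : (Δ.torus k).Opens) : res le_top (Δ.character k (-m)) *
      res le_top (Δ.character k m) = (1 : Γ(Δ.torus k, W)) := by
    rw [← map_mul, ← character_add, neg_add_cancel, character_zero, map_one]
  choose f hf using fun V s => Δ.exists_val_eq k (hreg V s)
  obtain ⟨φ, hφ⟩ := exists_modules_hom (Δ.divisorSheaf k a) (Δ.divisorSheaf k b)
    (fun V => AddMonoidHom.mk' (f V) fun s t => Δ.val_injective k _ _ (by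
      rw [map_add, hf, hf, hf, map_add, mul_add]))
    (fun h s => Δ.val_injective k _ _ (by
      refine (hf _ _).trans (Eq.trans ?_ (Δ.val_mres k h (f _ s)).symm)
      rw [hf, map_mul, val_mres, res_res]))
    (fun V r s => Δ.val_injective k _ _ (by
      refine (hf _ _).trans (Eq.trans ?_ (Δ.val_smul k r (f _ s)).symm)
      rw [hf, val_smul]
      ring))
  have := isIso_of_bijective φ fun V => by
    constructor
    · intro s t hst
      rw [hφ, hφ] at hst
      have h1 : Δ.val k b V (f V s) = Δ.val k b V (f V t) := congrArg _ hst
      rw [hf, hf] at h1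
      have h2 := congrArg (res le_top (Δ.character k (-m)) * ·) h1
      simp only [← mul_assoc, hunit, one_mul] at h2
      exact Δ.val_injective k _ _ h2
    · intro t
      obtain ⟨s, hs⟩ := Δ.exists_val_eq k (hreg' V t)
      refine ⟨s, (hφ V s).trans (Δ.val_injective k _ _ ((hf V s).trans ?_))⟩
      rw [hs, ← mul_assoc, mul_comm (res _ _), hunit, one_mul]
  exact ⟨asIso φ⟩

theorem frobenius_one : Δ.frobenius k 1 = 𝟙 (Δ.variety k) := by
  refine colimit.hom_ext fun σ => ?_
  refine (Δ.chart_comp_frobenius k 1 σ).trans ?_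
  have h : Δ.frobRing k 1 σ = RingHom.id _ := by
    refine (congrArg _ ?_).trans AddMonoidAlgebra.mapDomainRingHom_id
    ext m : 1
    exact one_nsmul m
  have h1 : Δ.chartFrobenius k 1 σ = 𝟙 ((Δ.charts k).obj σ) :=
    (congrArg (fun f => Spec.map (CommRingCat.ofHom f)) h).trans (Spec.map_id _)
  rw [h1]
  exact (Category.id_comp (Δ.chart k σ)).trans (Category.comp_id (Δ.chart k σ)).symm

/-- An isomorphism is a retract of the push-forward under `F_1 = id`, and division by `1` rounds
nothing. -/
theorem exists_of_iso {a b : ι → ℤ} (e : Δ.divisorSheaf k b ≅ Δ.divisorSheaf k a) :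
    ∃ m : Module.Dual ℤ N, ∀ ρ, b ρ = a ρ + m (Δ.ray ρ) := by
  have R : Retract (Δ.divisorSheaf k b)
      ((Scheme.Modules.pushforward (Δ.frobenius k 1)).obj (Δ.divisorSheaf k a)) := by
    rw [frobenius_one]
    exact Retract.ofIso (e ≪≫ (Scheme.Modules.pushforwardId _).symm.app _)
  obtain ⟨m, hm⟩ := Δ.exists_floor_of_retract k le_rfl R
  exact ⟨m, fun ρ => by rw [hm]; simp⟩

theorem cls_divisorBundle_eq_iff {a b : ι → ℤ} :
    (Δ.divisorBundle k a).cls = (Δ.divisorBundle k b).cls ↔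
      ∃ m : Module.Dual ℤ N, ∀ ρ, a ρ = b ρ + m (Δ.ray ρ) :=
  Quotient.eq.trans ⟨fun ⟨e⟩ => Δ.exists_of_iso k e, fun ⟨m, hm⟩ => Δ.nonempty_iso_of_eq k m hm⟩

end SmoothFan

end Toric

/-! ### Recognizing a tensor product of sheaves -/

namespace Toric

theorem tensor_addMonoidHom_ext {R A B C : Type*} [CommRing R] [AddCommGroup A] [AddCommGroup B]
    [AddCommGroup C] [Module R A] [Module R B] {f g : A ⊗[R] B →+ C}
    (h : ∀ a b, f (a ⊗ₜ[R] b) = g (a ⊗ₜ[R] b)) (x : A ⊗[R] B) : f x = g x := by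
  induction x with
  | zero => rw [map_zero, map_zero]
  | add x y hx hy => rw [map_add, map_add, hx, hy]
  | tmul s t => exact h s t

theorem isIso_homEquiv_symm {C D : Type*} [Category* C] [Category* D] {G : C ⥤ D}
    {H : D ⥤ C} (adj : G ⊣ H) {M : C} {N : D} (f : M ⟶ H.obj N) (h : IsIso (G.map f))
    [IsIso (adj.counit.app N)] : IsIso ((adj.homEquiv M N).symm f) := by
  rw [Adjunction.homEquiv_counit]
  infer_instance

theorem exists_presheaf_hom {X : Scheme.{u}} (L L' M : X.Modules)
    (μ : ∀ V, Γ(L, V) →ₗ[Γ(X, V)] Γ(L', V) →ₗ[Γ(X, V)] Γ(M, V))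
    (hμ : ∀ {V W : X.Opens} (h : W ≤ V) (s : Γ(L, V)) (t : Γ(L', V)),
      μ W (mres L h s) (mres L' h t) = mres M h (μ V s t)) :
    ∃ m : PresheafOfModules.Monoidal.tensorObj (R := X.presheaf) L.val L'.val ⟶
      (PresheafOfModules.restrictScalars (𝟙 X.ringCatSheaf.obj)).obj M.val,
      ∀ (V : X.Opens) (x : Γ(L, V) ⊗[Γ(X, V)] Γ(L', V)),
        ((PresheafOfModules.toPresheaf _).map m).app (.op V) x = TensorProduct.lift (μ V) x := by
  refine ⟨PresheafOfModules.homMk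
      { app := fun V => AddCommGrpCat.ofHom
          (X := Γ(L, V.unop) ⊗[Γ(X, V.unop)] Γ(L', V.unop)) (Y := Γ(M, V.unop))
          (TensorProduct.lift (μ V.unop)).toAddMonoidHom
        naturality := fun V W g => by
          ext (x : Γ(L, V.unop) ⊗[Γ(X, V.unop)] Γ(L', V.unop))
          exact tensor_addMonoidHom_ext (R := Γ(X, V.unop)) (A := Γ(L, V.unop))
            (B := Γ(L', V.unop)) (C := Γ(M, W.unop))
            (f := AddCommGrpCat.Hom.hom
              ((PresheafOfModules.Monoidal.tensorObj (R := X.presheaf) L.val L'.val).presheaf.map g ≫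
                AddCommGrpCat.ofHom (X := Γ(L, W.unop) ⊗[Γ(X, W.unop)] Γ(L', W.unop))
                  (Y := Γ(M, W.unop)) (TensorProduct.lift (μ W.unop)).toAddMonoidHom))
            (g := AddCommGrpCat.Hom.hom
              (AddCommGrpCat.ofHom (X := Γ(L, V.unop) ⊗[Γ(X, V.unop)] Γ(L', V.unop))
                  (Y := Γ(M, V.unop)) (TensorProduct.lift (μ V.unop)).toAddMonoidHom ≫
                M.presheaf.map g))
            (fun s t => hμ (leOfHom g.unop) s t) x }
      (fun V r (x : Γ(L, V.unop) ⊗[Γ(X, V.unop)] Γ(L', V.unop)) =>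
        (TensorProduct.lift (μ V.unop)).map_smul r x), fun _ _ => rfl⟩

/-- The tensor product of two cyclic modules is generated by `a ⊗ b`, and its generator goes to the
free generator `μ a b`. Freeness of `A` and `B` need not be assumed. -/
theorem tensor_lift_bijective {R A B C : Type*} [CommRing R] [AddCommGroup A] [AddCommGroup B]
    [AddCommGroup C] [Module R A] [Module R B] [Module R C] (μ : A →ₗ[R] B →ₗ[R] C) {a : A} {b : B}
    (ha : ∀ x : A, ∃ r : R, x = r • a) (hb : ∀ x : B, ∃ r : R, x = r • b)
    (hab : Function.Bijective fun r : R => r • μ a b) :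
    Function.Bijective (TensorProduct.lift μ) := by
  have h (x : A ⊗[R] B) : ∃ r : R, x = r • (a ⊗ₜ[R] b) := by
    induction x with
    | zero => exact ⟨0, by rw [zero_smul]⟩
    | add x y hx hy =>
      obtain ⟨r, rfl⟩ := hx
      obtain ⟨s, rfl⟩ := hy
      exact ⟨r + s, by rw [add_smul]⟩
    | tmul x y =>
      obtain ⟨r, rfl⟩ := ha x
      obtain ⟨s, rfl⟩ := hb y
      exact ⟨r * s, by rw [TensorProduct.smul_tmul_smul]⟩
  have h1 (r : R) : TensorProduct.lift μ (r • (a ⊗ₜ[R] b)) = r • μ a b := by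
    rw [map_smul, TensorProduct.lift.tmul]
  refine ⟨fun x y hxy => ?_, fun z => ?_⟩
  · obtain ⟨r, rfl⟩ := h x
    obtain ⟨s, rfl⟩ := h y
    rw [h1, h1] at hxy
    rw [hab.1 hxy]
  · obtain ⟨r, rfl⟩ := hab.2 z
    exact ⟨_, h1 r⟩

/-- Local injectivity and surjectivity can be checked after intersecting with members of the cover.
The conclusion says that sheafification inverts `φ`. -/
theorem isLocallyBijective_of_cover {X : TopCat.{u}} {P Q : TopCat.Presheaf AddCommGrpCat.{u} X}
    (φ : P ⟶ Q) {I : Type*} (U : I → Opens X) (hU : ∀ x, ∃ i, x ∈ U i)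
    (h : ∀ i, ∀ V ≤ U i, Function.Bijective (φ.app (.op V))) :
    (Opens.grothendieckTopology X).W φ := by
  have h1 : Presheaf.IsLocallyInjective (Opens.grothendieckTopology X) φ := by
    refine ⟨fun {V} x y hxy p hp => ?_⟩
    obtain ⟨i, hi⟩ := hU p
    refine ⟨V.unop ⊓ U i, homOfLE inf_le_left, ?_, ⟨hp, hi⟩⟩
    apply (h i _ inf_le_right).1
    have := ConcreteCategory.congr_hom (φ.naturality (homOfLE (inf_le_left : V.unop ⊓ U i ≤ _)).op)
    exact (this x).trans ((congrArg _ hxy).trans (this y).symm)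
  have h2 : Presheaf.IsLocallySurjective (Opens.grothendieckTopology X) φ := by
    refine ⟨fun {V} y p hp => ?_⟩
    obtain ⟨i, hi⟩ := hU p
    refine ⟨V ⊓ U i, homOfLE inf_le_left, ?_, ⟨hp, hi⟩⟩
    exact (h i _ inf_le_right).2 _
  exact (Opens.grothendieckTopology X).W_of_isLocallyBijective φ

/-- A bilinear pairing with values in the sheaf `M` induces a map from the sheafified tensor
product. If locally the pairing takes generators to a free generator, the presheaf map is bijective
on small open sets, so the induced map is an isomorphism. -/
theorem nonempty_iso_tensorModule {X : Scheme.{u}} (L L' M : X.Modules)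
    (μ : ∀ V, Γ(L, V) →ₗ[Γ(X, V)] Γ(L', V) →ₗ[Γ(X, V)] Γ(M, V))
    (hμ : ∀ {V W : X.Opens} (h : W ≤ V) (s : Γ(L, V)) (t : Γ(L', V)),
      μ W (mres L h s) (mres L' h t) = mres M h (μ V s t))
    {I : Type*} (U : I → X.Opens) (hU : ∀ x, ∃ i, x ∈ U i)
    (h : ∀ i, ∀ V ≤ U i, ∃ (s : Γ(L, V)) (t : Γ(L', V)), (∀ x : Γ(L, V), ∃ r : Γ(X, V), x = r • s) ∧
      (∀ x : Γ(L', V), ∃ r : Γ(X, V), x = r • t) ∧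
      Function.Bijective fun r : Γ(X, V) => r • μ V s t) :
    Nonempty (M ≅ tensorModule L L') := by
  obtain ⟨m, hm⟩ := exists_presheaf_hom L L' M μ hμ
  let φ : tensorModule L L' ⟶ M :=
    (PresheafOfModules.sheafificationHomEquiv (𝟙 X.ringCatSheaf.obj)).symm m
  have hW : (Opens.grothendieckTopology X).W ((PresheafOfModules.toPresheaf _).map m) := by
    refine isLocallyBijective_of_cover _ U hU fun i V hV => ?_
    obtain ⟨s, t, hs, ht, hst⟩ := h i V hV
    have h1 := tensor_lift_bijective (μ V) hs ht hst
    have h2 : (((PresheafOfModules.toPresheaf _).map m).app (.op V) :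
        Γ(L, V) ⊗[Γ(X, V)] Γ(L', V) → Γ(M, V)) = TensorProduct.lift (μ V) := funext (hm V)
    rw [← h2] at h1
    exact h1
  have : IsIso φ := by
    have h3 : IsIso ((SheafOfModules.toSheaf X.ringCatSheaf).map φ) := by
      have h4 := PresheafOfModules.toSheaf_map_sheafificationHomEquiv_symm
        (𝟙 X.ringCatSheaf.obj) m
      rw [GrothendieckTopology.W_iff] at hW
      exact (congrArg IsIso h4).mpr (isIso_homEquiv_symm _ _ hW)
    have h5 : IsIso (X := tensorModule L L') (C := SheafOfModules X.ringCatSheaf) φ :=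
      isIso_of_reflects_iso (C := SheafOfModules X.ringCatSheaf) _
        (SheafOfModules.toSheaf X.ringCatSheaf)
    exact ⟨h5.1⟩
  exact ⟨(asIso φ).symm⟩

end Toric

/-! ### Addition of divisors is the tensor product -/

namespace Toric

/-- Isomorphic sheaves have isomorphic tensor products. -/
theorem nonempty_tensorModule_congr {X : Scheme.{u}} {L₁ L₂ M₁ M₂ : X.Modules} (e : L₁ ≅ M₁)
    (e' : L₂ ≅ M₂) : Nonempty (tensorModule L₁ L₂ ≅ tensorModule M₁ M₂) := by
  let F := Scheme.Modules.toPresheafOfModules X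
  let f : L₁.val ≅ M₁.val := F.mapIso e
  let f' : L₂.val ≅ M₂.val := F.mapIso e'
  have key : Nonempty (PresheafOfModules.Monoidal.tensorObj (R := X.presheaf) L₁.val L₂.val ≅
      PresheafOfModules.Monoidal.tensorObj (R := X.presheaf) M₁.val M₂.val) :=
    ⟨MonoidalCategory.tensorIso (C := PresheafOfModules (X.presheaf ⋙ forget₂ CommRingCat RingCat))
      f f'⟩
  obtain ⟨g⟩ := key
  let i := (PresheafOfModules.sheafification (𝟙 X.ringCatSheaf.obj)).mapIso g
  exact ⟨⟨i.hom, i.inv, i.hom_inv_id, i.inv_hom_id⟩⟩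

namespace SmoothFan

variable {N : Type u} [AddCommGroup N] {ι : Type u} (Δ : SmoothFan N ι)
variable (k : Type u) [Field k]

theorem res_character_neg_mul (W : (Δ.torus k).Opens) (m : Module.Dual ℤ N) :
    res le_top (Δ.character k (-m)) * res le_top (Δ.character k m) = (1 : Γ(Δ.torus k, W)) := by
  rw [← map_mul, ← character_add, neg_add_cancel, character_zero, map_one]

/-- On `U_σ` the sheaf of `∑ a_ρ D_ρ` is generated by the inverse `χ^{-m}` of its local equation. -/
theorem exists_generator {a : ι → ℤ} {σ : Δ.Cone} {m : Module.Dual ℤ N}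
    (hm : ∀ ρ ∈ σ.1, m (Δ.ray ρ) = a ρ) {V : (Δ.variety k).Opens} (hV : V ≤ Δ.affine k σ) :
    ∃ s : Γ(Δ.divisorSheaf k a, V), Δ.val k a V s = res le_top (Δ.character k (-m)) := by
  refine Δ.exists_val_eq k ((Δ.isRegular_iff k hV hm).2 ⟨1, ?_⟩)
  rw [map_one, mul_comm]
  exact (Δ.res_character_neg_mul k _ m).symm

theorem generator_bijective {a : ι → ℤ} {σ : Δ.Cone} {m : Module.Dual ℤ N}
    (hm : ∀ ρ ∈ σ.1, m (Δ.ray ρ) = a ρ) {V : (Δ.variety k).Opens} (hV : V ≤ Δ.affine k σ)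
    {s : Γ(Δ.divisorSheaf k a, V)} (hs : Δ.val k a V s = res le_top (Δ.character k (-m))) :
    Function.Bijective fun r : Γ(Δ.variety k, V) => r • s := by
  constructor
  · intro r r' hr
    have h1 := congrArg (Δ.val k a V) hr
    simp only [val_smul, hs] at h1
    have h2 := congrArg (· * res le_top (Δ.character k m)) h1
    simp only [mul_assoc, res_character_neg_mul, mul_one] at h2
    exact Δ.torus_app_injective k V h2
  · intro t
    obtain ⟨g, hg⟩ := (Δ.isRegular_iff k hV hm).1 (Δ.isRegular_val k t)
    refine ⟨g, Δ.val_injective k _ _ ?_⟩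
    change Δ.val k a V (g • s) = _
    rw [val_smul, hg, hs, mul_comm, ← mul_assoc, res_character_neg_mul, one_mul]

/-- The pairing is multiplication of functions on the torus. On `U_σ` the generators `χ^{-ma}` and
`χ^{-mb}` have product `χ^{-(ma + mb)}`, the generator for `a + b`. -/
theorem nonempty_divisorSheaf_add_iso (a b : ι → ℤ) :
    Nonempty (Δ.divisorSheaf k (a + b) ≅
      tensorModule (Δ.divisorSheaf k a) (Δ.divisorSheaf k b)) := by
  choose p hp using fun V (s : Γ(Δ.divisorSheaf k a, V)) (t : Γ(Δ.divisorSheaf k b, V)) =>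
    Δ.exists_val_eq k (Δ.isRegular_mul k (Δ.isRegular_val k s) (Δ.isRegular_val k t))
  obtain ⟨μ, hμ⟩ : ∃ μ : ∀ V, Γ(Δ.divisorSheaf k a, V) →ₗ[Γ(Δ.variety k, V)]
      Γ(Δ.divisorSheaf k b, V) →ₗ[Γ(Δ.variety k, V)] Γ(Δ.divisorSheaf k (a + b), V),
      ∀ V s t, Δ.val k (a + b) V (μ V s t) = Δ.val k a V s * Δ.val k b V t := by
    refine ⟨fun V => LinearMap.mk₂ _ (p V)
      (fun s s' t => Δ.val_injective k _ _ ?_) (fun r s t => Δ.val_injective k _ _ ?_)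
      (fun s t t' => Δ.val_injective k _ _ ?_) (fun r s t => Δ.val_injective k _ _ ?_), hp⟩
    · rw [map_add, hp, hp, hp, map_add, add_mul]
    · rw [val_smul, hp, hp, val_smul, mul_assoc]
    · rw [map_add, hp, hp, hp, map_add, mul_add]
    · rw [val_smul, hp, hp, val_smul, mul_left_comm]
  refine nonempty_iso_tensorModule (Δ.divisorSheaf k a) (Δ.divisorSheaf k b)
    (Δ.divisorSheaf k (a + b)) μ (fun h s t => Δ.val_injective k _ _ ?_) (Δ.affine k)
    (Δ.exists_mem_affine k) (fun σ V hV => ?_)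
  · rw [val_mres, hμ, hμ, map_mul, val_mres, val_mres]
  · obtain ⟨ma, hma⟩ := Δ.exists_dual σ a
    obtain ⟨mb, hmb⟩ := Δ.exists_dual σ b
    obtain ⟨s, hs⟩ := Δ.exists_generator k hma hV
    obtain ⟨t, ht⟩ := Δ.exists_generator k hmb hV
    have hm : ∀ ρ ∈ σ.1, (ma + mb) (Δ.ray ρ) = (a + b) ρ := fun ρ hρ => by
      rw [LinearMap.add_apply, hma ρ hρ, hmb ρ hρ, Pi.add_apply]
    refine ⟨s, t, fun x => ?_, fun x => ?_, Δ.generator_bijective k hm hV ?_⟩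
    · obtain ⟨r, hr⟩ := (Δ.generator_bijective k hma hV hs).2 x
      exact ⟨r, hr.symm⟩
    · obtain ⟨r, hr⟩ := (Δ.generator_bijective k hmb hV ht).2 x
      exact ⟨r, hr.symm⟩
    · rw [hμ, hs, ht, ← map_mul, ← character_add, neg_add]

end SmoothFan

end Toric

/-! ### Invertible sheaves on factorial affine schemes are trivial -/

namespace Toric

/-- Elements `x i` of a unique factorization domain that differ by units after localization at
`f i * f i'` differ, locally, by units from a common element. -/
theorem exists_common_factor {R κ : Type*} [CommRing R] [IsDomain R]
    [UniqueFactorizationMonoid R] [Fintype κ] (f x : κ → R) (hx : ∀ i, x i ≠ 0) (hf : ∀ i, f i ≠ 0)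
    (h : ∀ i i', ∃ n, x i' ∣ (f i * f i') ^ n * x i) :
    ∃ (d : R) (y : κ → R) (n m : ℕ), ∀ i, f i ^ n * x i = d * y i ∧ y i ∣ f i ^ m := by
  classical
  let _ : StrongNormalizationMonoid R := UniqueFactorizationMonoid.strongNormalizationMonoid
  let _ := UniqueFactorizationMonoid.toStrongNormalizedGCDMonoid R
  choose n hn using h
  let A := ∑ i, ∑ i', n i i'
  have hA (i i') : x i' ∣ (f i * f i') ^ A * x i := by
    refine (hn i i').trans (mul_dvd_mul_right (pow_dvd_pow _ ?_) _)
    exact (Finset.single_le_sum (f := fun i' => n i i') (fun _ _ => Nat.zero_le _)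
      (Finset.mem_univ i')).trans (Finset.single_le_sum (f := fun i => ∑ i', n i i')
      (fun _ _ => Nat.zero_le _) (Finset.mem_univ i))
  rcases isEmpty_or_nonempty κ with hκ | ⟨⟨i₀⟩⟩
  · exact ⟨0, 0, 0, 0, fun i => hκ.elim i⟩
  obtain ⟨y, hy, hy1⟩ := Finset.extract_gcd (fun i => f i ^ A * x i)
    (⟨i₀, Finset.mem_univ i₀⟩ : (Finset.univ : Finset κ).Nonempty)
  set d := Finset.univ.gcd fun i => f i ^ A * x i with hd
  have hd0 : d ≠ 0 := fun h0 => by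
    have h1 := hy i₀ (Finset.mem_univ _)
    rw [h0, zero_mul] at h1
    exact mul_ne_zero (pow_ne_zero _ (hf i₀)) (hx i₀) h1
  have hdvd (i) : y i ∣ f i ^ (2 * A) := by
    -- By `hA`, `d * y i` divides `f i ^ (2 * A) * f i' ^ A * x i' = d * (f i ^ (2 * A) * y i')`. As
    -- the `y i'` have greatest common divisor `1`, `y i` must divide `f i ^ (2 * A)`.
    have h1 : ∀ i' ∈ Finset.univ, y i ∣ f i ^ (2 * A) * y i' := by
      intro i' _
      rw [← mul_dvd_mul_iff_left hd0, ← hy i (Finset.mem_univ _), mul_left_comm,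
        ← hy i' (Finset.mem_univ _)]
      refine (mul_dvd_mul_left _ (hA i' i)).trans (dvd_of_eq ?_)
      ring
    have h2 := Finset.dvd_gcd h1
    have h3 := Finset.gcd_mul_left (s := Finset.univ) (f := y) (a := f i ^ (2 * A))
    rw [hy1, mul_one] at h3
    rw [h3] at h2
    exact h2.trans (normalize_associated _).dvd
  exact ⟨d, y, A, 2 * A, fun i => ⟨hy i (Finset.mem_univ _), hdvd i⟩⟩

section Generator

variable {X : Scheme.{u}}

theorem res_ext {κ : Type u} {V : κ → X.Opens} {U : X.Opens} (h : ∀ i, V i ≤ U)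
    (hcov : U ≤ iSup V) {f g : Γ(X, U)} (hfg : ∀ i, res (h i) f = res (h i) g) : f = g :=
  X.sheaf.eq_of_locally_eq' V U (fun i => homOfLE (h i)) hcov f g hfg

theorem exists_res_eq {κ : Type u} {V : κ → X.Opens} {U : X.Opens} (h : ∀ i, V i ≤ U)
    (hcov : U ≤ iSup V) (f : ∀ i, Γ(X, V i))
    (hf : ∀ i i', res inf_le_left (f i) = (res inf_le_right (f i') : Γ(X, V i ⊓ V i'))) :
    ∃ g : Γ(X, U), ∀ i, res (h i) g = f i := by
  obtain ⟨g, hg, -⟩ := X.sheaf.existsUnique_gluing' V U (fun i => homOfLE (h i)) hcov f hf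
  exact ⟨g, hg⟩

theorem mres_ext (L : X.Modules) {κ : Type u} {V : κ → X.Opens} {U : X.Opens} (h : ∀ i, V i ≤ U)
    (hcov : U ≤ iSup V) {s t : Γ(L, U)} (hst : ∀ i, mres L (h i) s = mres L (h i) t) : s = t :=
  TopCat.Sheaf.eq_of_locally_eq' (⟨L.presheaf, L.isSheaf⟩ : TopCat.Sheaf Ab X) V U
    (fun i => homOfLE (h i)) hcov s t hst

theorem exists_mres_eq (L : X.Modules) {κ : Type u} {V : κ → X.Opens} {U : X.Opens}
    (h : ∀ i, V i ≤ U) (hcov : U ≤ iSup V) (s : ∀ i, Γ(L, V i))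
    (hs : ∀ i i', mres L inf_le_left (s i) = (mres L inf_le_right (s i') : Γ(L, V i ⊓ V i'))) :
    ∃ t : Γ(L, U), ∀ i, mres L (h i) t = s i := by
  obtain ⟨t, ht, -⟩ := TopCat.Sheaf.existsUnique_gluing'
    (⟨L.presheaf, L.isSheaf⟩ : TopCat.Sheaf Ab X) V U (fun i => homOfLE (h i)) hcov s hs
  exact ⟨t, ht⟩

variable {L : X.Modules} {U : X.Opens}

/-- The section `s` generates `L` freely over `U`. -/
def IsGenerator (L : X.Modules) (U : X.Opens) (s : Γ(L, U)) : Prop :=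
  ∀ (V : X.Opens) (h : V ≤ U), Function.Bijective fun r : Γ(X, V) => r • mres L h s

theorem IsGenerator.mres {s : Γ(L, U)} (hs : IsGenerator L U s) {W : X.Opens} (h : W ≤ U) :
    IsGenerator L W (mres L h s) := by
  intro V hV
  rw [mres_mres]
  exact hs V (hV.trans h)

theorem IsGenerator.exists_smul_eq {s : Γ(L, U)} (hs : IsGenerator L U s) (t : Γ(L, U)) :
    ∃ r : Γ(X, U), r • s = t := by
  have h := (hs U le_rfl).2 t
  rwa [mres_self] at h

theorem IsGenerator.smul_injective {s : Γ(L, U)} (hs : IsGenerator L U s) {r r' : Γ(X, U)}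
    (h : r • s = r' • s) : r = r' := by
  have h' := (hs U le_rfl).1
  rw [mres_self] at h'
  exact h' h

theorem IsGenerator.smul {s : Γ(L, U)} (hs : IsGenerator L U s) {u : Γ(X, U)} (hu : IsUnit u) :
    IsGenerator L U (u • s) := by
  intro V hV
  obtain ⟨v, hv⟩ := (hu.map (res hV)).exists_right_inv
  simp only [mres_smul, smul_smul]
  constructor
  · intro r r' h
    have h1 := (hs V hV).1 h
    have h2 := congrArg (· * v) h1
    simpa only [mul_assoc, hv, mul_one] using h2
  · intro t
    obtain ⟨r, hr⟩ := (hs V hV).2 t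
    refine ⟨r * v, ?_⟩
    dsimp only at hr ⊢
    rw [mul_assoc, mul_comm v, hv, mul_one, hr]

/-- A generator differs from another one by a unit. -/
theorem IsGenerator.exists_unit {s t : Γ(L, U)} (hs : IsGenerator L U s)
    (ht : IsGenerator L U t) : ∃ u : Γ(X, U), IsUnit u ∧ u • s = t := by
  obtain ⟨u, hu⟩ := hs.exists_smul_eq t
  obtain ⟨v, hv⟩ := ht.exists_smul_eq s
  refine ⟨u, IsUnit.of_mul_eq_one v (hs.smul_injective ?_), hu⟩
  rw [one_smul, mul_comm, mul_smul, hu, hv]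

theorem isGenerator_of_cover {κ : Type u} {V : κ → X.Opens} (h : ∀ i, V i ≤ U)
    (hcov : U ≤ iSup V) {s : Γ(L, U)} (hs : ∀ i, IsGenerator L (V i) (mres L (h i) s)) :
    IsGenerator L U s := by
  intro W hW
  have hcov' : W ≤ iSup fun i => V i ⊓ W := fun x hx => by
    obtain ⟨i, hi⟩ := Opens.mem_iSup.1 (hcov (hW hx))
    exact Opens.mem_iSup.2 ⟨i, hi, hx⟩
  have hb (i) (W' : X.Opens) (h' : W' ≤ V i ⊓ W) := hs i W' (h'.trans inf_le_left)
  simp only [mres_mres] at hb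
  constructor
  · intro r r' hr
    refine res_ext (V := fun i => V i ⊓ W) (fun i => inf_le_right) hcov' fun i => ?_
    apply (hb i _ le_rfl).1
    have h1 := congrArg (Toric.mres L (inf_le_right : V i ⊓ W ≤ W)) hr
    simpa only [mres_smul, mres_mres] using h1
  · intro t
    choose r hr using fun i => (hb i _ le_rfl).2 (Toric.mres L (inf_le_right : V i ⊓ W ≤ W) t)
    dsimp only at hr
    obtain ⟨g, hg⟩ := exists_res_eq (V := fun i => V i ⊓ W) (fun i => inf_le_right) hcov' r
      fun i i' => by
        have hi := congrArg (Toric.mres L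
          (inf_le_left : (V i ⊓ W) ⊓ (V i' ⊓ W) ≤ _)) (hr i)
        have hi' := congrArg (Toric.mres L
          (inf_le_right : (V i ⊓ W) ⊓ (V i' ⊓ W) ≤ _)) (hr i')
        simp only [mres_smul, mres_mres] at hi hi'
        exact (hb i _ inf_le_left).1 (hi.trans hi'.symm)
    refine ⟨g, mres_ext L (V := fun i => V i ⊓ W) (fun i => inf_le_right) hcov' fun i => ?_⟩
    rw [mres_smul, hg, mres_mres, hr]

/-- An invertible sheaf has generators locally. -/
theorem IsInvertible.exists_isGenerator (hL : IsInvertible L) (x : X) :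
    ∃ V : X.Opens, x ∈ V ∧ ∃ s : Γ(L, V), IsGenerator L V s := by
  obtain ⟨V, hx, ⟨e⟩⟩ := hL x
  have hV : V.ι ''ᵁ ⊤ = V := by simp
  let M := L.restrict V.ι
  obtain ⟨φ, hφ, hsmul, hnat⟩ : ∃ φ : ∀ W : (V : Scheme.{u}).Opens, Γ((V : Scheme.{u}), W) →
      Γ(M, W), (∀ W, Function.Bijective (φ W)) ∧ (∀ W r r', φ W (r * r') = r • φ W r') ∧
      ∀ W, φ W 1 = Toric.mres M le_top (φ ⊤ 1) := by
    refine ⟨fun W => e.inv.app W, fun W => ?_, fun W r r' => ?_, fun W => ?_⟩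
    · exact (ConcreteCategory.isIso_iff_bijective _).1
        (Scheme.Modules.Hom.isIso_iff_isIso_app.1 (inferInstance : IsIso e.inv) W)
    · exact Scheme.Modules.Hom.app_smul e.inv r (show Γ(structureModule (V : Scheme.{u}), W) from r')
    · refine Eq.trans ?_ (hom_mres e.inv le_top
        (show Γ(structureModule (V : Scheme.{u}), ⊤) from (1 : Γ((V : Scheme.{u}), ⊤))))
      congr 1
      exact (map_one (res (le_top : W ≤ ⊤))).symm
  refine ⟨V.ι ''ᵁ ⊤, hV.symm ▸ hx, φ ⊤ 1, fun W hW => ?_⟩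
  obtain ⟨W', rfl⟩ : ∃ W', W = V.ι ''ᵁ W' := ⟨V.ι ⁻¹ᵁ W, by
    rw [Scheme.Hom.image_preimage_eq_opensRange_inf]
    simpa using hW.trans hV.le⟩
  have h1 : (fun r : Γ(X, V.ι ''ᵁ W') => r • Toric.mres L hW (φ ⊤ 1)) =
      fun r : Γ(X, V.ι ''ᵁ W') => φ W' r := by
    funext r
    have h2 : φ W' r = (show Γ((V : Scheme.{u}), W') from r) •
        Toric.mres M le_top (φ ⊤ 1) := by
      rw [← hnat, ← hsmul]
      congr 1
      exact (mul_one (show Γ((V : Scheme.{u}), W') from r)).symm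
    refine Eq.trans ?_ h2.symm
    trans ((V.ι.appIso W').inv r) • Toric.mres L hW (φ ⊤ 1)
    · rw [Scheme.Opens.ι_appIso]
      rfl
    · rfl
  rw [h1]
  exact hφ W'

/-- Sections of an invertible sheaf on an integral scheme are determined by their restriction to
a nonempty open subset. -/
theorem IsInvertible.mres_injective [IsIntegral X] (hL : IsInvertible L) {V : X.Opens} (h : V ≤ U)
    (hV : (V : Set X).Nonempty) : Function.Injective (Toric.mres L h) := by
  rw [injective_iff_map_eq_zero]
  intro s hs
  choose W hxW w hw using fun x : X => hL.exists_isGenerator x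
  refine mres_ext L (V := fun x : U => W x ⊓ U) (fun x => inf_le_right)
    (fun x hx => Opens.mem_iSup.2 ⟨⟨x, hx⟩, hxW x, hx⟩) fun x => ?_
  have hgen := (hw x).mres (inf_le_left : W x ⊓ U ≤ W x)
  obtain ⟨r, hr⟩ := hgen.exists_smul_eq (Toric.mres L inf_le_right s)
  obtain ⟨z, hz, hzV⟩ := nonempty_preirreducible_inter (W x ⊓ U).2 V.2 ⟨x.1, hxW x, x.2⟩ hV
  have : Nonempty (W x ⊓ U ⊓ V : X.Opens) := ⟨⟨z, hz, hzV⟩⟩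
  have h1 : res (inf_le_left : W x ⊓ U ⊓ V ≤ W x ⊓ U) r = 0 := by
    have h2 := hgen.mres (inf_le_left : W x ⊓ U ⊓ V ≤ W x ⊓ U)
    refine h2.smul_injective ?_
    rw [← mres_smul, hr, mres_mres, zero_smul,
      ← mres_mres L h (inf_le_right : W x ⊓ U ⊓ V ≤ V), hs, map_zero]
  have h3 : r = 0 := map_injective_of_isIntegral X
    (homOfLE (inf_le_left : W x ⊓ U ⊓ V ≤ W x ⊓ U)) (h1.trans (map_zero (res inf_le_left)).symm)
  rw [← hr, h3, zero_smul, map_zero]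

theorem exists_res_eq_pow_mul (hU : IsAffineOpen U) (f : Γ(X, U)) {W : X.Opens}
    (hW : W = X.basicOpen f) (h : W ≤ U) (u : Γ(X, W)) :
    ∃ (n : ℕ) (x : Γ(X, U)), res h x = res h f ^ n * u := by
  subst hW
  have := hU.isLocalization_basicOpen f
  obtain ⟨⟨x, ⟨_, n, rfl⟩⟩, hx⟩ := IsLocalization.surj (M := Submonoid.powers f) u
  refine ⟨n, x, ?_⟩
  refine hx.symm.trans ?_
  rw [mul_comm, ← map_pow]
  rfl

/-- An invertible sheaf has a generator over an affine open set whose coordinate ring is a unique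
factorization domain. -/
theorem IsInvertible.exists_isGenerator_of_isAffineOpen [IsIntegral X] (hL : IsInvertible L)
    (hU : IsAffineOpen U) [Nonempty U] [UniqueFactorizationMonoid Γ(X, U)] :
    ∃ e : Γ(L, U), IsGenerator L U e := by
  classical
  let S : Set Γ(X, U) := {f | f ≠ 0 ∧ ∃ s : Γ(L, X.basicOpen f), IsGenerator L (X.basicOpen f) s}
  have hS : Ideal.span S = ⊤ := by
    rw [← hU.iSup_basicOpen_eq_self_iff]
    refine le_antisymm (iSup_le fun f => X.basicOpen_le _) fun x hx => ?_
    obtain ⟨V, hxV, s, hs⟩ := hL.exists_isGenerator x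
    obtain ⟨f, hf, hxf⟩ := hU.exists_basicOpen_le ⟨x, hxV⟩ hx
    refine Opens.mem_iSup.2 ⟨⟨f, ?_, _, hs.mres hf⟩, hxf⟩
    rintro rfl
    simp [Scheme.basicOpen_zero] at hxf
  obtain ⟨T, hTS, hT⟩ := (Ideal.span_eq_top_iff_finite S).1 hS
  let D : T → X.Opens := fun i => X.basicOpen i.1
  have hD (i : T) : D i ≤ U := X.basicOpen_le _
  have hcov : U ≤ iSup D := ((hU.iSup_basicOpen_eq_self_iff (s := (T : Set Γ(X, U)))).2 hT).ge
  have hDn (i : T) : (D i : Set X).Nonempty := by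
    rw [Set.nonempty_iff_ne_empty]
    intro h
    have h1 : X.basicOpen i.1 = ⊥ := Opens.ext h
    exact (hTS i.2).1 ((basicOpen_eq_bot_iff i.1).1 h1)
  have hunit {W : X.Opens} (i : T) (h : W ≤ D i) : IsUnit (res (h.trans (hD i)) i.1) := by
    have h1 : IsUnit (res (hD i) i.1) := X.toRingedSpace.isUnit_res_basicOpen i.1
    have h2 := h1.map (res h)
    rwa [res_res] at h2
  obtain ⟨x₀, hx₀⟩ : (U : Set X).Nonempty := Set.nonempty_coe_sort.1 ‹_›
  obtain ⟨o, -⟩ := Opens.mem_iSup.1 (hcov hx₀)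
  have hinj {W : X.Opens} (h : W ≤ U) (hW : (W : Set X).Nonempty) : Function.Injective (res h) := by
    obtain ⟨w, hw⟩ := hW
    have : Nonempty W := ⟨⟨w, hw⟩⟩
    exact map_injective_of_isIntegral X (homOfLE h)
  have hD2 (i j : T) : D i ⊓ D j = X.basicOpen (i.1 * j.1) := (X.basicOpen_mul _ _).symm
  have hne (i j : T) : ((D i ⊓ D j : X.Opens) : Set X).Nonempty :=
    nonempty_preirreducible_inter (D i).2 (D j).2 (hDn i) (hDn j)
  have hne3 (i j l : T) : ((D i ⊓ D j ⊓ D l : X.Opens) : Set X).Nonempty :=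
    nonempty_preirreducible_inter (D i ⊓ D j).2 (D l).2 (hne i j) (hDn l)
  choose s hs using fun i : T => (hTS i.2).2
  -- All generators are compared with the one over a fixed `D o`. Rescaling `s i` by a power of the
  -- unit `i` clears the denominators at `i`, leaving `x i • s o = o ^ N • t i` with `x i` defined
  -- over all of `U` and a common exponent `N`.
  obtain ⟨N, t, x, ht, hx⟩ : ∃ (N : ℕ) (t : ∀ i, Γ(L, D i)) (x : T → Γ(X, U)),
      (∀ i, IsGenerator L (D i) (t i)) ∧ ∀ i,
      res (inf_le_left.trans (hD i) : D i ⊓ D o ≤ U) (x i) •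
          Toric.mres L (inf_le_right : D i ⊓ D o ≤ D o) (s o) =
        res (inf_le_left.trans (hD i) : D i ⊓ D o ≤ U) o.1 ^ N •
          Toric.mres L (inf_le_left : D i ⊓ D o ≤ D i) (t i) := by
    have h1 (i : T) : ∃ (n : ℕ) (x : Γ(X, U)),
        res (inf_le_left.trans (hD i) : D i ⊓ D o ≤ U) x •
          Toric.mres L (inf_le_right : D i ⊓ D o ≤ D o) (s o) =
        res (inf_le_left.trans (hD i) : D i ⊓ D o ≤ U) (i.1 * o.1) ^ n •
          Toric.mres L (inf_le_left : D i ⊓ D o ≤ D i) (s i) := by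
      obtain ⟨u, hu⟩ := ((hs o).mres (inf_le_right : D i ⊓ D o ≤ D o)).exists_smul_eq
        (Toric.mres L (inf_le_left : D i ⊓ D o ≤ D i) (s i))
      obtain ⟨n, x, hx⟩ := exists_res_eq_pow_mul hU _ (hD2 i o) (inf_le_left.trans (hD i)) u
      exact ⟨n, x, by rw [hx, mul_smul, hu]⟩
    choose n x hx using h1
    refine ⟨∑ i, n i, fun i => res (hD i) i.1 ^ (∑ i, n i) • s i,
      fun i => (i.1 * o.1) ^ (∑ i, n i - n i) * x i, fun i => (hs i).smul ?_, fun i => ?_⟩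
    · exact (hunit i le_rfl).pow _
    · have hle : n i ≤ ∑ i, n i := Finset.single_le_sum (f := n) (fun _ _ => Nat.zero_le _)
        (Finset.mem_univ i)
      rw [map_mul, mul_smul, hx, mres_smul, smul_smul, smul_smul, map_pow, map_pow, ← pow_add,
        Nat.sub_add_cancel hle, map_mul, res_res, mul_pow, mul_comm]
  have htn {W : X.Opens} (hW : (W : Set X).Nonempty) {i : T} (h : W ≤ D i) :
      Toric.mres L h (t i) ≠ 0 := by
    intro h0
    obtain ⟨w, hw⟩ := hW
    have : Nonempty W := ⟨⟨w, hw⟩⟩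
    refine one_ne_zero (α := Γ(X, W)) (((ht i).mres h).smul_injective ?_)
    rw [h0, smul_zero, smul_zero]
  have hx' {W : X.Opens} (i : T) (h : W ≤ D i) (h' : W ≤ D o) :
      res (h.trans (hD i)) (x i) • Toric.mres L h' (s o) =
        res (h.trans (hD i)) o.1 ^ N • Toric.mres L h (t i) := by
    have h1 := congrArg (Toric.mres L (le_inf h h')) (hx i)
    simpa only [mres_smul, map_pow, mres_mres, res_res] using h1
  have hx0 (i : T) : x i ≠ 0 := by
    intro h0
    have h1 := hx i
    rw [h0, map_zero, zero_smul] at h1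
    have h2 : IsUnit (res (inf_le_left.trans (hD i) : D i ⊓ D o ≤ U) o.1 ^ N) :=
      (hunit o inf_le_right).pow _
    exact htn (hne i o) inf_le_left ((h2.smul_eq_zero).1 h1.symm)
  -- On `D i ⊓ D j` the section `t i` is a multiple of `t j`. Comparing both with `s o` turns this
  -- into a divisibility in the coordinate ring of `U`.
  have hdiv (i j : T) : ∃ n, x j ∣ (i.1 * j.1) ^ n * x i := by
    obtain ⟨u, hu⟩ := ((ht j).mres (inf_le_right : D i ⊓ D j ≤ D j)).exists_smul_eq
      (Toric.mres L (inf_le_left : D i ⊓ D j ≤ D i) (t i))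
    obtain ⟨n, c, hc⟩ := exists_res_eq_pow_mul hU _ (hD2 i j) (inf_le_left.trans (hD i)) u
    refine ⟨n, c, ?_⟩
    let W := D i ⊓ D j ⊓ D o
    have hWi : W ≤ D i := inf_le_left.trans inf_le_left
    have hWj : W ≤ D j := inf_le_left.trans inf_le_right
    have hWo : W ≤ D o := inf_le_right
    have hWU : W ≤ U := hWi.trans (hD i)
    apply hinj hWU (hne3 i j o)
    refine ((hs o).mres hWo).smul_injective ?_
    have h1 := congrArg (Toric.mres L (inf_le_left : W ≤ D i ⊓ D j)) hu
    rw [mres_smul, mres_mres, mres_mres] at h1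
    have h2 := congrArg (res (inf_le_left : W ≤ D i ⊓ D j)) hc
    rw [map_mul, map_pow, res_res, res_res] at h2
    rw [map_mul, mul_smul, hx' i hWi hWo, mul_comm (x j) c, map_mul, mul_smul, hx' j hWj hWo, ← h1, map_pow,
      h2]
    simp only [smul_smul]
    congr 1
    ring
  obtain ⟨d, y, n, m, hy⟩ := exists_common_factor (fun i : T => i.1) x hx0
    (fun i => (hTS i.2).1) hdiv
  have hyu (i : T) : ∃ v : Γ(X, D i), v * res (hD i) (y i) = 1 := by
    have h1 := isUnit_of_dvd_unit (map_dvd (res (hD i)) (hy i).2) (by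
      rw [map_pow]
      exact (hunit i le_rfl).pow m)
    exact h1.exists_left_inv
  choose v hv using hyu
  -- From `i ^ n * x i = d * y i` with `y i` a unit on `D i`, the rescaled generator `e i = (y i)⁻¹
  -- i ^ n • t i` satisfies `o ^ N • e i = d • s o`. The right side does not depend on `i`, so the
  -- `e i` glue.
  let e : ∀ i, Γ(L, D i) := fun i => (v i * res (hD i) i.1 ^ n) • t i
  have he (i : T) : IsGenerator L (D i) (e i) :=
    (ht i).smul ((IsUnit.of_mul_eq_one _ (hv i)).mul ((hunit i le_rfl).pow n))
  have heq {W : X.Opens} (i : T) (h : W ≤ D i) (h' : W ≤ D o) :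
      res (h.trans (hD i)) o.1 ^ N • Toric.mres L h (e i) =
        res (h.trans (hD i)) d • Toric.mres L h' (s o) := by
    have h1 := congrArg (res h) (hv i)
    rw [map_mul, map_one, res_res] at h1
    have h2 := congrArg (res (h.trans (hD i))) (hy i).1
    rw [map_mul, map_mul, map_pow] at h2
    rw [mres_smul, smul_smul, mul_comm, mul_smul, ← hx' i h h', smul_smul, map_mul, map_pow,
      res_res, mul_assoc, h2, mul_left_comm, h1, mul_one]
  obtain ⟨E, hE⟩ := exists_mres_eq L hD hcov e fun i j => by
    refine hL.mres_injective (inf_le_left : D i ⊓ D j ⊓ D o ≤ _) (hne3 i j o) ?_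
    rw [mres_mres, mres_mres]
    have hu : IsUnit (res ((inf_le_right : D i ⊓ D j ⊓ D o ≤ D o).trans (hD o)) o.1 ^ N) :=
      (hunit o inf_le_right).pow _
    exact hu.smul_left_cancel.1 ((heq i (inf_le_left.trans inf_le_left) inf_le_right).trans
      (heq j (inf_le_left.trans inf_le_right) inf_le_right).symm)
  refine ⟨E, isGenerator_of_cover hD hcov fun i => ?_⟩
  rw [hE]
  exact he i

end Generator

end Toric

/-! ### Units and factoriality of the coordinate rings -/

namespace Toric

/-- The units of a monoid algebra are monomials. -/
theorem exists_single_eq_of_mul_eq_one {R A : Type*} [CommRing R] [IsDomain R] [AddMonoid A]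
    [TwoUniqueSums A] {P Q : AddMonoidAlgebra R A} (h : P * Q = 1) :
    ∃ (m m' : A) (c c' : R), m + m' = 0 ∧ c * c' = 1 ∧ P = AddMonoidAlgebra.single m c ∧
      Q = AddMonoidAlgebra.single m' c' := by
  classical
  have hne : (1 : AddMonoidAlgebra R A) ≠ 0 := one_ne_zero
  have hP : P.coeff.support.Nonempty := by
    rw [Finset.nonempty_iff_ne_empty, Ne, Finsupp.support_eq_empty]
    intro h0
    have : P = 0 := by ext x; simp [h0]
    exact hne (by rw [← h, this, zero_mul])
  have hQ : Q.coeff.support.Nonempty := by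
    rw [Finset.nonempty_iff_ne_empty, Ne, Finsupp.support_eq_empty]
    intro h0
    have : Q = 0 := by ext x; simp [h0]
    exact hne (by rw [← h, this, mul_zero])
  -- If one support had more than one element, two different pairs of exponents would have unique
  -- sums. Both products survive in `P * Q = 1`, so both sums are `0`, contradicting uniqueness.
  have hcard : ¬ 1 < P.coeff.support.card * Q.coeff.support.card := by
    intro hlt
    obtain ⟨p, hp, q, hq, hpq, hup, huq⟩ := TwoUniqueSums.uniqueAdd_of_one_lt_card hlt
    have key : ∀ x ∈ P.coeff.support ×ˢ Q.coeff.support,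
        UniqueAdd P.coeff.support Q.coeff.support x.1 x.2 → x.1 + x.2 = 0 := by
      intro x hx hu
      have h1 := AddMonoidAlgebra.coeff_mul_add_of_uniqueAdd hu
      rw [h, AddMonoidAlgebra.one_def, AddMonoidAlgebra.coeff_single, Finsupp.single_apply] at h1
      by_contra h0
      rw [if_neg (Ne.symm h0)] at h1
      obtain ⟨h2, h3⟩ := Finset.mem_product.1 hx
      exact mul_ne_zero (Finsupp.mem_support_iff.1 h2) (Finsupp.mem_support_iff.1 h3) h1.symm
    obtain ⟨h2, h3⟩ := Finset.mem_product.1 hp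
    have h4 := huq h2 h3 ((key p hp hup).trans (key q hq huq).symm)
    exact hpq (Prod.ext h4.1 h4.2)
  have hP1 : P.coeff.support.card = 1 := by
    have h1 := hP.card_pos
    have h2 := hQ.card_pos
    nlinarith
  have hQ1 : Q.coeff.support.card = 1 := by
    have h1 := hP.card_pos
    have h2 := hQ.card_pos
    nlinarith
  obtain ⟨m, c, hc, hPm⟩ := Finsupp.card_support_eq_one'.1 hP1
  obtain ⟨m', c', hc', hQm⟩ := Finsupp.card_support_eq_one'.1 hQ1
  have hPs : P = AddMonoidAlgebra.single m c := by
    ext x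
    rw [hPm, AddMonoidAlgebra.coeff_single]
  have hQs : Q = AddMonoidAlgebra.single m' c' := by
    ext x
    rw [hQm, AddMonoidAlgebra.coeff_single]
  have h1 := congrArg AddMonoidAlgebra.coeff h
  rw [hPs, hQs, AddMonoidAlgebra.single_mul_single, AddMonoidAlgebra.one_def,
    AddMonoidAlgebra.coeff_single, AddMonoidAlgebra.coeff_single,
    Finsupp.single_eq_single_iff] at h1
  rcases h1 with ⟨h2, h3⟩ | ⟨-, h3⟩
  · exact ⟨m, m', c, c', h2, h3, hPs, hQs⟩
  · exact absurd h3 one_ne_zero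

/-- A morphism of sheaves of modules that is bijective over the small open sets is an
isomorphism. -/
theorem isIso_of_locally_bijective {X : Scheme.{u}} {L L' : X.Modules} (φ : L ⟶ L') {κ : Type u}
    (U : κ → X.Opens) (hU : ∀ x, ∃ i, x ∈ U i)
    (h : ∀ i, ∀ V ≤ U i, Function.Bijective (φ.app V)) : IsIso φ := by
  refine isIso_of_bijective φ fun V => ?_
  have hcov : V ≤ iSup fun i => U i ⊓ V := fun x hx => by
    obtain ⟨i, hi⟩ := hU x
    exact Opens.mem_iSup.2 ⟨i, hi, hx⟩
  have hinj : Function.Injective (φ.app V) := by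
    intro s t hst
    refine mres_ext L (fun i => inf_le_right) hcov fun i => ?_
    apply (h i _ inf_le_left).1
    rw [hom_mres, hom_mres, hst]
  refine ⟨hinj, fun t => ?_⟩
  choose s hs using fun i => (h i _ inf_le_left).2 (mres L' (inf_le_right : U i ⊓ V ≤ V) t)
  obtain ⟨s', hs'⟩ := exists_mres_eq L (fun i => inf_le_right) hcov s fun i i' => by
    apply (h i _ (inf_le_left.trans inf_le_left)).1
    rw [hom_mres, hom_mres, hs, hs, mres_mres, mres_mres]
  refine ⟨s', mres_ext L' (fun i => inf_le_right) hcov fun i => ?_⟩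
  rw [← hom_mres, hs', hs]

namespace SmoothFan

variable {N : Type u} [AddCommGroup N] {ι : Type u} (Δ : SmoothFan N ι)
variable (k : Type u) [Field k]

theorem twoUniqueSums_dualMonoid (σ : Δ.Cone) : TwoUniqueSums (Δ.dualMonoid σ) := by
  obtain ⟨b, -⟩ := Δ.smooth _ Δ.empty_mem
  let f : Δ.dualMonoid σ →+ (Fin (Module.finrank ℤ N) → ℤ) :=
    { toFun := fun m i => m.1 (b i)
      map_zero' := rfl
      map_add' := fun _ _ => rfl }
  exact TwoUniqueSums.of_injective_addHom f.toAddHom (fun m m' h => Subtype.ext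
    (b.ext fun i => congrFun h i)) inferInstance

/-- An invertible function on `U_σ` is, up to a constant, a character orthogonal to `σ`. -/
theorem exists_character_of_isUnit {σ : Δ.Cone} {g : Γ(Δ.variety k, Δ.affine k σ)}
    (hg : IsUnit g) : ∃ (m : Module.Dual ℤ N) (c : k), c ≠ 0 ∧ (∀ ρ ∈ σ.1, m (Δ.ray ρ) = 0) ∧
      (Δ.chart k Δ.zeroCone).app _ g = Δ.laurent k _ (AddMonoidAlgebra.single (Δ.mono m) c) := by
  have := Δ.twoUniqueSums_dualMonoid σ
  obtain ⟨g', hg'⟩ := hg.exists_right_inv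
  obtain ⟨P, hP⟩ := Δ.exists_laurent_eq_app k σ g
  obtain ⟨P', hP'⟩ := Δ.exists_laurent_eq_app k σ g'
  have h1 : P * P' = 1 := by
    apply Δ.chartRingMap_injective k (Δ.zeroCone_le σ)
    apply (Δ.laurent_bijective k (Δ.top_le_preimage_affine k σ)).1
    rw [map_mul, map_mul, ← hP, ← hP', ← map_mul, hg', map_one, map_one, map_one]
  obtain ⟨m, m', c, c', hm, hc, rfl, rfl⟩ := exists_single_eq_of_mul_eq_one h1
  refine ⟨m.1, c, left_ne_zero_of_mul_eq_one hc, fun ρ hρ => ?_, ?_⟩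
  · have h2 := m.2 ρ hρ
    have h3 := m'.2 ρ hρ
    have h4 : m.1 (Δ.ray ρ) + m'.1 (Δ.ray ρ) = 0 := LinearMap.congr_fun (congrArg Subtype.val hm) _
    omega
  · rw [hP, chartRingMap_single]
    rfl

/-- In a basis of `N` extending the rays of `σ`, the dual coordinates present the ring as a
polynomial ring with those variables inverted that do not correspond to rays of `σ`. A localization
of a factorial ring is factorial. -/
instance uniqueFactorizationMonoid_chartRing (σ : Δ.Cone) :
    UniqueFactorizationMonoid (Δ.chartRing k σ) := by
  classical
  obtain ⟨b, e, he⟩ := Δ.smooth σ.1 σ.2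
  have hb (i j) : b.coord i (b j) = if i = j then 1 else 0 := by
    rw [Module.Basis.coord_apply, Module.Basis.repr_self, Finsupp.single_apply]
    simp only [eq_comm]
  have hmem (m : Module.Dual ℤ N) : m ∈ Δ.dualMonoid σ ↔ ∀ ρ, 0 ≤ m (b (e ρ)) :=
    ⟨fun h ρ => by rw [he]; exact h _ ρ.2, fun h ρ hρ => by
      have := h ⟨ρ, hρ⟩
      rwa [he] at this⟩
  let φ : (Fin (Module.finrank ℤ N) →₀ ℕ) →+ Δ.dualMonoid σ :=
    { toFun := fun x => ⟨∑ i, x i • b.coord i, (hmem _).2 fun ρ => by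
        simp only [LinearMap.sum_apply, LinearMap.smul_apply, hb]
        exact Finset.sum_nonneg fun i _ => by split_ifs <;> simp⟩
      map_zero' := by ext; simp
      map_add' := fun x y => by
        ext
        simp [add_smul, Finset.sum_add_distrib] }
  have hφ (x) (i) : (φ x).1 (b i) = x i := by
    change (∑ j, x j • b.coord j) (b i) = _
    simp [LinearMap.sum_apply, LinearMap.smul_apply, hb]
  have hφinj : Function.Injective φ := fun x y h => by
    ext i
    have h1 := congrArg (fun m : Δ.dualMonoid σ => m.1 (b i)) h
    simpa [hφ] using h1
  -- The exponent of the product of the variables to be inverted.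
  let z : Fin (Module.finrank ℤ N) →₀ ℕ :=
    Finsupp.equivFunOnFinite.symm fun i => if i ∈ Set.range e then 0 else 1
  have hz (i) : z i = if i ∈ Set.range e then 0 else 1 := rfl
  let _ : Algebra (AddMonoidAlgebra k (Fin (Module.finrank ℤ N) →₀ ℕ)) (Δ.chartRing k σ) :=
    (AddMonoidAlgebra.mapDomainRingHom k φ).toAlgebra
  have halg (x r) : algebraMap (AddMonoidAlgebra k (Fin (Module.finrank ℤ N) →₀ ℕ))
      (Δ.chartRing k σ) (AddMonoidAlgebra.single x r) = AddMonoidAlgebra.single (φ x) r :=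
    AddMonoidAlgebra.mapDomain_single
  let x₀ : AddMonoidAlgebra k (Fin (Module.finrank ℤ N) →₀ ℕ) := AddMonoidAlgebra.single z 1
  have hpow (n : ℕ) : algebraMap (AddMonoidAlgebra k (Fin (Module.finrank ℤ N) →₀ ℕ))
      (Δ.chartRing k σ) x₀ ^ n = AddMonoidAlgebra.single (n • φ z) 1 := by
    rw [halg, AddMonoidAlgebra.single_pow, one_pow]
  have : IsLocalization.Away x₀ (Δ.chartRing k σ) := by
    refine IsLocalization.Away.mk _ ?_ ?_ ?_
    · rw [halg]
      refine Δ.isUnit_monomial k σ _ fun ρ hρ => ?_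
      rw [← he ⟨ρ, hρ⟩, hφ, hz, if_pos ⟨_, rfl⟩]
      rfl
    · intro y
      induction y using AddMonoidAlgebra.induction_linear with
      | zero => exact ⟨0, 0, by simp⟩
      | add f g hf hg =>
        obtain ⟨n, a, ha⟩ := hf
        obtain ⟨n', a', ha'⟩ := hg
        refine ⟨n + n', a * x₀ ^ n' + a' * x₀ ^ n, ?_⟩
        rw [map_add, map_mul, map_mul, map_pow, map_pow, ← ha, ← ha']
        ring
      | single s r =>
        -- Adding `n` to the coordinates outside `σ` makes them nonnegative; those of the rays of
        -- `σ` are nonnegative already.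
        let n := ∑ i, (s.1 (b i)).natAbs
        have hn (i) : (s.1 (b i)).natAbs ≤ n := Finset.single_le_sum
          (f := fun i => (s.1 (b i)).natAbs) (fun _ _ => Nat.zero_le _) (Finset.mem_univ i)
        refine ⟨n, AddMonoidAlgebra.single (Finsupp.equivFunOnFinite.symm fun i =>
          (s.1 (b i) + n * z i).toNat) r, ?_⟩
        rw [hpow, halg, AddMonoidAlgebra.single_mul_single, mul_one]
        congr 1
        refine Subtype.ext (b.ext fun i => ?_)
        rw [hφ]
        change s.1 (b i) + (n • (φ z).1) (b i) = _
        rw [LinearMap.smul_apply, hφ, hz, nsmul_eq_mul]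
        simp only [Finsupp.equivFunOnFinite_symm_apply_apply]
        rw [Int.toNat_of_nonneg, hz]
        rw [hz]
        split_ifs with hi
        · obtain ⟨ρ, rfl⟩ := hi
          have := (hmem _).1 s.2 ρ
          simpa using this
        · have := hn i
          simp only [Nat.cast_one, mul_one]
          omega
    · intro a a' h
      refine ⟨0, ?_⟩
      rw [AddMonoidAlgebra.mapDomain_injective hφinj h]
  have : UniqueFactorizationMonoid (AddMonoidAlgebra k (Fin (Module.finrank ℤ N) →₀ ℕ)) :=
    inferInstanceAs (UniqueFactorizationMonoid (MvPolynomial (Fin (Module.finrank ℤ N)) k))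
  exact UniqueFactorizationMonoid.of_isLocalization (Submonoid.powers x₀) _

theorem uniqueFactorizationMonoid_affine (σ : Δ.Cone) :
    UniqueFactorizationMonoid Γ(Δ.variety k, Δ.affine k σ) := by
  rw [affine, ← Scheme.Hom.image_top_eq_opensRange]
  exact (RingEquiv.ofBijective _ (Δ.affineFunction_bijective k σ)).toMulEquiv.uniqueFactorizationMonoid
    inferInstance

end SmoothFan

end Toric

/-! ### Every line bundle comes from an invariant divisor -/

namespace Toric

namespace SmoothFan

variable {N : Type u} [AddCommGroup N] {ι : Type u} (Δ : SmoothFan N ι)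
variable (k : Type u) [Field k]

theorem chart_preimage_inf_affine (V : (Δ.variety k).Opens) (σ : Δ.Cone) :
    Δ.chart k Δ.zeroCone ⁻¹ᵁ V ≤ Δ.chart k Δ.zeroCone ⁻¹ᵁ (V ⊓ Δ.affine k σ) := fun _ hx =>
  ⟨hx, Δ.top_le_preimage_affine k σ trivial⟩

/-- A trivialization over the torus embeds an invertible sheaf into the sheaf of functions on the
torus. -/
theorem exists_torus_embedding {L : (Δ.variety k).Modules} {e : Γ(L, Δ.affine k Δ.zeroCone)}
    (he : IsGenerator L (Δ.affine k Δ.zeroCone) e) :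
    ∃ α : ∀ V : (Δ.variety k).Opens, Γ(L, V) →+ Γ(Δ.torus k, Δ.chart k Δ.zeroCone ⁻¹ᵁ V),
      (∀ (V) (r : Γ(Δ.variety k, V)) (s : Γ(L, V)),
        α V (r • s) = (Δ.chart k Δ.zeroCone).app V r * α V s) ∧
      (∀ (V W : (Δ.variety k).Opens) (h : W ≤ V) (s : Γ(L, V)),
        α W (mres L h s) = res ((Δ.chart k Δ.zeroCone).preimage_mono h) (α V s)) ∧
      α _ e = 1 := by
  have hgen (V : (Δ.variety k).Opens) := he.mres (inf_le_right : V ⊓ Δ.affine k Δ.zeroCone ≤ _)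
  choose f hf using fun (V : (Δ.variety k).Opens) (s : Γ(L, V)) =>
    (hgen V).exists_smul_eq (mres L (inf_le_left : V ⊓ Δ.affine k Δ.zeroCone ≤ V) s)
  have hadd (V) (s t : Γ(L, V)) : f V (s + t) = f V s + f V t := by
    refine (hgen V).smul_injective ?_
    rw [hf, add_smul, hf, hf, map_add]
  have hsmul (V) (r : Γ(Δ.variety k, V)) (s : Γ(L, V)) :
      f V (r • s) = res inf_le_left r * f V s := by
    refine (hgen V).smul_injective ?_
    rw [hf, mul_smul, hf, mres_smul]
  have hres (V W : (Δ.variety k).Opens) (h : W ≤ V) (s : Γ(L, V)) :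
      f W (mres L h s) = res (inf_le_inf_right _ h) (f V s) := by
    refine (hgen W).smul_injective ?_
    have h1 := congrArg (mres L (inf_le_inf_right (Δ.affine k Δ.zeroCone) h)) (hf V s)
    rw [mres_smul, mres_mres, mres_mres] at h1
    rw [hf, h1, mres_mres]
  have hone : f _ e = 1 := by
    refine (hgen _).smul_injective ?_
    rw [hf, one_smul]
  refine ⟨fun V => AddMonoidHom.mk' (fun s => res (Δ.chart_preimage_inf_affine k V Δ.zeroCone)
    ((Δ.chart k Δ.zeroCone).app _ (f V s))) fun s t => ?_, fun V r s => ?_, fun V W h s => ?_, ?_⟩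
  · rw [hadd, map_add, map_add]
  · simp only [AddMonoidHom.mk'_apply]
    rw [hsmul, map_mul, map_mul, app_res, res_res, res_self]
  · simp only [AddMonoidHom.mk'_apply]
    rw [hres, app_res, res_res, res_res]
  · simp only [AddMonoidHom.mk'_apply]
    rw [hone, map_one, map_one]

/-- Every invertible sheaf on a smooth toric variety comes from a torus-invariant divisor. -/
theorem exists_nonempty_iso_divisorSheaf {L : (Δ.variety k).Modules} (hL : IsInvertible L) :
    ∃ a : ι → ℤ, Nonempty (L ≅ Δ.divisorSheaf k a) := by
  have hne (σ : Δ.Cone) : Nonempty (Δ.affine k σ) :=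
    ⟨⟨_, Classical.arbitrary ((Δ.charts k).obj σ), rfl⟩⟩
  have hgen (σ : Δ.Cone) : ∃ e : Γ(L, Δ.affine k σ), IsGenerator L _ e :=
    have := Δ.uniqueFactorizationMonoid_affine k σ
    have := hne σ
    hL.exists_isGenerator_of_isAffineOpen (Δ.isAffineOpen_affine k σ)
  choose e he using hgen
  obtain ⟨α, hsmul, hres, hone⟩ := Δ.exists_torus_embedding k (he Δ.zeroCone)
  -- On the torus, `e σ` is a unit times the generator sent to `1`, and a unit is a constant times a
  -- character. The sign makes `m σ` a local equation.
  have hchar (σ : Δ.Cone) : ∃ (m : Module.Dual ℤ N) (c : k), c ≠ 0 ∧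
      α _ (e σ) = Δ.laurent k _ (AddMonoidAlgebra.single (Δ.mono (-m)) c) := by
    have hle := Δ.affine_mono k (Δ.zeroCone_le σ)
    obtain ⟨u, hu, hue⟩ := (he Δ.zeroCone).exists_unit ((he σ).mres hle)
    obtain ⟨m, c, hc, -, hm⟩ := Δ.exists_character_of_isUnit k hu
    refine ⟨-m, c, hc, ?_⟩
    have h1 := hres _ _ hle (e σ)
    rw [← hue, hsmul, hone, mul_one, hm] at h1
    have h2 := congrArg (res ((Δ.top_le_preimage_affine k Δ.zeroCone).trans' le_top :
      Δ.chart k Δ.zeroCone ⁻¹ᵁ Δ.affine k σ ≤ _)) h1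
    rw [res_laurent, res_res, res_self] at h2
    rw [neg_neg, h2]
  choose m c hc hm using hchar
  let ray : ι → Δ.Cone := fun ρ => ⟨{ρ}, Δ.singleton_mem ρ⟩
  let a : ι → ℤ := fun ρ => m (ray ρ) (Δ.ray ρ)
  -- Over `U_ρ` the generators of `σ` and of the ray differ by a unit of `U_ρ`, whose character
  -- vanishes on `u_ρ`. So the local equations agree on every ray and define one divisor.
  have ha (σ : Δ.Cone) (ρ) (hρ : ρ ∈ σ.1) : m σ (Δ.ray ρ) = a ρ := by
    have hle : ray ρ ≤ σ := Finset.singleton_subset_iff.2 hρ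
    obtain ⟨u, hu, hue⟩ := (he (ray ρ)).exists_unit ((he σ).mres (Δ.affine_mono k hle))
    obtain ⟨n, d, hd, hn, hdn⟩ := Δ.exists_character_of_isUnit k hu
    have h1 := hres _ _ (Δ.affine_mono k hle) (e σ)
    rw [← hue, hsmul, hdn, hm, hm, res_laurent, ← map_mul] at h1
    have h2 := (Δ.laurent_bijective k (Δ.top_le_preimage_affine k (ray ρ))).1 h1
    rw [AddMonoidAlgebra.single_mul_single] at h2
    have h3 := congrArg AddMonoidAlgebra.coeff h2
    rw [AddMonoidAlgebra.coeff_single, AddMonoidAlgebra.coeff_single,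
      Finsupp.single_eq_single_iff] at h3
    rcases h3 with ⟨h4, -⟩ | ⟨h4, -⟩
    · have h5 := LinearMap.congr_fun (congrArg Subtype.val h4) (Δ.ray ρ)
      have h6 := hn ρ (Finset.mem_singleton_self ρ)
      change n (Δ.ray ρ) + -(m (ray ρ) (Δ.ray ρ)) = -(m σ (Δ.ray ρ)) at h5
      change m σ (Δ.ray ρ) = m (ray ρ) (Δ.ray ρ)
      omega
    · exact absurd h4 (mul_ne_zero hd (hc _))
  have hnorm (σ : Δ.Cone) : ∃ t : Γ(L, Δ.affine k σ), IsGenerator L _ t ∧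
      α _ t = res le_top (Δ.character k (-(m σ))) := by
    obtain ⟨v, hv⟩ := Δ.exists_app_eq_laurent k σ (AddMonoidAlgebra.single 0 (c σ)⁻¹)
    obtain ⟨w, hw⟩ := Δ.exists_app_eq_laurent k σ (AddMonoidAlgebra.single 0 (c σ))
    have hvw : v * w = 1 := by
      apply Δ.torus_app_injective k
      rw [map_mul, hv, hw, ← map_mul, ← map_mul, AddMonoidAlgebra.single_mul_single,
        inv_mul_cancel₀ (hc σ), add_zero, ← AddMonoidAlgebra.one_def, map_one, map_one, map_one]
    refine ⟨v • e σ, (he σ).smul (IsUnit.of_mul_eq_one _ hvw), ?_⟩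
    rw [hsmul, hv, hm, ← map_mul, chartRingMap_single, AddMonoidAlgebra.single_mul_single,
      inv_mul_cancel₀ (hc σ), map_zero, zero_add, res_character]
  choose t ht hαt using hnorm
  have hcov (x : Δ.variety k) : ∃ σ, x ∈ Δ.affine k σ := Δ.exists_mem_affine k x
  have hreg (V : (Δ.variety k).Opens) (s : Γ(L, V)) : Δ.IsRegular k a V (α V s) := by
    refine Δ.isRegular_of_locally k fun σ => ?_
    rw [← hres V _ inf_le_left s, Δ.isRegular_iff k inf_le_right (ha σ)]
    obtain ⟨r, hr⟩ := ((ht σ).mres (inf_le_right : V ⊓ Δ.affine k σ ≤ _)).exists_smul_eq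
      (mres L inf_le_left s)
    refine ⟨r, ?_⟩
    rw [← hr, hsmul, hres, hαt, res_res, mul_left_comm, mul_comm (res _ (Δ.character k (m σ))),
      res_character_neg_mul, mul_one]
  choose g hg using fun V s => Δ.exists_val_eq k (hreg V s)
  obtain ⟨φ, hφ⟩ := exists_modules_hom L (Δ.divisorSheaf k a)
    (fun V => AddMonoidHom.mk' (g V) fun s s' => Δ.val_injective k _ _ (by
      rw [hg, map_add, map_add, hg, hg]))
    (fun h s => Δ.val_injective k _ _ (by
      change Δ.val k a _ (g _ _) = Δ.val k a _ (mres _ _ (g _ _))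
      rw [hg, val_mres, hg, hres]))
    (fun V r s => Δ.val_injective k _ _ (by
      change Δ.val k a _ (g _ _) = Δ.val k a _ (r • (g _ _))
      rw [hg, val_smul, hg, hsmul]))
  have hφ' (V) (s) : Δ.val k a V (φ.app V s) = α V s := by
    rw [hφ]
    exact hg V s
  have : IsIso φ := by
    refine isIso_of_locally_bijective φ (Δ.affine k) hcov fun σ V hV => ?_
    have h1 := ht σ V hV
    have h2 := Δ.generator_bijective k (ha σ) hV (s := φ.app V (mres L hV (t σ))) (by
      rw [hφ', hres, hαt, res_res])
    have h3 : (fun r : Γ(Δ.variety k, V) => r • φ.app V (mres L hV (t σ))) =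
        φ.app V ∘ fun r : Γ(Δ.variety k, V) => r • mres L hV (t σ) := by
      funext r
      exact (Scheme.Modules.Hom.app_smul φ r _).symm
    rw [h3] at h2
    exact (Function.Bijective.of_comp_iff _ h1).1 h2
  exact ⟨a, ⟨asIso φ⟩⟩

theorem exists_cls_divisorBundle_eq (P : Pic (Δ.variety k)) :
    ∃ a : ι → ℤ, (Δ.divisorBundle k a).cls = P := by
  obtain ⟨L, rfl⟩ := Quotient.exists_rep P
  obtain ⟨a, ⟨e⟩⟩ := Δ.exists_nonempty_iso_divisorSheaf k L.2
  exact ⟨a, Quotient.sound ⟨e.symm⟩⟩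

end SmoothFan

end Toric

/-! ### The real Picard group -/

namespace Toric

theorem Pic.toReal_eq_add {X : Scheme.{u}} {L L' L'' : LineBundle X}
    (h : Nonempty (L''.1 ≅ tensorModule L.1 L'.1)) :
    L''.cls.toReal = L.cls.toReal + L'.cls.toReal := by
  refine (Submodule.Quotient.eq _).2 (Submodule.subset_span ⟨L, L', L'', h, rfl⟩)

/-- A divisor with integral coefficients as a divisor with real coefficients. -/
def realDivisor {ι : Type u} (a : ι → ℤ) : ι → ℝ := fun ρ => (a ρ : ℝ)

theorem realDivisor_add {ι : Type u} (a b : ι → ℤ) :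
    realDivisor (a + b) = realDivisor a + realDivisor b := by
  ext ρ
  simp [realDivisor]

namespace SmoothFan

variable {N : Type u} [AddCommGroup N] {ι : Type u} (Δ : SmoothFan N ι)

/-- The values of a character on the rays, as a divisor with real coefficients. -/
def rayValues (m : Module.Dual ℤ N) : ι → ℝ := fun ρ => (m (Δ.ray ρ) : ℝ)

/-- The real span of the divisors of the characters. -/
def principal : Submodule ℝ (ι → ℝ) := Submodule.span ℝ (Set.range Δ.rayValues)

variable (k : Type u) [Field k]

/-- The class of a torus-invariant divisor in `Pic(X)_ℝ`. -/
def classHom : (ι → ℤ) →+ PicReal (Δ.variety k) :=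
  AddMonoidHom.mk' (fun a => (Δ.divisorBundle k a).cls.toReal) fun a b =>
    Pic.toReal_eq_add (Δ.nonempty_divisorSheaf_add_iso k a b)

/-- A presentation of the real Picard group by real divisors modulo real combinations of principal
ones. All convex geometry can then be done in `ℝ^{Σ(1)}`. -/
theorem exists_realClass [Finite ι] : ∃ π : (ι → ℝ) →ₗ[ℝ] PicReal (Δ.variety k),
    (∀ a : ι → ℤ, π (realDivisor a) = (Δ.divisorBundle k a).cls.toReal) ∧
    LinearMap.ker π = Δ.principal := by
  classical
  have := Fintype.ofFinite ι
  let π : (ι → ℝ) →ₗ[ℝ] PicReal (Δ.variety k) :=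
    ∑ ρ, (LinearMap.proj ρ).smulRight (Δ.classHom k (Pi.single ρ 1))
  have hπ (x : ι → ℝ) : π x = ∑ ρ, x ρ • Δ.classHom k (Pi.single ρ 1) := by
    simp [π, LinearMap.sum_apply]
  have hint (a : ι → ℤ) : π (realDivisor a) = Δ.classHom k a := by
    have h1 : a = ∑ ρ, a ρ • (Pi.single ρ 1 : ι → ℤ) := by
      ext ρ
      simp [Finset.sum_apply, Pi.single_apply]
    conv_rhs => rw [h1, map_sum]
    rw [hπ]
    refine Finset.sum_congr rfl fun ρ _ => ?_
    rw [map_zsmul, realDivisor, Int.cast_smul_eq_zsmul]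
  refine ⟨π, hint, le_antisymm ?_ ?_⟩
  -- Choosing a divisor for each class gives a map `Ψ` from `Pic(X)_ℝ` to the quotient by the
  -- principal divisors, well defined since tensor products become sums. As `Ψ ∘ π` is the quotient
  -- map, the kernel of `π` is no larger.
  · choose d hd using Δ.exists_cls_divisorBundle_eq k
    have hsub {a b : ι → ℤ} (h : (Δ.divisorBundle k a).cls = (Δ.divisorBundle k b).cls) :
        Δ.principal.mkQ (realDivisor a) = Δ.principal.mkQ (realDivisor b) := by
      obtain ⟨m, hm⟩ := (Δ.cls_divisorBundle_eq_iff k).1 h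
      refine (Submodule.Quotient.eq _).2 (Submodule.subset_span ⟨m, ?_⟩)
      ext ρ
      simp [rayValues, realDivisor, hm]
    let Ψ₀ : (Pic (Δ.variety k) →₀ ℝ) →ₗ[ℝ] (ι → ℝ) ⧸ Δ.principal :=
      Finsupp.linearCombination ℝ fun P => Δ.principal.mkQ (realDivisor (d P))
    have hΨ₀ (P) : Ψ₀ (Finsupp.single P 1) = Δ.principal.mkQ (realDivisor (d P)) := by
      simp [Ψ₀]
    have hrel : Submodule.span ℝ (picRelations (Δ.variety k)) ≤ LinearMap.ker Ψ₀ := by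
      rw [Submodule.span_le]
      rintro _ ⟨L, L', L'', ⟨e⟩, rfl⟩
      obtain ⟨i⟩ : Nonempty (Δ.divisorSheaf k (d L.cls) ≅ L.1) := Quotient.exact (hd L.cls)
      obtain ⟨i'⟩ : Nonempty (Δ.divisorSheaf k (d L'.cls) ≅ L'.1) := Quotient.exact (hd L'.cls)
      obtain ⟨j⟩ := Δ.nonempty_divisorSheaf_add_iso k (d L.cls) (d L'.cls)
      obtain ⟨j'⟩ := nonempty_tensorModule_congr i i'
      have h1 : (Δ.divisorBundle k (d L''.cls)).cls =
          (Δ.divisorBundle k (d L.cls + d L'.cls)).cls :=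
        (hd L''.cls).trans (Quotient.sound ⟨e.trans (j.trans j').symm⟩)
      change Ψ₀ _ = 0
      rw [map_sub, map_add, hΨ₀, hΨ₀, hΨ₀, hsub h1, realDivisor_add, map_add, sub_self]
    let Ψ := (Submodule.span ℝ (picRelations (Δ.variety k))).liftQ Ψ₀ hrel
    have hΨ (a : ι → ℤ) : Ψ (Δ.classHom k a) = Δ.principal.mkQ (realDivisor a) := by
      change Ψ₀ _ = _
      rw [hΨ₀]
      exact hsub (hd _)
    intro x hx
    rw [← Δ.principal.ker_mkQ, LinearMap.mem_ker]
    have h2 : Ψ (π x) = Δ.principal.mkQ x := by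
      have h3 : x = ∑ ρ, x ρ • realDivisor (Pi.single ρ 1 : ι → ℤ) := by
        ext ρ
        simp [Finset.sum_apply, realDivisor, Pi.single_apply]
      conv_rhs => rw [h3, map_sum]
      rw [hπ, map_sum]
      refine Finset.sum_congr rfl fun ρ _ => ?_
      rw [map_smul, map_smul, hΨ]
    rw [← h2, LinearMap.mem_ker.1 hx, map_zero]
  · rw [principal, Submodule.span_le]
    rintro _ ⟨m, rfl⟩
    change π _ = 0
    have h1 : Δ.classHom k (fun ρ => m (Δ.ray ρ)) = Δ.classHom k 0 :=
      congrArg Pic.toReal ((Δ.cls_divisorBundle_eq_iff k).2 ⟨m, fun ρ => (zero_add _).symm⟩)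
    rw [map_zero] at h1
    exact (hint _).trans h1

/-- The line bundles that split off from the push-forward of a line bundle under a toric Frobenius
morphism. -/
theorem mem_frobAt_iff {l : ℕ} (hl : 1 ≤ l) {L : LineBundle (Δ.variety k)} {a : ι → ℤ}
    (ha : (Δ.divisorBundle k a).cls = L.cls) {P : Pic (Δ.variety k)} :
    P ∈ Δ.frobAt k l L ↔ ∃ (b : ι → ℤ) (m : Module.Dual ℤ N),
      (Δ.divisorBundle k b).cls = P ∧ ∀ ρ, b ρ = (a ρ + m (Δ.ray ρ)) / l := by
  obtain ⟨i⟩ : Nonempty (Δ.divisorSheaf k a ≅ L.1) := Quotient.exact ha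
  let F := Scheme.Modules.pushforward (Δ.frobenius k l)
  constructor
  · rintro ⟨E, rfl, ⟨R⟩⟩
    obtain ⟨b, hb⟩ := Δ.exists_cls_divisorBundle_eq k E.cls
    obtain ⟨j⟩ : Nonempty (Δ.divisorSheaf k b ≅ E.1) := Quotient.exact hb
    obtain ⟨m, hm⟩ := Δ.exists_floor_of_retract k hl
      (((Retract.ofIso j).trans R).trans (Retract.ofIso (F.mapIso i.symm)))
    exact ⟨b, m, hb, hm⟩
  · rintro ⟨b, m, rfl, hm⟩
    obtain ⟨R⟩ := Δ.nonempty_retract k hl hm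
    exact ⟨_, rfl, ⟨R.trans (Retract.ofIso (F.mapIso i))⟩⟩

end SmoothFan

end Toric

/-! ### Convexity, approximation and integral parts -/

namespace Toric

/-- The points `y` of `Z` whose segment to `x` can be prolonged beyond `x` inside `Z` form a face
with `x` in its relative interior. Any face with `x` in its relative interior consists of such
points, so the union over faces reduces to one condition on `p`. -/
theorem mem_openStar_iff {V : Type*} [AddCommGroup V] [Module ℝ V] {Z : Set V} (hZ : Convex ℝ Z)
    {p x : V} (hp : p ∈ Z) :
    x ∈ openStar Z p ↔ x ∈ Z ∧ ∃ ε : ℝ, 0 < ε ∧ x + ε • (x - p) ∈ Z := by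
  constructor
  · rintro ⟨F, ⟨-, hF⟩, hpF, hx, h⟩
    obtain ⟨ε, hε, h'⟩ := h p hpF
    exact ⟨hF.subset hx, ε, hε, hF.subset h'⟩
  · rintro ⟨hx, hxp⟩
    refine ⟨{y | y ∈ Z ∧ ∃ ε : ℝ, 0 < ε ∧ x + ε • (x - y) ∈ Z}, ⟨?_, ?_, ?_⟩, ⟨hp, hxp⟩,
      ⟨hx, 1, one_pos, by simpa using hx⟩, ?_⟩
    · rintro y ⟨hy, ε, hε, h⟩ z ⟨hz, δ, hδ, h'⟩ s t hs ht hst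
      have shrink {w : V} {ε η : ℝ} (hη : 0 < η) (hle : η ≤ ε) (hw : x + ε • (x - w) ∈ Z) :
          x + η • (x - w) ∈ Z := by
        have hε' : 0 < ε := hη.trans_le hle
        have h1 := hZ hx hw (sub_nonneg.2 ((div_le_one hε').2 hle)) (div_pos hη hε').le
          (sub_add_cancel _ _)
        have h2 : η / ε * ε = η := div_mul_cancel₀ _ hε'.ne'
        convert h1 using 1
        rw [smul_add, smul_smul, h2, sub_smul, one_smul]
        abel
      have hmin : 0 < min ε δ := lt_min hε hδ
      refine ⟨hZ hy hz hs ht hst, min ε δ, hmin, ?_⟩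
      have h1 := hZ (shrink hmin (min_le_left _ _) h) (shrink hmin (min_le_right _ _) h') hs ht hst
      convert h1 using 1
      obtain rfl : t = 1 - s := by linarith
      module
    · exact fun y hy => hy.1
    · rintro y hy z hz w ⟨hw, ε, hε, h⟩ ⟨s, t, hs, ht, hst, rfl⟩
      have h0 : 0 < 1 + ε * t := by positivity
      -- The point prolonging the segment from `y` is the convex combination of `x + ε(x - w)` and
      -- `z`, with weights `1/(1 + εt)` and `εt/(1 + εt)`, in which `z` cancels.
      refine ⟨hy, ε * s / (1 + ε * t), by positivity, ?_⟩
      have h1 := hZ h hz (a := 1 / (1 + ε * t)) (b := ε * t / (1 + ε * t)) (by positivity)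
        (by positivity) (by field_simp)
      convert h1 using 1
      obtain rfl : s = 1 - t := by linarith
      match_scalars <;> field_simp
      all_goals ring
    · rintro y ⟨hy, ε, hε, h⟩
      refine ⟨ε, hε, h, ε⁻¹, inv_pos.2 hε, ?_⟩
      convert hy using 1
      match_scalars <;> field_simp
      all_goals ring

/-- Simultaneous Diophantine approximation. -/
theorem exists_nat_mul_near_int {κ : Type*} [Finite κ] (c : κ → ℝ) {η : ℝ} (hη : 0 < η) :
    ∃ (q : ℕ) (p : κ → ℤ), 1 ≤ q ∧ ∀ j, |(p j : ℝ) - q * c j| < η := by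
  have := Fintype.ofFinite κ
  -- Two terms of a convergent subsequence of the fractional parts are close, and `q` is the
  -- difference of their indices.
  let x : ℕ → κ → ℝ := fun n j => Int.fract (n * c j)
  obtain ⟨y, -, φ, hφ, hy⟩ := (isCompact_Icc (a := (0 : κ → ℝ)) (b := 1)).tendsto_subseq (x := x)
    fun n => ⟨fun j => Int.fract_nonneg _, fun j => (Int.fract_lt_one _).le⟩
  obtain ⟨n, hn⟩ := Metric.cauchySeq_iff'.1 hy.cauchySeq η hη
  have h1 := hn (n + 1) (Nat.le_succ n)
  have hlt : φ n < φ (n + 1) := hφ (Nat.lt_succ_self n)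
  refine ⟨φ (n + 1) - φ n, fun j => ⌊φ (n + 1) * c j⌋ - ⌊φ n * c j⌋, by omega, fun j => ?_⟩
  have h2 := (dist_le_pi_dist (x (φ (n + 1))) (x (φ n)) j).trans_lt h1
  rw [Real.dist_eq, abs_sub_comm] at h2
  have h3 : ((⌊φ (n + 1) * c j⌋ - ⌊φ n * c j⌋ : ℤ) : ℝ) - (φ (n + 1) - φ n : ℕ) * c j =
      x (φ n) j - x (φ (n + 1)) j := by
    rw [Nat.cast_sub hlt.le]
    simp only [x, Int.fract]
    push_cast
    ring
  rwa [h3]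

/-- The part of a real divisor cut off by taking integral parts. -/
theorem exists_realDivisor_eq {ι : Type u} {l : ℕ} (hl : 1 ≤ l) {a b n : ι → ℤ}
    (h : ∀ ρ, b ρ = (a ρ + n ρ) / l) :
    ∃ t : ι → ℝ, (∀ ρ, 0 ≤ t ρ) ∧ (∀ ρ, l * t ρ ≤ l - 1) ∧
      realDivisor b = (l : ℝ)⁻¹ • realDivisor a + (l : ℝ)⁻¹ • realDivisor n - t := by
  have hl0 : (0 : ℝ) < l := by exact_mod_cast hl
  have hl1 : (0 : ℤ) < l := by exact_mod_cast hl
  -- `t` is the remainder divided by `l`. An integral remainder is at most `l - 1`, and this sharp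
  -- bound is needed for the open star and the cone.
  refine ⟨fun ρ => (l : ℝ)⁻¹ * (((a ρ + n ρ) % l : ℤ) : ℝ), fun ρ => ?_, fun ρ => ?_, ?_⟩
  · have : (0 : ℝ) ≤ (((a ρ + n ρ) % l : ℤ) : ℝ) := by
      exact_mod_cast Int.emod_nonneg _ hl1.ne'
    positivity
  · rw [mul_inv_cancel_left₀ hl0.ne']
    have h1 := Int.emod_lt_of_pos (a ρ + n ρ) hl1
    have h2 : (a ρ + n ρ) % l ≤ l - 1 := by omega
    exact_mod_cast h2
  · ext ρ
    have h1 := Int.mul_ediv_add_emod (a ρ + n ρ) l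
    rw [← h ρ] at h1
    have h2 : (l : ℝ) * b ρ + (((a ρ + n ρ) % l : ℤ) : ℝ) = a ρ + n ρ := by exact_mod_cast h1
    simp only [realDivisor, Pi.sub_apply, Pi.add_apply, Pi.smul_apply, smul_eq_mul]
    field_simp
    linarith

theorem convexHull_cubeVertex (ι : Type u) [Finite ι] :
    convexHull ℝ (Set.range fun A : Set ι => realDivisor (cubeVertex A)) = Set.Icc (-1) 0 := by
  classical
  have h1 : (Set.range fun A : Set ι => realDivisor (cubeVertex A)) =
      Set.univ.pi fun _ : ι => ({-1, 0} : Set ℝ) := by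
    ext x
    simp only [Set.mem_range, Set.mem_pi, Set.mem_univ, forall_true_left, Set.mem_insert_iff,
      Set.mem_singleton_iff]
    constructor
    · rintro ⟨A, rfl⟩ ρ
      by_cases h : ρ ∈ A <;> simp [realDivisor, cubeVertex, h]
    · intro h
      refine ⟨{ρ | x ρ = -1}, funext fun ρ => ?_⟩
      by_cases h' : x ρ = -1
      · simp [realDivisor, cubeVertex, h']
      · simp [realDivisor, cubeVertex, (h ρ).resolve_left h']
  rw [h1, convexHull_pi, ← Set.pi_univ_Icc]
  congr 1
  ext1 ρ
  rw [convexHull_pair, segment_eq_Icc (by norm_num)]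
  rfl

end Toric

/-! ### Rounded divisors and the zonotope -/

namespace Toric

namespace SmoothFan

variable {N : Type u} [AddCommGroup N] {ι : Type u} (Δ : SmoothFan N ι)
variable {W : Type*} [AddCommGroup W] [Module ℝ W] {π : (ι → ℝ) →ₗ[ℝ] W}

theorem realClass_rayValues (hπ : LinearMap.ker π = Δ.principal) (m : Module.Dual ℤ N) :
    π (realDivisor fun ρ => m (Δ.ray ρ)) = 0 := by
  have h1 : Δ.rayValues m ∈ LinearMap.ker π := by
    rw [hπ]
    exact Submodule.subset_span ⟨m, rfl⟩
  exact h1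

/-- The class of the integral part of `(a + m) / l`. -/
theorem exists_realClass_eq (hπ : LinearMap.ker π = Δ.principal) {l : ℕ} (hl : 1 ≤ l)
    {a b : ι → ℤ} {m : Module.Dual ℤ N} (h : ∀ ρ, b ρ = (a ρ + m (Δ.ray ρ)) / l) :
    ∃ t : ι → ℝ, (∀ ρ, 0 ≤ t ρ) ∧ (∀ ρ, l * t ρ ≤ l - 1) ∧
      π (realDivisor b) = (l : ℝ)⁻¹ • π (realDivisor a) - π t := by
  obtain ⟨t, h0, h1, h2⟩ := exists_realDivisor_eq hl (n := fun ρ => m (Δ.ray ρ)) h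
  refine ⟨t, h0, h1, ?_⟩
  rw [h2, map_sub, map_add, map_smul, map_smul, Δ.realClass_rayValues hπ, smul_zero, add_zero]

/-- If `[a] = π s` with `s` in the cube, then `[b] = π(s/l - t)`. Prolonging by `1/l` beyond `[b]`
leads to `(s - l(l+1)t)/l²`, which stays in the cube since `l(l+1)t ≤ (l+1)(l-1) = l² - 1` and `s ≥
-1`. -/
theorem mem_openStar_of_floor (hπ : LinearMap.ker π = Δ.principal) {l : ℕ} (hl : 1 ≤ l)
    {a b : ι → ℤ} {m : Module.Dual ℤ N} (h : ∀ ρ, b ρ = (a ρ + m (Δ.ray ρ)) / l)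
    (ha : π (realDivisor a) ∈ π '' Set.Icc (-1) 0) :
    π (realDivisor b) ∈ openStar (π '' Set.Icc (-1) 0) (π (realDivisor a)) := by
  rw [mem_openStar_iff ((convex_Icc _ _).linear_image π) ha]
  obtain ⟨t, h0, h1, h2⟩ := Δ.exists_realClass_eq hπ hl h
  obtain ⟨s, ⟨hs, hs'⟩, hsa⟩ := ha
  have hl0 : (0 : ℝ) < l := by exact_mod_cast hl
  have hl1 : (1 : ℝ) ≤ l := by exact_mod_cast hl
  rw [h2, ← hsa]
  refine ⟨⟨(l : ℝ)⁻¹ • s - t, ⟨fun ρ => ?_, fun ρ => ?_⟩, by simp⟩, (l : ℝ)⁻¹, inv_pos.2 hl0,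
    ⟨(l : ℝ)⁻¹ • s - t + (l : ℝ)⁻¹ • ((l : ℝ)⁻¹ • s - t - s), ⟨fun ρ => ?_, fun ρ => ?_⟩, by simp⟩⟩
  all_goals
    have h3 := hs ρ
    have h4 := hs' ρ
    have h5 := h0 ρ
    have h6 := h1 ρ
    simp only [Pi.sub_apply, Pi.add_apply, Pi.smul_apply, smul_eq_mul, Pi.neg_apply, Pi.one_apply,
      Pi.zero_apply] at *
  · rw [← mul_le_mul_iff_right₀ hl0]
    field_simp
    linarith
  · have : (l : ℝ)⁻¹ * s ρ ≤ 0 := mul_nonpos_of_nonneg_of_nonpos (inv_pos.2 hl0).le h4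
    linarith
  · have h7 : (l : ℝ)⁻¹ * s ρ - t ρ + (l : ℝ)⁻¹ * ((l : ℝ)⁻¹ * s ρ - t ρ - s ρ) =
      (s ρ - l * (l + 1) * t ρ) / l ^ 2 := by field_simp; ring
    rw [h7, le_div_iff₀ (by positivity)]
    nlinarith
  · have h7 : (l : ℝ)⁻¹ * s ρ - t ρ + (l : ℝ)⁻¹ * ((l : ℝ)⁻¹ * s ρ - t ρ - s ρ) =
      (s ρ - l * (l + 1) * t ρ) / l ^ 2 := by field_simp; ring
    rw [h7]
    refine div_nonpos_of_nonpos_of_nonneg ?_ (by positivity)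
    have : 0 ≤ l * (l + 1) * t ρ := by positivity
    linarith

/-- From `[a] = l[b] + l[t]` one gets `[a] - [b] = (l-1)([b] - [-(l/(l-1)) t])`, and `l t ≤ l - 1`
puts `-(l/(l-1)) t` in the cube. For `l = 1` the two classes coincide. -/
theorem mem_translatedCone_of_floor (hπ : LinearMap.ker π = Δ.principal) {l : ℕ} (hl : 1 ≤ l)
    {a b : ι → ℤ} {m : Module.Dual ℤ N} (h : ∀ ρ, b ρ = (a ρ + m (Δ.ray ρ)) / l) :
    π (realDivisor a) ∈ translatedCone (π '' Set.Icc (-1) 0) (π (realDivisor b)) := by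
  obtain ⟨t, h0, h1, h2⟩ := Δ.exists_realClass_eq hπ hl h
  have hl0 : (0 : ℝ) < l := by exact_mod_cast hl
  have h3 : π (realDivisor a) = (l : ℝ) • π (realDivisor b) + (l : ℝ) • π t := by
    rw [h2, smul_sub, smul_inv_smul₀ hl0.ne', sub_add_cancel]
  change π (realDivisor a) - π (realDivisor b) ∈ PointedCone.hull ℝ _
  rcases hl.eq_or_lt with rfl | hl'
  · have ht : t = 0 := funext fun ρ => le_antisymm (by simpa using h1 ρ) (h0 ρ)
    rw [h3, ht]
    simp
  · have hl1 : (0 : ℝ) < l - 1 := by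
      have : (1 : ℝ) < l := by exact_mod_cast hl'
      linarith
    have h4 : π (realDivisor a) - π (realDivisor b) =
        ((l : ℝ) - 1) • (π (realDivisor b) - π (-((l / (l - 1) : ℝ) • t))) := by
      rw [h3, map_neg, map_smul, sub_neg_eq_add, smul_add, smul_smul,
        mul_div_cancel₀ _ hl1.ne', sub_smul, one_smul]
      abel
    rw [h4]
    refine Submodule.smul_mem _ (⟨(l : ℝ) - 1, hl1.le⟩ : {c : ℝ // 0 ≤ c})
      (Submodule.subset_span ⟨_, ⟨_, ⟨fun ρ => ?_, fun ρ => ?_⟩, rfl⟩, rfl⟩)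
    · simp only [Pi.neg_apply, Pi.smul_apply, smul_eq_mul, Pi.one_apply, neg_le_neg_iff]
      rw [div_mul_eq_mul_div, div_le_one hl1]
      exact h1 ρ
    · simp only [Pi.neg_apply, Pi.smul_apply, smul_eq_mul, Pi.zero_apply, neg_nonpos]
      exact mul_nonneg (div_nonneg hl0.le hl1.le) (h0 ρ)

/-- For `l` large, division by `l` rounds negative integers to `-1` and nonnegative ones to `0`. So
only the signs of `a + m` matter, and they are what `coneDivisor` encodes. -/
theorem exists_cubeVertex_floor_iff [Finite ι] {A : Set ι} {a : ι → ℤ} :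
    (∃ (l : ℕ) (m : Module.Dual ℤ N), 1 ≤ l ∧
      ∀ ρ, cubeVertex A ρ = (a ρ + m (Δ.ray ρ)) / l) ↔
    ∃ (r : ι → ℕ) (m : Module.Dual ℤ N), ∀ ρ, a ρ + m (Δ.ray ρ) = coneDivisor A r ρ := by
  classical
  have hcone (r : ι → ℕ) (ρ : ι) : coneDivisor A r ρ = if ρ ∈ A then -1 - (r ρ : ℤ) else r ρ := by
    by_cases h : ρ ∈ A <;> simp [coneDivisor, cubeVertex, h]
  have hcube (ρ : ι) : cubeVertex A ρ = if ρ ∈ A then -1 else 0 := by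
    by_cases h : ρ ∈ A <;> simp [cubeVertex, h]
  constructor
  · rintro ⟨l, m, hl, h⟩
    have hl0 : (0 : ℤ) < l := by exact_mod_cast hl
    refine ⟨fun ρ => if ρ ∈ A then (-1 - (a ρ + m (Δ.ray ρ))).toNat
      else (a ρ + m (Δ.ray ρ)).toNat, m, fun ρ => ?_⟩
    have h1 := h ρ
    rw [hcube, eq_comm, Int.ediv_eq_iff_of_pos hl0] at h1
    rw [hcone]
    split_ifs at h1 ⊢ with hρ <;> omega
  · rintro ⟨r, m, h⟩
    have := Fintype.ofFinite ι
    have hle (ρ) : r ρ ≤ ∑ ρ, r ρ :=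
      Finset.single_le_sum (f := r) (fun _ _ => Nat.zero_le _) (Finset.mem_univ ρ)
    -- Rounding needs `r ρ < l` for every `ρ`; on `A` this is `-l ≤ -1 - r ρ`.
    refine ⟨∑ ρ, r ρ + 1, m, Nat.le_add_left _ _, fun ρ => ?_⟩
    have h1 := hle ρ
    rw [h, hcone, hcube, eq_comm, Int.ediv_eq_iff_of_pos (by positivity)]
    split_ifs with hρ <;> push_cast <;> [skip; skip] <;> zify at h1 <;> constructor <;> linarith

/-- The points of the open star of a vertex are rounded characters. -/
theorem exists_floor_of_mem_openStar [Module.Free ℤ N] [Module.Finite ℤ N] [Finite ι]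
    (hπ : LinearMap.ker π = Δ.principal) {A : Set ι} {b : ι → ℤ}
    (hb : π (realDivisor b) ∈
      openStar (π '' Set.Icc (-1) 0) (π (realDivisor (cubeVertex A)))) :
    ∃ (l : ℕ) (m : Module.Dual ℤ N), 1 ≤ l ∧
      ∀ ρ, b ρ = (cubeVertex A ρ + m (Δ.ray ρ)) / l := by
  classical
  have := Fintype.ofFinite ι
  have hcube (ρ : ι) : cubeVertex A ρ = if ρ ∈ A then -1 else 0 := by
    by_cases h : ρ ∈ A <;> simp [cubeVertex, h]
  have hA : π (realDivisor (cubeVertex A)) ∈ π '' Set.Icc (-1) 0 := by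
    refine ⟨_, ⟨fun ρ => ?_, fun ρ => ?_⟩, rfl⟩ <;>
      by_cases h : ρ ∈ A <;> simp [realDivisor, hcube, h]
  rw [mem_openStar_iff ((convex_Icc _ _).linear_image π) hA] at hb
  obtain ⟨-, ε, hε, w, ⟨hw, hw'⟩, hwb⟩ := hb
  have hε1 : 0 < 1 + ε := by linarith
  -- Solving `[b] + ε([b] - p) = [w]` for `[b]` shows that `b` and a weighted mean of the vertex and
  -- `w` differ by a real combination `θ` of characters.
  have hθ : realDivisor b - (1 + ε)⁻¹ • (ε • realDivisor (cubeVertex A) + w) ∈ Δ.principal := by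
    rw [← hπ, LinearMap.mem_ker, map_sub, map_smul, map_add, map_smul, hwb]
    match_scalars <;> field_simp
    all_goals ring
  let B := Module.Free.chooseBasis ℤ (Module.Dual ℤ N)
  obtain ⟨c, hc⟩ : ∃ c : Module.Free.ChooseBasisIndex ℤ (Module.Dual ℤ N) → ℝ,
      realDivisor b - (1 + ε)⁻¹ • (ε • realDivisor (cubeVertex A) + w) =
        ∑ i, c i • Δ.rayValues (B i) := by
    have hle : Δ.principal ≤ Submodule.span ℝ (Set.range fun i => Δ.rayValues (B i)) := by
      rw [principal, Submodule.span_le]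
      rintro _ ⟨m, rfl⟩
      have h1 : Δ.rayValues m = ∑ i, (B.repr m i : ℝ) • Δ.rayValues (B i) := by
        ext ρ
        have h2 := LinearMap.congr_fun (B.sum_repr m) (Δ.ray ρ)
        simp only [rayValues, Finset.sum_apply, Pi.smul_apply, smul_eq_mul]
        rw [← h2, LinearMap.sum_apply, Int.cast_sum]
        refine Finset.sum_congr rfl fun i _ => ?_
        rw [LinearMap.smul_apply, smul_eq_mul, Int.cast_mul]
      rw [h1]
      exact Submodule.sum_mem _ fun i _ => Submodule.smul_mem _ _ (Submodule.subset_span ⟨i, rfl⟩)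
    obtain ⟨c, hc⟩ := (Submodule.mem_span_range_iff_exists_fun ℝ).1 (hle hθ)
    exact ⟨c, hc.symm⟩
  set θ := realDivisor b - (1 + ε)⁻¹ • (ε • realDivisor (cubeVertex A) + w) with hθdef
  let C : ℝ := ∑ i, ∑ ρ, |Δ.rayValues (B i) ρ|
  have hC0 : 0 ≤ C := Finset.sum_nonneg fun i _ => Finset.sum_nonneg fun ρ _ => abs_nonneg _
  let δ := ε / (1 + ε)
  have hδ : 0 < δ := div_pos hε hε1
  -- The coefficients are approximated so closely that the integral character `m` differs from `q θ`
  -- by less than `δ` on each ray; the `+ 1` makes this strict and avoids division by zero.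
  obtain ⟨q, p, hq, hp⟩ := exists_nat_mul_near_int c (η := δ / (C + 1)) (by positivity)
  let m : Module.Dual ℤ N := ∑ i, p i • B i
  have hm (ρ) : |(m (Δ.ray ρ) : ℝ) - q * θ ρ| < δ := by
    have h1 : (m (Δ.ray ρ) : ℝ) - q * θ ρ = ∑ i, ((p i : ℝ) - q * c i) * Δ.rayValues (B i) ρ := by
      rw [hc]
      simp only [m, LinearMap.sum_apply, LinearMap.smul_apply, Finset.sum_apply, Pi.smul_apply,
        smul_eq_mul, rayValues, Finset.mul_sum, sub_mul, Finset.sum_sub_distrib]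
      push_cast
      congr 1
      exact Finset.sum_congr rfl fun i _ => by ring
    rw [h1]
    calc |∑ i, ((p i : ℝ) - q * c i) * Δ.rayValues (B i) ρ|
        ≤ ∑ i, |((p i : ℝ) - q * c i) * Δ.rayValues (B i) ρ| := Finset.abs_sum_le_sum_abs _ _
      _ ≤ ∑ i, δ / (C + 1) * ∑ ρ, |Δ.rayValues (B i) ρ| := Finset.sum_le_sum fun i _ => by
          rw [abs_mul]
          exact mul_le_mul (hp i).le (Finset.single_le_sum (f := fun ρ => |Δ.rayValues (B i) ρ|)
            (fun _ _ => abs_nonneg _) (Finset.mem_univ ρ)) (abs_nonneg _) (by positivity)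
      _ = δ * (C / (C + 1)) := by rw [← Finset.mul_sum, mul_div_assoc', div_mul_eq_mul_div]
      _ < δ := mul_lt_of_lt_one_right hδ ((div_lt_one (by positivity)).2 (by linarith))
  have hq0 : (0 : ℤ) < q := by exact_mod_cast hq
  have hq1 : (1 : ℝ) ≤ q := by exact_mod_cast hq
  have hδ1 : δ < 1 := (div_lt_one hε1).2 (by linarith)
  refine ⟨q, m, hq, fun ρ => ?_⟩
  rw [eq_comm, Int.ediv_eq_iff_of_pos hq0, hcube]
  have h1 := abs_lt.1 (hm ρ)
  have h2 := hw ρ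
  have h3 := hw' ρ
  -- With `δ` the weight of the vertex, an error below `δ` is just small enough. On `A` the term `q
  -- δ ≥ δ` absorbs it on the lower side, outside `A` on the upper side; on the remaining sides `δ <
  -- 1` suffices by integrality.
  have h4 : (b ρ : ℝ) = θ ρ + (δ * (cubeVertex A ρ : ℤ) + (1 - δ) * w ρ) := by
    simp only [hθdef, realDivisor, Pi.sub_apply, Pi.add_apply, Pi.smul_apply, smul_eq_mul, δ]
    field_simp
    ring
  simp only [Pi.neg_apply, Pi.one_apply, Pi.zero_apply] at h2 h3
  have h5 : -((1 - δ) * q) ≤ q * ((1 - δ) * w ρ) := by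
    have h10 : 0 ≤ (1 - δ) * q * (w ρ + 1) :=
      mul_nonneg (mul_nonneg (sub_pos.2 hδ1).le (by positivity)) (by linarith)
    linarith
  have h6 : q * ((1 - δ) * w ρ) ≤ 0 :=
    mul_nonpos_of_nonneg_of_nonpos (by positivity)
      (mul_nonpos_of_nonneg_of_nonpos (sub_pos.2 hδ1).le h3)
  rw [hcube] at h4
  by_cases hρ : ρ ∈ A
  · rw [if_pos hρ] at h4 ⊢
    have h7 : (q : ℝ) * b ρ = q * θ ρ - q * δ + q * ((1 - δ) * w ρ) := by
      rw [h4]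
      push_cast
      ring
    have h8 : ((b ρ * q : ℤ) : ℝ) < m (Δ.ray ρ) := by
      push_cast
      nlinarith
    have h9 : ((m (Δ.ray ρ) : ℤ) : ℝ) < ((b ρ * q + q + 1 : ℤ) : ℝ) := by
      push_cast
      nlinarith
    have h8' : b ρ * q < m (Δ.ray ρ) := by exact_mod_cast h8
    have h9' : m (Δ.ray ρ) < b ρ * q + q + 1 := by exact_mod_cast h9
    omega
  · rw [if_neg hρ] at h4 ⊢
    have h7 : (q : ℝ) * b ρ = q * θ ρ + q * ((1 - δ) * w ρ) := by
      rw [h4]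
      push_cast
      ring
    have h8 : ((b ρ * q - 1 : ℤ) : ℝ) < m (Δ.ray ρ) := by
      push_cast
      nlinarith
    have h9 : ((m (Δ.ray ρ) : ℤ) : ℝ) < ((b ρ * q + q : ℤ) : ℝ) := by
      push_cast
      nlinarith
    have h8' : b ρ * q - 1 < m (Δ.ray ρ) := by exact_mod_cast h8
    have h9' : m (Δ.ray ρ) < b ρ * q + q := by exact_mod_cast h9
    omega

/-- The integral parts of `(a + m) / l` fall, modulo characters, into a finite set. -/
theorem exists_finite_floor [Module.Free ℤ N] [Module.Finite ℤ N] [Finite ι] (a : ι → ℤ) :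
    ∃ S : Set (ι → ℤ), S.Finite ∧ ∀ (l : ℕ) (b : ι → ℤ) (m : Module.Dual ℤ N), 1 ≤ l →
      (∀ ρ, b ρ = (a ρ + m (Δ.ray ρ)) / l) →
      ∃ b' ∈ S, ∃ m' m'' : Module.Dual ℤ N, (∀ ρ, b' ρ = (a ρ + m' (Δ.ray ρ)) / l) ∧
        ∀ ρ, b ρ = b' ρ + m'' (Δ.ray ρ) := by
  classical
  have := Fintype.ofFinite ι
  let B := Module.Free.chooseBasis ℤ (Module.Dual ℤ N)
  -- Reducing the coordinates of `m` modulo `l` changes `b` by a principal divisor. The reduced `a +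
  -- m'` is bounded by `C * l`, so its rounding lies in a box independent of `l`.
  let C : ι → ℤ := fun ρ => |a ρ| + ∑ i, |B i (Δ.ray ρ)|
  refine ⟨Set.Icc (-C) C, Set.finite_Icc _ _, fun l b m hl h => ?_⟩
  have hl0 : (0 : ℤ) < l := by exact_mod_cast hl
  let m' : Module.Dual ℤ N := ∑ i, (B.repr m i % l) • B i
  let m'' : Module.Dual ℤ N := ∑ i, (B.repr m i / l) • B i
  have hm : m = m' + (l : ℤ) • m'' := by
    conv_lhs => rw [← B.sum_repr m]
    rw [Finset.smul_sum, ← Finset.sum_add_distrib]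
    refine Finset.sum_congr rfl fun i _ => ?_
    rw [smul_smul, ← add_smul, Int.emod_add_mul_ediv]
  have hbd (ρ) : |a ρ + m' (Δ.ray ρ)| ≤ C ρ * l := by
    have h1 : |m' (Δ.ray ρ)| ≤ (∑ i, |B i (Δ.ray ρ)|) * l := by
      simp only [m', LinearMap.sum_apply, LinearMap.smul_apply, smul_eq_mul]
      refine (Finset.abs_sum_le_sum_abs _ _).trans ?_
      rw [Finset.sum_mul]
      refine Finset.sum_le_sum fun i _ => ?_
      rw [abs_mul, abs_of_nonneg (Int.emod_nonneg _ hl0.ne'), mul_comm]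
      exact mul_le_mul_of_nonneg_left (Int.emod_lt_of_pos _ hl0).le (abs_nonneg _)
    have h2 : |a ρ| ≤ |a ρ| * l := le_mul_of_one_le_right (abs_nonneg _) hl0
    calc |a ρ + m' (Δ.ray ρ)| ≤ |a ρ| + |m' (Δ.ray ρ)| := abs_add_le _ _
      _ ≤ |a ρ| * l + (∑ i, |B i (Δ.ray ρ)|) * l := add_le_add h2 h1
      _ = C ρ * l := by simp only [C]; ring
  refine ⟨fun ρ => (a ρ + m' (Δ.ray ρ)) / l, ⟨fun ρ => ?_, fun ρ => ?_⟩, m', m'',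
    fun ρ => rfl, fun ρ => ?_⟩
  · rw [Int.le_ediv_iff_mul_le hl0]
    have := (abs_le.1 (hbd ρ)).1
    simpa using this
  · refine Int.ediv_le_of_le_mul hl0 ?_
    exact (abs_le.1 (hbd ρ)).2
  · rw [h, hm, LinearMap.add_apply, LinearMap.smul_apply, smul_eq_mul, ← add_assoc,
      Int.add_mul_ediv_left _ _ hl0.ne']

-- Up to principal divisors only finitely many `b` occur. If `[b]` is outside `Z`, then so is `[b] -
-- [a]/l` for large `l`, by closedness; but this class is `-[t]`, which lies in `Z`.
open scoped Pointwise in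
theorem eventually_mem_of_floor [Module.Free ℤ N] [Module.Finite ℤ N] [Finite ι]
    (hπ : LinearMap.ker π = Δ.principal) (a : ι → ℤ) :
    ∃ l₀ : ℕ, 1 ≤ l₀ ∧ ∀ l ≥ l₀, ∀ (b : ι → ℤ) (m : Module.Dual ℤ N),
      (∀ ρ, b ρ = (a ρ + m (Δ.ray ρ)) / l) → π (realDivisor b) ∈ π '' Set.Icc (-1) 0 := by
  have := Fintype.ofFinite ι
  obtain ⟨S, hS, hSb⟩ := Δ.exists_finite_floor a
  -- Limits are taken in `ℝ^{Σ(1)}`: the preimage of `Z` is a linear subspace plus a compact cube,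
  -- hence closed.
  have hclosed : IsClosed (π ⁻¹' (π '' Set.Icc (-1) 0)) := by
    have h1 : π ⁻¹' (π '' Set.Icc (-1) 0) =
        (LinearMap.ker π : Set (ι → ℝ)) + Set.Icc (-1 : ι → ℝ) 0 := by
      ext x
      rw [Set.mem_add]
      constructor
      · rintro ⟨y, hy, hyx⟩
        exact ⟨x - y, by simp [hyx], y, hy, sub_add_cancel _ _⟩
      · rintro ⟨y, hy, z, hz, rfl⟩
        exact ⟨z, hz, by rw [map_add, (LinearMap.mem_ker.1 hy), zero_add]⟩
    rw [h1]
    exact (Submodule.closed_of_finiteDimensional _).add_right_of_isCompact isCompact_Icc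
  have hev : ∀ᶠ l : ℕ in Filter.atTop, ∀ b ∈ S, π (realDivisor b) ∉ π '' Set.Icc (-1) 0 →
      π (realDivisor b - (l : ℝ)⁻¹ • realDivisor a) ∉ π '' Set.Icc (-1) 0 := by
    rw [Filter.eventually_all_finite hS]
    intro b _
    by_cases hb : π (realDivisor b) ∈ π '' Set.Icc (-1) 0
    · exact Filter.Eventually.of_forall fun _ h => absurd hb h
    · have h1 : Filter.Tendsto (fun l : ℕ => realDivisor b - (l : ℝ)⁻¹ • realDivisor a)
          Filter.atTop (nhds (realDivisor b - (0 : ℝ) • realDivisor a)) :=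
        tendsto_const_nhds.sub (tendsto_inv_atTop_nhds_zero_nat.smul_const _)
      rw [zero_smul, sub_zero] at h1
      filter_upwards [h1.eventually (hclosed.isOpen_compl.mem_nhds hb)] with l hl _
      exact hl
  obtain ⟨l₀, hl₀⟩ := Filter.eventually_atTop.1 hev
  refine ⟨max l₀ 1, le_max_right _ _, fun l hl b m h => ?_⟩
  have hl1 : 1 ≤ l := (le_max_right _ _).trans hl
  obtain ⟨b', hb', m', m'', h', hbb⟩ := hSb l b m hl1 h
  have h1 : π (realDivisor b) = π (realDivisor b') := by
    have h2 : b = b' + fun ρ => m'' (Δ.ray ρ) := funext hbb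
    rw [h2, realDivisor_add, map_add, Δ.realClass_rayValues hπ, add_zero]
  rw [h1]
  by_contra hcon
  refine hl₀ l ((le_max_left _ _).trans hl) b' hb' hcon ?_
  obtain ⟨t, h3, h4, h5⟩ := Δ.exists_realClass_eq hπ hl1 h'
  have hl0 : (1 : ℝ) ≤ l := by exact_mod_cast hl1
  refine ⟨-t, ⟨fun ρ => ?_, fun ρ => ?_⟩, ?_⟩
  · have h6 := h3 ρ
    have h7 := h4 ρ
    simp only [Pi.neg_apply, Pi.one_apply, neg_le_neg_iff]
    nlinarith
  · simpa using h3 ρ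
  · rw [map_sub, map_smul, h5, map_neg]
    abel

end SmoothFan

end Toric

/-! ### Conclusion -/

namespace Toric

namespace SmoothFan

variable {N : Type u} [AddCommGroup N] {ι : Type u} (Δ : SmoothFan N ι)
variable (k : Type u) [Field k]

theorem zonotope_eq [Finite ι] {π : (ι → ℝ) →ₗ[ℝ] PicReal (Δ.variety k)}
    (hπ : ∀ a : ι → ℤ, π (realDivisor a) = (Δ.divisorBundle k a).cls.toReal) :
    Δ.zonotope k = π '' Set.Icc (-1) 0 := by
  rw [zonotope, ← convexHull_cubeVertex, LinearMap.image_convexHull, ← Set.range_comp]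
  congr 2
  ext1 A
  exact (hπ _).symm

theorem cls_cubeVertex_mem_frob_iff [Finite ι] {L : LineBundle (Δ.variety k)} {a : ι → ℤ}
    (ha : (Δ.divisorBundle k a).cls = L.cls) (A : Set ι) :
    (Δ.divisorBundle k (cubeVertex A)).cls ∈ Δ.frob k L ↔
      ∃ r : ι → ℕ, L.cls = (Δ.divisorBundle k (coneDivisor A r)).cls := by
  have h1 : (∃ r : ι → ℕ, L.cls = (Δ.divisorBundle k (coneDivisor A r)).cls) ↔
      ∃ (r : ι → ℕ) (m : Module.Dual ℤ N), ∀ ρ, a ρ + m (Δ.ray ρ) = coneDivisor A r ρ := by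
    refine exists_congr fun r => ?_
    rw [← ha, eq_comm, Δ.cls_divisorBundle_eq_iff k]
    exact exists_congr fun m => forall_congr' fun ρ => eq_comm
  rw [h1, ← Δ.exists_cubeVertex_floor_iff]
  constructor
  · rintro ⟨l, hl, hP⟩
    obtain ⟨b, m, hb, hbm⟩ := (Δ.mem_frobAt_iff k hl ha).1 hP
    obtain ⟨m', hm'⟩ := (Δ.cls_divisorBundle_eq_iff k).1 hb.symm
    -- A principal correction `m'` outside the integral part is `l • m'` inside it.
    refine ⟨l, m + (l : ℤ) • m', hl, fun ρ => ?_⟩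
    have hl0 : (l : ℤ) ≠ 0 := by exact_mod_cast (Nat.pos_iff_ne_zero.1 hl)
    rw [hm', hbm, LinearMap.add_apply, LinearMap.smul_apply, smul_eq_mul, ← add_assoc,
      Int.add_mul_ediv_left _ _ hl0]
  · rintro ⟨l, m, hl, h⟩
    exact ⟨l, hl, (Δ.mem_frobAt_iff k hl ha).2 ⟨_, m, rfl, h⟩⟩

end SmoothFan

end Toric

end

theorem proposition4p9 {k : Type u} [Field k] [IsAlgClosed k]
    {N : Type u} [AddCommGroup N] [Module.Free ℤ N] [Module.Finite ℤ N]
    {ι : Type u} [Finite ι] (Δ : Toric.SmoothFan N ι) (L : Toric.LineBundle (Δ.variety k)) :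
    (∃ l₀ : ℕ, ∀ l ≥ l₀, ∀ E ∈ Δ.frobAt k l L, E.toReal ∈ Δ.zonotope k) ∧
    (L.cls.toReal ∈ Δ.zonotope k →
      ∀ E ∈ Δ.frob k L, E.toReal ∈ Toric.openStar (Δ.zonotope k) L.cls.toReal) ∧
    (∀ A : Set ι, L.cls = (Δ.divisorBundle k (Toric.cubeVertex A)).cls →
      Δ.frob k L = {E | E.toReal ∈ Toric.openStar (Δ.zonotope k) L.cls.toReal}) ∧
    (∀ p ∈ Δ.frob k L, p.toReal ∈ Δ.zonotope k →
      L.cls.toReal ∈ Toric.translatedCone (Δ.zonotope k) p.toReal) ∧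
    (∀ A : Set ι, (Δ.divisorBundle k (Toric.cubeVertex A)).cls ∈ Δ.frob k L ↔
      ∃ r : ι → ℕ, L.cls = (Δ.divisorBundle k (Toric.coneDivisor A r)).cls) := by

  obtain ⟨a, ha⟩ := Δ.exists_cls_divisorBundle_eq k L.cls
  obtain ⟨π, hπ, hker⟩ := Δ.exists_realClass k
  have hfloor {l : ℕ} (hl : 1 ≤ l) {P : Toric.Pic (Δ.variety k)} (hP : P ∈ Δ.frobAt k l L) :
      ∃ (b : ι → ℤ) (m : Module.Dual ℤ N), π (Toric.realDivisor b) = P.toReal ∧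
        ∀ ρ, b ρ = (a ρ + m (Δ.ray ρ)) / l := by
    obtain ⟨b, m, rfl, h⟩ := (Δ.mem_frobAt_iff k hl ha).1 hP
    exact ⟨b, m, hπ b, h⟩
  have hstar (hL : L.cls.toReal ∈ Δ.zonotope k) :
      ∀ E ∈ Δ.frob k L, E.toReal ∈ Toric.openStar (Δ.zonotope k) L.cls.toReal := by
    rintro E ⟨l, hl, hE⟩
    obtain ⟨b, m, hb, h⟩ := hfloor hl hE
    rw [Δ.zonotope_eq k hπ, ← ha, ← hπ] at hL
    rw [Δ.zonotope_eq k hπ, ← ha, ← hπ, ← hb]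
    exact Δ.mem_openStar_of_floor hker hl h hL
  refine ⟨?_, hstar, fun A hA => ?_, ?_, Δ.cls_cubeVertex_mem_frob_iff k ha⟩
  · obtain ⟨l₀, hl₀, h₀⟩ := Δ.eventually_mem_of_floor hker a
    refine ⟨l₀, fun l hl E hE => ?_⟩
    obtain ⟨b, m, hb, h⟩ := hfloor (hl₀.trans hl) hE
    rw [Δ.zonotope_eq k hπ, ← hb]
    exact h₀ l hl b m h
  · refine Set.Subset.antisymm (hstar ?_) fun E hE => ?_
    · rw [hA]
      exact subset_convexHull ℝ _ ⟨A, rfl⟩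
    · obtain ⟨b, rfl⟩ := Δ.exists_cls_divisorBundle_eq k E
      change (Δ.divisorBundle k b).cls.toReal ∈ Toric.openStar _ _ at hE
      rw [hA, Δ.zonotope_eq k hπ, ← hπ, ← hπ] at hE
      -- Here `L` is represented by `cubeVertex A` itself, not by the divisor `a` chosen at the
      -- start.
      obtain ⟨l, m, hl, h⟩ := Δ.exists_floor_of_mem_openStar hker hE
      exact ⟨l, hl, (Δ.mem_frobAt_iff k hl hA.symm).2 ⟨b, m, rfl, h⟩⟩
  · rintro P ⟨l, hl, hP⟩ -
    obtain ⟨b, m, hb, h⟩ := hfloor hl hP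
    rw [Δ.zonotope_eq k hπ, ← ha, ← hπ, ← hb]
    exact Δ.mem_translatedCone_of_floor hker hl h
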